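/- Max algebra is the semiring $\mathbb{R}_+$ of nonnegative reals with $a\oplus b=\max(a,b)$ and ordinary multiplication; $\otimes$ denotes the corresponding matrix product, $(A\otimes B)_{ij}=\max_k a_{ik}b_{kj}$, and powers of matrices are meant in this sense, with $A^0=I$. Let $A\in\mathbb{R}_+^{n\times n}$ be irreducible, i.e. in the digraph with edges $\{(i,j): a_{ij}\neq 0\}$ every node can be reached from every node, and let $$\lambda(A)=\max_{1\le k\le n}\bigl(\max_i (A^k)_{ii}\bigr)^{1/k}$$ be its maximum cycle geometric mean. Assume $\lambda(A)\neq 0$ (this excludes only the $1\times1$ zero matrix), and put $\hat A=A/\lambda(A)$, so that $\lambda(\hat A)=1$, and $\hat A=A$ if $\lambda(A)=1$. The critical graph of $\hat A$ consists of the nodes and edges on cycles whose geometric mean of weights equals $\lambda(\hat A)$. Let $\gamma$ be its cyclicity, i.e. the least common multiple, over its strongly connected components, of the greatest common divisor of the lengths of the cycles in the component. Let $T$ be the least integer such that $\hat A^{r+\gamma}=\hat A^r$ for all $r\ge T$. For an integer $t\ge 0$ let $\operatorname{Attr}(\hat A,t)$ be the set of all $x\in\mathbb{R}_+^n$ for which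 $\hat A^{r}\otimes x=\hat A^{r+t}\otimes x$ for some $r\ge0$. **Theorem.** For every irreducible $A\in\mathbb{R}_+^{n\times n}$ with $\lambda(A)\ne0$, each of the following problems can be solved in $O(n^3\log n)$ time. P1. Given $A$, $x\in\mathbb{R}_+^n$ and an integer $t\ge 0$, decide whether $x\in\operatorname{Attr}(\hat A,t)$. P2. Given $A$ and an integer $k$ with $0\le k<\gamma$, compute the periodic power $\hat A^r$ with $r\equiv k \pmod\gamma$, i.e. the matrix that equals $\hat A^r$ for all $r\ge T$ with $r\equiv k\pmod \gamma$. P3. Given $A$ and $x\in\mathbb{R}_+^n$, compute the ultimate period of the orbit $\{\hat A^r\otimes x\}_{r\ge0}$, i.e. the least integer $\alpha\ge1$ such that $\hat A^{r+\alpha}\otimes x=\hat A^r\otimes x$ for all $r\ge T$. Here time is the number of steps of a random access machine with exact nonnegative reals, with unit cost for each operation, memory access and control step. The operations are: maximum, product, quotient, $k$-th roots and comparison of reals; addition, truncated subtraction, quotient, remainder and comparison of nonnegative integers. For each problem there are one program and one constant $C$ such that for all $n$ and all inputs the program halts with the correct answer within $C\,n^3(\lfloor\log_2 n\rfloor+1)$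 steps. -/

import Mathlib

open scoped NNReal

namespace MaxTimes

noncomputable section

/-! ### Max algebra over the nonnegative reals -/

/-- Max-times matrix product: `(A ⊗ B) i j = max_k (A i k * B k j)`. -/
def mmul {n : ℕ} (A B : Matrix (Fin n) (Fin n) ℝ≥0) : Matrix (Fin n) (Fin n) ℝ≥0 :=
  fun i j => Finset.univ.sup fun k => A i k * B k j

/-- Max-times powers, `A ^ 0` being the identity matrix. -/
def mpow {n : ℕ} (A : Matrix (Fin n) (Fin n) ℝ≥0) : ℕ → Matrix (Fin n) (Fin n) ℝ≥0
  | 0 => 1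
  | k + 1 => mmul (mpow A k) A

/-- Max-times matrix-vector product: `(A ⊗ x) i = max_k (A i k * x k)`. -/
def mvec {n : ℕ} (A : Matrix (Fin n) (Fin n) ℝ≥0) (x : Fin n → ℝ≥0) : Fin n → ℝ≥0 :=
  fun i => Finset.univ.sup fun k => A i k * x k

/-- `A` is irreducible: in the digraph with an edge `(i, j)` whenever `A i j ≠ 0`, every node can
be reached from every node (a node is reached from itself by the one-node path). -/
def Irred {n : ℕ} (A : Matrix (Fin n) (Fin n) ℝ≥0) : Prop :=
  ∀ i j, Relation.ReflTransGen (fun u v => A u v ≠ 0) i j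

/-- The maximum cycle geometric mean `λ(A) = max_{1 ≤ k ≤ n} (max_i (A ^ k) i i) ^ (1 / k)`. -/
def mcgm {n : ℕ} (A : Matrix (Fin n) (Fin n) ℝ≥0) : ℝ≥0 :=
  (Finset.Icc 1 n).sup fun k => (Finset.univ.sup fun i => mpow A k i i) ^ (1 / (k : ℝ))

/-- The definite matrix `A / λ(A)` (for `λ(A) ≠ 0`); it is `A` itself if `λ(A) = 1`. -/
def normalized {n : ℕ} (A : Matrix (Fin n) (Fin n) ℝ≥0) : Matrix (Fin n) (Fin n) ℝ≥0 :=
  fun i j => A i j / mcgm A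

/-! ### The critical graph, its cyclicity, and the periodic regime -/

/-- `c 0, c 1, …, c k = c 0` is a cycle of length `k ≥ 1` of the digraph with edge relation `E`. -/
def IsCycleOf {V : Type*} (E : V → V → Prop) (k : ℕ) (c : ℕ → V) : Prop :=
  0 < k ∧ c k = c 0 ∧ ∀ l < k, E (c l) (c (l + 1))

/-- The geometric mean of the weights along `c 0, c 1, …, c k`. -/
def geomMean {n : ℕ} (A : Matrix (Fin n) (Fin n) ℝ≥0) (k : ℕ) (c : ℕ → Fin n) : ℝ≥0 :=
  (∏ l ∈ Finset.range k, A (c l) (c (l + 1))) ^ (1 / (k : ℝ))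

/-- The edges of the critical graph: those lying on a cycle with geometric mean `λ(A)`. -/
def CritEdge {n : ℕ} (A : Matrix (Fin n) (Fin n) ℝ≥0) (i j : Fin n) : Prop :=
  ∃ (k : ℕ) (c : ℕ → Fin n), IsCycleOf (fun u v => A u v ≠ 0) k c ∧ geomMean A k c = mcgm A ∧
    ∃ l < k, c l = i ∧ c (l + 1) = j

/-- The nodes of the critical graph. -/
def CritNode {n : ℕ} (A : Matrix (Fin n) (Fin n) ℝ≥0) (i : Fin n) : Prop :=
  ∃ j, CritEdge A i j

/-- The cyclicity of the strongly connected component of `i`: the greatest common divisor of the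
lengths of all cycles in that component (used only for components that have a cycle). -/
def compCyclicity {V : Type*} (E : V → V → Prop) (i : V) : ℕ :=
  sSup {d : ℕ | ∀ (k : ℕ) (c : ℕ → V), IsCycleOf E k c →
    Relation.ReflTransGen E i (c 0) → Relation.ReflTransGen E (c 0) i → d ∣ k}

open scoped Classical in
/-- The cyclicity `γ` of the critical graph: the least common multiple of the cyclicities of its
strongly connected components. -/
def cyclicity {n : ℕ} (A : Matrix (Fin n) (Fin n) ℝ≥0) : ℕ :=
  (Finset.univ.filter fun i => CritNode A i).lcm fun i => compCyclicity (CritEdge A) i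

/-- The transient `T(A)`: the least `T` such that `A ^ (r + γ) = A ^ r` for all `r ≥ T`. -/
def transient {n : ℕ} (A : Matrix (Fin n) (Fin n) ℝ≥0) : ℕ :=
  sInf {T : ℕ | ∀ r, T ≤ r → mpow A (r + cyclicity A) = mpow A r}

/-- The attraction cone `Attr(A, t)`. -/
def Attr {n : ℕ} (A : Matrix (Fin n) (Fin n) ℝ≥0) (t : ℕ) : Set (Fin n → ℝ≥0) :=
  {x | ∃ r, mvec (mpow A r) x = mvec (mpow A (r + t)) x}

/-- `α` is the ultimate period of the orbit `A ^ r ⊗ x`: the least positive integer such that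
`A ^ (r + α) ⊗ x = A ^ r ⊗ x` for all `r ≥ T(A)`. -/
def IsUltimatePeriod {n : ℕ} (A : Matrix (Fin n) (Fin n) ℝ≥0) (x : Fin n → ℝ≥0) (α : ℕ) : Prop :=
  IsLeast {a : ℕ | 0 < a ∧
    ∀ r, transient A ≤ r → mvec (mpow A (r + a)) x = mvec (mpow A r) x} α

/-! ### The machine model

A random access machine with exact nonnegative real numbers, programmed in a structured language.
Its memory consists of arrays of natural numbers and arrays of nonnegative reals; the cell
`(i, j)` of array number `a` is addressed by integer expressions for `i` and `j`, whereas `a` is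
fixed in the program text, so that a program uses finitely many arrays. Reals are handled only by
the operations of max algebra (maximum, product, quotient, integer roots) and by comparisons.
Integers have addition, truncated subtraction, quotient and remainder, but no product, so that
the length of integers grows at most by a constant per step. Each operation, memory access
and control step costs one unit. -/

/-- The memory. -/
structure Store where
  int : ℕ → ℕ → ℕ → ℕ
  real : ℕ → ℕ → ℕ → ℝ≥0

/-- Integer expressions. -/
inductive IExp where
  | const (c : ℕ)
  | get (a : ℕ) (i j : IExp)
  | add (e f : IExp)
  | sub (e f : IExp)
  | div (e f : IExp)
  | mod (e f : IExp)

/-- Real expressions; `root k e` is the `k`-th root of `e`. -/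
inductive RExp where
  | zero
  | one
  | get (a : ℕ) (i j : IExp)
  | max (e f : RExp)
  | mul (e f : RExp)
  | div (e f : RExp)
  | root (k : IExp) (e : RExp)

/-- Tests. -/
inductive Test where
  | ile (e f : IExp)
  | rle (e f : RExp)
  | not (b : Test)
  | and (b c : Test)

/-- Programs. -/
inductive Prog where
  | skip
  | setI (a : ℕ) (i j e : IExp)
  | setR (a : ℕ) (i j : IExp) (e : RExp)
  | seq (p q : Prog)
  | ite (b : Test) (p q : Prog)
  | while (b : Test) (p : Prog)

def IExp.eval (s : Store) : IExp → ℕ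
  | .const c => c
  | .get a i j => s.int a (i.eval s) (j.eval s)
  | .add e f => e.eval s + f.eval s
  | .sub e f => e.eval s - f.eval s
  | .div e f => e.eval s / f.eval s
  | .mod e f => e.eval s % f.eval s

/-- The number of operations in the evaluation of an integer expression. -/
def IExp.cost : IExp → ℕ
  | .const _ => 1
  | .get _ i j => i.cost + j.cost + 1
  | .add e f => e.cost + f.cost + 1
  | .sub e f => e.cost + f.cost + 1
  | .div e f => e.cost + f.cost + 1
  | .mod e f => e.cost + f.cost + 1

def RExp.eval (s : Store) : RExp → ℝ≥0
  | .zero => 0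
  | .one => 1
  | .get a i j => s.real a (i.eval s) (j.eval s)
  | .max e f => e.eval s ⊔ f.eval s
  | .mul e f => e.eval s * f.eval s
  | .div e f => e.eval s / f.eval s
  | .root k e => e.eval s ^ (1 / (k.eval s : ℝ))

/-- The number of operations in the evaluation of a real expression. -/
def RExp.cost : RExp → ℕ
  | .zero => 1
  | .one => 1
  | .get _ i j => i.cost + j.cost + 1
  | .max e f => e.cost + f.cost + 1
  | .mul e f => e.cost + f.cost + 1
  | .div e f => e.cost + f.cost + 1
  | .root k e => k.cost + e.cost + 1

def Test.Holds (s : Store) : Test → Prop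
  | .ile e f => e.eval s ≤ f.eval s
  | .rle e f => e.eval s ≤ f.eval s
  | .not b => ¬ b.Holds s
  | .and b c => b.Holds s ∧ c.Holds s

/-- The number of operations in the evaluation of a test. -/
def Test.cost : Test → ℕ
  | .ile e f => e.cost + f.cost + 1
  | .rle e f => e.cost + f.cost + 1
  | .not b => b.cost + 1
  | .and b c => b.cost + c.cost + 1

/-- Overwrite one integer cell. -/
def Store.setInt (s : Store) (a i j v : ℕ) : Store :=
  { s with int := fun a' i' j' => if a' = a ∧ i' = i ∧ j' = j then v else s.int a' i' j' }

/-- Overwrite one real cell. -/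
def Store.setReal (s : Store) (a i j : ℕ) (v : ℝ≥0) : Store :=
  { s with real := fun a' i' j' => if a' = a ∧ i' = i ∧ j' = j then v else s.real a' i' j' }

/-- `Exec p s k s'`: started on the memory `s`, the program `p` halts after exactly `k` steps with
the memory `s'`. -/
inductive Exec : Prog → Store → ℕ → Store → Prop where
  | skip (s : Store) : Exec .skip s 1 s
  | setI (a : ℕ) (i j e : IExp) (s : Store) :
      Exec (.setI a i j e) s (i.cost + j.cost + e.cost + 1)
        (s.setInt a (i.eval s) (j.eval s) (e.eval s))
  | setR (a : ℕ) (i j : IExp) (e : RExp) (s : Store) :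
      Exec (.setR a i j e) s (i.cost + j.cost + e.cost + 1)
        (s.setReal a (i.eval s) (j.eval s) (e.eval s))
  | seq {p q : Prog} {s s' s'' : Store} {k l : ℕ} :
      Exec p s k s' → Exec q s' l s'' → Exec (.seq p q) s (k + l) s''
  | iteTrue {b : Test} {p q : Prog} {s s' : Store} {k : ℕ} :
      b.Holds s → Exec p s k s' → Exec (.ite b p q) s (b.cost + 1 + k) s'
  | iteFalse {b : Test} {p q : Prog} {s s' : Store} {k : ℕ} :
      ¬ b.Holds s → Exec q s k s' → Exec (.ite b p q) s (b.cost + 1 + k) s'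
  | whileFalse {b : Test} {p : Prog} {s : Store} :
      ¬ b.Holds s → Exec (.while b p) s (b.cost + 1) s
  | whileTrue {b : Test} {p : Prog} {s s' s'' : Store} {k l : ℕ} :
      b.Holds s → Exec p s k s' → Exec (.while b p) s' l s'' →
        Exec (.while b p) s (b.cost + 1 + k + l) s''

/-- On the memory `s`, the program `p` halts within `N` steps, with a memory satisfying `post`. -/
def HaltsWithin (p : Prog) (s : Store) (N : ℕ) (post : Store → Prop) : Prop :=
  ∃ k s', Exec p s k s' ∧ k ≤ N ∧ post s'

/-- The initial memory for the dimension `n`, the matrix `A`, the vector `x` and the integer `m`: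
integer cells `(0, 0)` of arrays `0` and `1` hold `n` and `m`, real array `0` holds `A` and the
first column of real array `1` holds `x`; everything else is `0`. -/
def input {n : ℕ} (A : Matrix (Fin n) (Fin n) ℝ≥0) (x : Fin n → ℝ≥0) (m : ℕ) : Store where
  int := fun a i j => if i = 0 ∧ j = 0 then (if a = 0 then n else if a = 1 then m else 0) else 0
  real := fun a i j =>
    if hi : i < n then
      if a = 0 then (if hj : j < n then A ⟨i, hi⟩ ⟨j, hj⟩ else 0)
      else if a = 1 ∧ j = 0 then x ⟨i, hi⟩ else 0
    else 0

/-- The integer output. -/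
def Store.outInt (s : Store) : ℕ := s.int 2 0 0

/-- The output matrix. -/
def Store.outMatrix (s : Store) (n : ℕ) : Matrix (Fin n) (Fin n) ℝ≥0 :=
  fun i j => s.real 2 i j

end

end MaxTimes

/-! Let `B = A / λ(A)`, so that no closed walk of `B` has weight greater than `1`. A critical edge
lies on a closed walk of weight `1` and length `l ≤ n`. An optimal walk from a node of this closed
walk can be shortened below the length `n * l` by removing closed subwalks, with its length modulo
`l` preserved, and prolonged again by turns of the closed walk. Hence, from the exponent `n ^ 2` on,
the row of a critical node in the powers of `B` is periodic with a period at most `n`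
(`UnitNode.row_period`), and the rows of the two ends of a critical edge are proportional
(`UnitEdge.row`); likewise for columns.

Closed walks that avoid critical nodes have weights bounded by some `m < 1`, and so by
irreducibility long optimal walks meet a critical node. By the previous remarks the position of this
meeting can be moved at will (`UnitNode.shift`). Therefore a large power of `B` is the product of
the critical columns of `B ^ a` and the critical rows of `B ^ b`, for any `a, b ≥ n ^ 2`
(`eventually_factor`). It follows that the cyclicity of the critical graph is a period of the powers
(`mpow_add_cyclicity`), that a number is an eventual period of an orbit iff it is one of its
critical coordinates (`evPeriod_orbit_iff`), and that a periodic power is the product of `B ^ q`,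
for one `q ≥ n ^ 2`, and a matrix with the critical rows of powers whose exponents matter modulo the
periods of these rows only (`mmul_eq_periodic_power`).

All algorithms start by computing `λ(A)` from Karp's formula (`karp`) in `O(n ^ 3)` steps, a power
`B ^ q` with `q ≥ n ^ 2` and the entrywise maximum of `B, …, B ^ q` by `O(log n)` matrix products,
and from these a critical edge leaving each critical node (`prepProg_spec`). From the `2 * n + 1`
terms of the orbit of `x` that follow `B ^ q ⊗ x`, the period of each critical coordinate is found
by comparing `n` consecutive terms (`evPeriod_iff_window`), and the ultimate period of the orbit is
the least common multiple of these periods. The vector `x` is attracted iff this number divides `t`.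
For the periodic powers, the chosen critical edges are followed from a critical node `c`. They run
into a cycle, whose length `L` is a period of the row of `c`; moving along `e < L` edges shows the
row of `c` in `B ^ (q + e)` to be a multiple of a row of `B ^ q` (`mpow_row_walk`).

Programs are verified with partial specifications in terms of `HaltsWithin`. The rule for counting
loops is `HaltsWithin.forLoop`; what a program leaves unchanged follows from the lists of arrays it
writes (`Frame`, `Exec.frame`). -/

namespace MaxTimes

/-! ### Max-times matrix algebra -/

section Algebra

variable {n : ℕ} {A B : Matrix (Fin n) (Fin n) ℝ≥0}

theorem le_mmul (A B : Matrix (Fin n) (Fin n) ℝ≥0) (i k j : Fin n) :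
    A i k * B k j ≤ mmul A B i j :=
  Finset.le_sup (f := fun k => A i k * B k j) (Finset.mem_univ k)

theorem exists_mmul_eq (A B : Matrix (Fin n) (Fin n) ℝ≥0) (i j : Fin n) :
    ∃ k, mmul A B i j = A i k * B k j := by
  obtain ⟨k, -, hk⟩ := Finset.exists_mem_eq_sup Finset.univ ⟨i, Finset.mem_univ i⟩
    fun k => A i k * B k j
  exact ⟨k, hk⟩

theorem mmul_le_iff {A B : Matrix (Fin n) (Fin n) ℝ≥0} {i j : Fin n} {b : ℝ≥0} :
    mmul A B i j ≤ b ↔ ∀ k, A i k * B k j ≤ b := by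
  simp [mmul]

theorem le_mvec (A : Matrix (Fin n) (Fin n) ℝ≥0) (x : Fin n → ℝ≥0) (i k : Fin n) :
    A i k * x k ≤ mvec A x i :=
  Finset.le_sup (f := fun k => A i k * x k) (Finset.mem_univ k)

theorem exists_mvec_eq (A : Matrix (Fin n) (Fin n) ℝ≥0) (x : Fin n → ℝ≥0) (i : Fin n) :
    ∃ k, mvec A x i = A i k * x k := by
  obtain ⟨k, -, hk⟩ := Finset.exists_mem_eq_sup Finset.univ ⟨i, Finset.mem_univ i⟩
    fun k => A i k * x k
  exact ⟨k, hk⟩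

theorem mmul_assoc (A B C : Matrix (Fin n) (Fin n) ℝ≥0) :
    mmul (mmul A B) C = mmul A (mmul B C) := by
  ext i j : 2
  apply le_antisymm
  · obtain ⟨k, hk⟩ := exists_mmul_eq (mmul A B) C i j
    obtain ⟨l, hl⟩ := exists_mmul_eq A B i k
    rw [hk, hl, mul_assoc]
    exact (mul_le_mul_right (le_mmul B C l k j) _).trans (le_mmul A _ i l j)
  · obtain ⟨k, hk⟩ := exists_mmul_eq A (mmul B C) i j
    obtain ⟨l, hl⟩ := exists_mmul_eq B C k j
    rw [hk, hl, ← mul_assoc]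
    exact (mul_le_mul_left (le_mmul A B i k l) _).trans (le_mmul _ C i l j)

theorem mvec_mmul (A B : Matrix (Fin n) (Fin n) ℝ≥0) (x : Fin n → ℝ≥0) :
    mvec (mmul A B) x = mvec A (mvec B x) := by
  ext1 i
  apply le_antisymm
  · obtain ⟨k, hk⟩ := exists_mvec_eq (mmul A B) x i
    obtain ⟨l, hl⟩ := exists_mmul_eq A B i k
    rw [hk, hl, mul_assoc]
    exact (mul_le_mul_right (le_mvec B x l k) _).trans (le_mvec A _ i l)
  · obtain ⟨k, hk⟩ := exists_mvec_eq A (mvec B x) i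
    obtain ⟨l, hl⟩ := exists_mvec_eq B x k
    rw [hk, hl, ← mul_assoc]
    exact (mul_le_mul_left (le_mmul A B i k l) _).trans (le_mvec _ x i l)

theorem mmul_one (A : Matrix (Fin n) (Fin n) ℝ≥0) : mmul A 1 = A := by
  ext i j : 2
  apply le_antisymm
  · refine mmul_le_iff.2 fun k => ?_
    by_cases h : k = j
    · subst h; simp
    · simp [Matrix.one_apply_ne h]
  · simpa using le_mmul A 1 i j j

theorem one_mmul (A : Matrix (Fin n) (Fin n) ℝ≥0) : mmul 1 A = A := by
  ext i j : 2
  apply le_antisymm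
  · refine mmul_le_iff.2 fun k => ?_
    by_cases h : i = k
    · subst h; simp
    · simp [Matrix.one_apply_ne h]
  · simpa using le_mmul 1 A i i j

theorem mpow_add (A : Matrix (Fin n) (Fin n) ℝ≥0) (a b : ℕ) :
    mpow A (a + b) = mmul (mpow A a) (mpow A b) := by
  induction b with
  | zero => simp [mpow, mmul_one]
  | succ b ih => rw [← add_assoc, mpow, ih, mmul_assoc]; rfl

@[simp] theorem mpow_zero (A : Matrix (Fin n) (Fin n) ℝ≥0) : mpow A 0 = 1 := rfl

@[simp] theorem mpow_one (A : Matrix (Fin n) (Fin n) ℝ≥0) : mpow A 1 = A := by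
  simp [mpow, one_mmul]

theorem mpow_mul_le (A : Matrix (Fin n) (Fin n) ℝ≥0) (a b : ℕ) (i k j : Fin n) :
    mpow A a i k * mpow A b k j ≤ mpow A (a + b) i j := by
  rw [mpow_add]; exact le_mmul _ _ i k j

theorem exists_mpow_add_eq (A : Matrix (Fin n) (Fin n) ℝ≥0) (a b : ℕ) (i j : Fin n) :
    ∃ k, mpow A (a + b) i j = mpow A a i k * mpow A b k j := by
  rw [mpow_add]; exact exists_mmul_eq _ _ i j

theorem mul_mpow_le (A : Matrix (Fin n) (Fin n) ℝ≥0) (r : ℕ) (i k j : Fin n) :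
    A i k * mpow A r k j ≤ mpow A (r + 1) i j := by
  have := mpow_mul_le A 1 r i k j
  rwa [mpow_one, add_comm] at this

theorem exists_mpow_succ_eq (A : Matrix (Fin n) (Fin n) ℝ≥0) (r : ℕ) (i j : Fin n) :
    ∃ k, mpow A (r + 1) i j = A i k * mpow A r k j := by
  have := exists_mpow_add_eq A 1 r i j
  rwa [mpow_one, add_comm] at this

theorem mpow_transpose (A : Matrix (Fin n) (Fin n) ℝ≥0) (r : ℕ) :
    mpow A.transpose r = (mpow A r).transpose := by
  induction r with
  | zero => simp
  | succ r ih =>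
    have h := mpow_add A 1 r
    rw [add_comm, mpow_one] at h
    rw [h, mpow, ih]
    ext i j : 2
    simp [mmul, mul_comm]

theorem mpow_mono (h : ∀ i j, A i j ≤ B i j) (r : ℕ) (i j : Fin n) :
    mpow A r i j ≤ mpow B r i j := by
  induction r generalizing i j with
  | zero => exact le_rfl
  | succ r ih =>
    exact mmul_le_iff.2 fun k => (mul_le_mul' (ih i k) (h k j)).trans (le_mmul _ _ i k j)

theorem mvec_mpow_add (A : Matrix (Fin n) (Fin n) ℝ≥0) (x : Fin n → ℝ≥0) (a b : ℕ) :
    mvec (mpow A (a + b)) x = mvec (mpow A a) (mvec (mpow A b) x) := by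
  rw [mpow_add, mvec_mmul]

theorem mpow_div (A : Matrix (Fin n) (Fin n) ℝ≥0) (c : ℝ≥0) (r : ℕ) (i j : Fin n) :
    mpow (fun i j => A i j / c) r i j = mpow A r i j / c ^ r := by
  induction r generalizing i j with
  | zero => rw [pow_zero, div_one]; rfl
  | succ r ih =>
    apply le_antisymm
    · refine mmul_le_iff.2 fun k => ?_
      rw [ih, div_mul_div_comm, ← pow_succ]
      exact div_le_div_of_nonneg_right (le_mmul _ _ i k j) zero_le
    · obtain ⟨k, hk⟩ := exists_mmul_eq (mpow A r) A i j
      rw [mpow, hk, pow_succ, ← div_mul_div_comm, ← ih]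
      exact le_mmul _ (fun i j => A i j / c) i k j

theorem one_le_mpow_mul {l : ℕ} {i : Fin n} (h : 1 ≤ mpow A l i i) (t : ℕ) :
    1 ≤ mpow A (t * l) i i := by
  induction t with
  | zero => simp
  | succ t ih =>
    rw [Nat.succ_mul]
    exact (one_le_mul ih h).trans (mpow_mul_le A _ _ i i i)

theorem mpow_mul_pos {l : ℕ} {i : Fin n} (h : 0 < mpow A l i i) (t : ℕ) :
    0 < mpow A (t * l) i i := by
  induction t with
  | zero => simp
  | succ t ih =>
    rw [Nat.succ_mul]
    exact (mul_pos ih h).trans_le (mpow_mul_le A _ _ i i i)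

/-! ### Walks -/

/-- An entry of a power is at least the weight of each walk. -/
theorem prod_le_mpow (A : Matrix (Fin n) (Fin n) ℝ≥0) (c : ℕ → Fin n) (a k : ℕ) :
    ∏ l ∈ Finset.range k, A (c (a + l)) (c (a + l + 1)) ≤ mpow A k (c a) (c (a + k)) := by
  induction k with
  | zero => simp
  | succ k ih =>
    rw [Finset.prod_range_succ]
    exact (mul_le_mul_left ih _).trans (le_mmul _ _ _ _ _)

/-- A nonzero entry of a power is the weight of a walk. -/
theorem exists_walk (A : Matrix (Fin n) (Fin n) ℝ≥0) (k : ℕ) (i j : Fin n)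
    (h : mpow A k i j ≠ 0) :
    ∃ c : ℕ → Fin n, c 0 = i ∧ c k = j ∧
      mpow A k i j = ∏ l ∈ Finset.range k, A (c l) (c (l + 1)) := by
  induction k generalizing j with
  | zero =>
    have hij : i = j := by
      by_contra hij
      exact h (Matrix.one_apply_ne hij)
    subst hij
    exact ⟨fun _ => i, rfl, rfl, by simp⟩
  | succ k ih =>
    obtain ⟨u, hu⟩ := exists_mmul_eq (mpow A k) A i j
    have h' : mpow A k i u ≠ 0 := by
      intro h0
      exact h (by rw [mpow, hu, h0, zero_mul])
    obtain ⟨c, h0, hk, hc⟩ := ih u h'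
    refine ⟨fun l => if l ≤ k then c l else j, by simpa using h0, by simp, ?_⟩
    rw [mpow, hu, hc, Finset.prod_range_succ]
    congr 1
    · refine Finset.prod_congr rfl fun l hl => ?_
      have hl := Finset.mem_range.1 hl
      simp only [if_pos hl.le, if_pos (Nat.succ_le_of_lt hl)]
    · simp [hk]

/-- A walk with at least `n * l` edges has a closed subwalk whose length is a multiple of `l`:
two of the pairs (node, position modulo `l`) coincide. -/
theorem exists_closed_subwalk (A : Matrix (Fin n) (Fin n) ℝ≥0) {l r : ℕ} (hl : 0 < l)
    (hr : n * l ≤ r) (i j : Fin n) :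
    ∃ a b v, a < b ∧ b ≤ n * l ∧ l ∣ b - a ∧
      mpow A r i j ≤ mpow A a i v * mpow A (b - a) v v * mpow A (r - b) v j := by
  by_cases h : mpow A r i j = 0
  · refine ⟨0, n * l, i, Nat.mul_pos i.pos hl, le_rfl, by simp, ?_⟩
    rw [h]; exact zero_le
  obtain ⟨c, h0, hk, hc⟩ := exists_walk A r i j h
  have hcard : Fintype.card (Fin n × Fin l) < (Finset.range (n * l + 1)).card := by simp
  obtain ⟨a, ha, b, hb, hab, he⟩ := Finset.exists_ne_map_eq_of_card_lt_of_maps_to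
    (s := Finset.range (n * l + 1)) (t := Finset.univ) hcard
    (f := fun t => ((c t, ⟨t % l, Nat.mod_lt _ hl⟩) : Fin n × Fin l))
    (fun _ _ => Finset.mem_coe.2 (Finset.mem_univ _))
  wlog hlt : a < b generalizing a b
  · exact this b hb a ha hab.symm he.symm (by omega)
  simp only [Finset.mem_range, Prod.mk.injEq, Fin.mk.injEq] at ha hb he
  refine ⟨a, b, c a, hlt, by omega, (Nat.modEq_iff_dvd' hlt.le).1 he.2, ?_⟩
  have h1 := prod_le_mpow A c 0 a
  have h2 := prod_le_mpow A c a (b - a)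
  have h3 := prod_le_mpow A c b (r - b)
  rw [show a + (b - a) = b by omega, ← he.1] at h2
  rw [show b + (r - b) = r by omega, hk, ← he.1] at h3
  rw [zero_add, h0] at h1
  refine le_trans (le_of_eq ?_) (mul_le_mul' (mul_le_mul' h1 h2) h3)
  rw [hc, show r = a + (b - a) + (r - b) by omega, Finset.prod_range_add, Finset.prod_range_add]
  simp only [zero_add]
  rw [show a + (b - a) = b by omega, show b + (r - b) - b = r - b by omega]

/-! ### Matrices without closed walks of weight greater than one -/

/-- No closed walk has weight greater than `1`, that is, `λ(A) ≤ 1`. -/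
def ClosedLeOne (A : Matrix (Fin n) (Fin n) ℝ≥0) : Prop :=
  ∀ k, 0 < k → ∀ i, mpow A k i i ≤ 1

theorem ClosedLeOne.diag (h : ClosedLeOne A) (k : ℕ) (i : Fin n) : mpow A k i i ≤ 1 := by
  rcases Nat.eq_zero_or_pos k with rfl | hk
  · simp
  · exact h k hk i

/-- Closed walks of length at most `n` decide. -/
theorem closedLeOne_of_le (h : ∀ k, 0 < k → k ≤ n → ∀ i, mpow A k i i ≤ 1) : ClosedLeOne A := by
  intro k
  induction k using Nat.strong_induction_on with
  | _ k ih =>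
    intro hk i
    rcases le_or_gt k n with hkn | hkn
    · exact h k hk hkn i
    obtain ⟨a, b, v, hab, hb, -, hle⟩ :=
      exists_closed_subwalk A one_pos (by omega : n * 1 ≤ k) i i
    refine hle.trans ?_
    calc _ ≤ mpow A a i v * 1 * mpow A (k - b) v i := by
            gcongr; exact h _ (by omega) (by omega) v
      _ ≤ mpow A (a + (k - b)) i i := by rw [mul_one]; exact mpow_mul_le _ _ _ _ _ _
      _ ≤ 1 := ih _ (by omega) (by omega) i

/-- Closed subwalks can be removed until the length drops below `n * l`, the residue modulo `l` of
the length being kept. -/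
theorem ClosedLeOne.reduce (h : ClosedLeOne A) {l : ℕ} (hl : 0 < l) (r : ℕ) (i j : Fin n) :
    ∃ r', r' < n * l ∧ r' ≤ r ∧ l ∣ r - r' ∧ mpow A r i j ≤ mpow A r' i j := by
  induction r using Nat.strong_induction_on with
  | _ r ih =>
    rcases lt_or_ge r (n * l) with hr | hr
    · exact ⟨r, hr, le_rfl, by simp, le_rfl⟩
    obtain ⟨a, b, v, hab, hb, hd, hle⟩ := exists_closed_subwalk A hl hr i j
    obtain ⟨r', h1, h2, h3, h4⟩ := ih (r - (b - a)) (by omega)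
    refine ⟨r', h1, by omega, ?_, ?_⟩
    · have : r - r' = (r - (b - a) - r') + (b - a) := by omega
      rw [this]; exact dvd_add h3 hd
    · refine hle.trans (le_trans ?_ h4)
      calc _ ≤ mpow A a i v * 1 * mpow A (r - b) v j := by
              gcongr; exact h.diag _ v
        _ ≤ mpow A (a + (r - b)) i j := by rw [mul_one]; exact mpow_mul_le _ _ _ _ _ _
        _ = _ := by congr 2; omega

end Algebra

/-! ### Critical edges and the rows and columns of critical nodes -/

section Critical

variable {n : ℕ} {B : Matrix (Fin n) (Fin n) ℝ≥0}

/-- The edge `(i, j)` lies on a closed walk of weight at least `1`. For a matrix with `λ(B) = 1`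
these are the edges of the critical graph. -/
def UnitEdge (B : Matrix (Fin n) (Fin n) ℝ≥0) (i j : Fin n) : Prop :=
  ∃ r, 1 ≤ B i j * mpow B r j i

/-- Some edge leaving `i` lies on a closed walk of weight at least `1`. -/
def UnitNode (B : Matrix (Fin n) (Fin n) ℝ≥0) (i : Fin n) : Prop :=
  ∃ j, UnitEdge B i j

theorem UnitEdge.ne_zero {i j : Fin n} (h : UnitEdge B i j) : B i j ≠ 0 := by
  obtain ⟨r, hr⟩ := h
  intro h0
  rw [h0, zero_mul] at hr
  exact absurd hr (by simp)

theorem UnitEdge.transpose {i j : Fin n} (h : UnitEdge B i j) : UnitEdge B.transpose j i := by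
  obtain ⟨r, hr⟩ := h
  exact ⟨r, by rwa [mpow_transpose]⟩

theorem unitNode_of_one_le {k : ℕ} (hk : 0 < k) {i : Fin n} (h : 1 ≤ mpow B k i i) :
    UnitNode B i := by
  obtain ⟨k, rfl⟩ := Nat.exists_eq_succ_of_ne_zero hk.ne'
  obtain ⟨j, hj⟩ := exists_mpow_succ_eq B k i i
  exact ⟨j, k, by rwa [← hj]⟩

theorem UnitEdge.right {i j : Fin n} (h : UnitEdge B i j) : UnitNode B j := by
  obtain ⟨r, hr⟩ := h
  refine unitNode_of_one_le (Nat.succ_pos r) (hr.trans ?_)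
  rw [mul_comm]
  exact le_mmul (mpow B r) B j i j

theorem UnitNode.exists_pred {i : Fin n} (h : UnitNode B i) : ∃ j, UnitEdge B j i := by
  obtain ⟨j, h⟩ := h
  obtain ⟨k, hk⟩ := h.transpose.right
  exact ⟨k, hk.transpose⟩

/-- A critical edge lies on a critical closed walk of length at most `n`. -/
theorem UnitEdge.exists_short (hB : ClosedLeOne B) {i j : Fin n} (h : UnitEdge B i j) :
    ∃ r, r < n ∧ 1 ≤ B i j * mpow B r j i := by
  obtain ⟨r, hr⟩ := h
  obtain ⟨r', h1, -, -, h4⟩ := hB.reduce one_pos r j i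
  exact ⟨r', by omega, hr.trans (mul_le_mul_right h4 _)⟩

/-- The rows of critical nodes: after `n ^ 2` steps every optimal walk from `i` may be taken to
start with any given critical edge. Indeed it may be shortened modulo the length of a critical
cycle through this edge, and prolonged again by that cycle. -/
theorem UnitEdge.row (hB : ClosedLeOne B) {i j : Fin n} (h : UnitEdge B i j) {r : ℕ}
    (hr : n * n ≤ r) (v : Fin n) : mpow B (r + 1) i v = B i j * mpow B r j v := by
  apply le_antisymm _ (mul_mpow_le B r i j v)
  obtain ⟨l, hl, h1⟩ := h.exists_short hB
  obtain ⟨r', hr', hle, ⟨t, ht⟩, hw⟩ := hB.reduce (l := l + 1) (Nat.succ_pos l) (r + 1) i v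
  have hr2 : n * (l + 1) ≤ n * n := Nat.mul_le_mul_left n hl
  obtain ⟨t, rfl⟩ : ∃ t', t = t' + 1 := Nat.exists_eq_succ_of_ne_zero (by rintro rfl; omega)
  have e : r = l + (t * (l + 1) + r') := by
    rw [Nat.mul_succ, mul_comm] at ht; omega
  have h2 : 1 ≤ mpow B (t * (l + 1)) i i := one_le_mpow_mul (h1.trans (mul_mpow_le B l i j i)) t
  calc mpow B (r + 1) i v ≤ 1 * (1 * mpow B r' i v) := by simpa using hw
    _ ≤ (B i j * mpow B l j i) * (mpow B (t * (l + 1)) i i * mpow B r' i v) := by gcongr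
    _ ≤ (B i j * mpow B l j i) * mpow B (t * (l + 1) + r') i v := by
        gcongr; exact mpow_mul_le _ _ _ _ _ _
    _ ≤ B i j * mpow B r j v := by
        rw [mul_assoc]; gcongr; rw [e]; exact mpow_mul_le _ _ _ _ _ _

theorem ClosedLeOne.transpose (hB : ClosedLeOne B) : ClosedLeOne B.transpose := by
  intro k hk i
  rw [mpow_transpose]
  exact hB k hk i

theorem UnitEdge.col (hB : ClosedLeOne B) {i j : Fin n} (h : UnitEdge B i j) {r : ℕ}
    (hr : n * n ≤ r) (v : Fin n) : mpow B (r + 1) v j = mpow B r v i * B i j := by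
  have := h.transpose.row hB.transpose hr v
  simpa [mpow_transpose, mul_comm] using this

/-- The position at which a long walk meets a critical node can be chosen freely, away from the
ends of the walk. -/
theorem UnitNode.shift (hB : ClosedLeOne B) {a b : ℕ} (ha : n * n ≤ a) (hb : n * n ≤ b) {l m : ℕ}
    (hlm : l + m = a + b) {c : Fin n} (hc : UnitNode B c) (i j : Fin n) :
    ∃ c', UnitNode B c' ∧ mpow B l i c * mpow B m c j ≤ mpow B a i c' * mpow B b c' j := by
  rcases le_total a l with h | h
  · induction l, h using Nat.le_induction generalizing m c with
    | base =>
      obtain rfl : m = b := by omega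
      exact ⟨c, hc, le_rfl⟩
    | succ l hl ih =>
      obtain ⟨d, hd⟩ := hc.exists_pred
      obtain ⟨c', h1, h2⟩ := ih (m := m + 1) (by omega) ⟨c, hd⟩
      refine ⟨c', h1, le_trans ?_ h2⟩
      rw [hd.col hB (by omega), mul_assoc]
      gcongr
      exact mul_mpow_le _ _ _ _ _
  · have h' : b ≤ m := by omega
    clear h
    induction m, h' using Nat.le_induction generalizing l c with
    | base =>
      obtain rfl : l = a := by omega
      exact ⟨c, hc, le_rfl⟩
    | succ m hm ih =>
      obtain ⟨d, hd⟩ := hc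
      obtain ⟨c', h1, h2⟩ := ih (l := l + 1) (by omega) hd.right
      refine ⟨c', h1, le_trans ?_ h2⟩
      rw [hd.row hB (by omega), ← mul_assoc]
      gcongr
      exact le_mmul _ _ _ _ _

/-- Along a critical walk, rows of large powers are rescaled by the weight of the walk. -/
theorem mpow_row_walk (hB : ClosedLeOne B) (c : ℕ → Fin n) (k : ℕ)
    (hc : ∀ l < k, UnitEdge B (c l) (c (l + 1))) {r : ℕ} (hr : n * n ≤ r) (v : Fin n) :
    mpow B (r + k) (c 0) v
      = (∏ l ∈ Finset.range k, B (c l) (c (l + 1))) * mpow B r (c k) v := by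
  induction k generalizing r with
  | zero => simp
  | succ k ih =>
    rw [show r + (k + 1) = (r + 1) + k by omega, ih (fun l hl => hc l (by omega)) (by omega),
      (hc k (by omega)).row hB hr, Finset.prod_range_succ, mul_assoc]

/-- A critical walk can be closed up to a walk of weight at least `1`. -/
theorem exists_return_walk (c : ℕ → Fin n) (k : ℕ)
    (hc : ∀ l < k, UnitEdge B (c l) (c (l + 1))) :
    ∃ t, 1 ≤ (∏ l ∈ Finset.range k, B (c l) (c (l + 1))) * mpow B t (c k) (c 0) := by
  induction k with
  | zero => exact ⟨0, by simp⟩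
  | succ k ih =>
    obtain ⟨t, ht⟩ := ih fun l hl => hc l (by omega)
    obtain ⟨u, hu⟩ := hc k (by omega)
    refine ⟨u + t, ?_⟩
    rw [Finset.prod_range_succ]
    calc (1 : ℝ≥0) ≤ _ := one_le_mul ht hu
      _ = (∏ l ∈ Finset.range k, B (c l) (c (l + 1))) * B (c k) (c (k + 1)) *
            (mpow B u (c (k + 1)) (c k) * mpow B t (c k) (c 0)) := by ring
      _ ≤ _ := by gcongr; exact mpow_mul_le _ _ _ _ _ _

theorem prod_closed_unit_walk (hB : ClosedLeOne B) (c : ℕ → Fin n) (k : ℕ)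
    (hc : ∀ l < k, UnitEdge B (c l) (c (l + 1))) (hk : c k = c 0) :
    ∏ l ∈ Finset.range k, B (c l) (c (l + 1)) = 1 := by
  apply le_antisymm
  · have := prod_le_mpow B c 0 k
    simp only [zero_add, hk] at this
    exact this.trans (hB.diag k _)
  · obtain ⟨t, ht⟩ := exists_return_walk c k hc
    rw [hk] at ht
    exact ht.trans (mul_le_of_le_one_right zero_le (hB.diag t _))

/-! ### Long optimal walks meet the critical graph -/

open scoped Classical in
/-- The matrix with the rows and columns of critical nodes set to zero. -/
noncomputable def noncritPart (B : Matrix (Fin n) (Fin n) ℝ≥0) : Matrix (Fin n) (Fin n) ℝ≥0 :=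
  fun i j => if UnitNode B i ∨ UnitNode B j then 0 else B i j

theorem noncritPart_le (i j : Fin n) : noncritPart B i j ≤ B i j := by
  unfold noncritPart
  split_ifs
  · exact zero_le
  · exact le_rfl

theorem mpow_le_noncritPart_or (r : ℕ) (i j : Fin n) :
    mpow B r i j ≤ mpow (noncritPart B) r i j ∨
      ∃ c, UnitNode B c ∧ ∃ l m, l + m = r ∧ mpow B r i j ≤ mpow B l i c * mpow B m c j := by
  induction r generalizing j with
  | zero => exact Or.inl le_rfl
  | succ r ih =>
    obtain ⟨k, hk⟩ := exists_mmul_eq (mpow B r) B i j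
    by_cases hkc : UnitNode B k
    · exact Or.inr ⟨k, hkc, r, 1, rfl, by rw [mpow_one]; exact hk.le⟩
    by_cases hjc : UnitNode B j
    · exact Or.inr ⟨j, hjc, r + 1, 0, rfl, by simp⟩
    rcases ih k with h | ⟨c, hc, l, m, hlm, h⟩
    · left
      rw [mpow, hk]
      have : B k j = noncritPart B k j := by simp [noncritPart, hkc, hjc]
      rw [this]
      exact (mul_le_mul_left h _).trans (le_mmul _ _ _ _ _)
    · right
      refine ⟨c, hc, l, m + 1, by omega, ?_⟩
      rw [mpow, hk]
      refine (mul_le_mul_left h _).trans ?_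
      rw [mul_assoc]
      gcongr
      exact le_mmul _ _ _ _ _

theorem ClosedLeOne.noncritPart (hB : ClosedLeOne B) : ClosedLeOne (noncritPart B) :=
  fun k hk i => (mpow_mono noncritPart_le k i i).trans (hB k hk i)

theorem noncritPart_closed_lt {k : ℕ} (hk : 0 < k) (i : Fin n) :
    mpow (noncritPart B) k i i < 1 := by
  by_contra! h
  have hi : UnitNode B i := unitNode_of_one_le hk (h.trans (mpow_mono noncritPart_le k i i))
  obtain ⟨k, rfl⟩ := Nat.exists_eq_succ_of_ne_zero hk.ne'
  obtain ⟨j, hj⟩ := exists_mpow_succ_eq (MaxTimes.noncritPart B) k i i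
  have : MaxTimes.noncritPart B i j = 0 := by simp [MaxTimes.noncritPart, hi]
  rw [Nat.succ_eq_add_one, hj, this, zero_mul] at h
  exact absurd h (by simp)

/-- The powers of the noncritical part tend to zero: every `n` edges of a walk contain a cycle,
whose weight is at most some `m < 1`. -/
theorem noncritPart_eventually_lt (hB : ClosedLeOne B) {ε : ℝ≥0} (hε : 0 < ε) :
    ∀ᶠ r in Filter.atTop, ∀ i j, mpow (noncritPart B) r i j < ε := by
  set N := noncritPart B with hN
  have hNc : ClosedLeOne N := hB.noncritPart
  set m : ℝ≥0 := (Finset.Icc 1 n).sup fun k => Finset.univ.sup fun i => mpow N k i i with hm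
  have hm1 : m < 1 := by
    rw [hm, Finset.sup_lt_iff (by simp)]
    intro k hk
    rw [Finset.sup_lt_iff (by simp)]
    intro i _
    exact noncritPart_closed_lt (Finset.mem_Icc.1 hk).1 i
  set K : ℝ≥0 := (Finset.range n).sup fun k => Finset.univ.sup fun i =>
    Finset.univ.sup fun j => mpow N k i j with hK
  have key : ∀ t r, n * t ≤ r → ∀ i j, mpow N r i j ≤ m ^ t * K := by
    intro t
    induction t with
    | zero =>
      intro r _ i j
      obtain ⟨r', h1, -, -, h4⟩ := hNc.reduce one_pos r i j
      rw [pow_zero, one_mul]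
      refine h4.trans ?_
      calc mpow N r' i j ≤ Finset.univ.sup fun j => mpow N r' i j :=
            Finset.le_sup (f := fun j => mpow N r' i j) (Finset.mem_univ j)
        _ ≤ Finset.univ.sup fun i => Finset.univ.sup fun j => mpow N r' i j :=
            Finset.le_sup (f := fun i => Finset.univ.sup fun j => mpow N r' i j)
              (Finset.mem_univ i)
        _ ≤ K := Finset.le_sup (f := fun k => Finset.univ.sup fun i =>
              Finset.univ.sup fun j => mpow N k i j) (Finset.mem_range.2 (by omega))
    | succ t ih =>
      intro r hr i j
      have hr' : n * t + n ≤ r := by rwa [← Nat.mul_succ]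
      obtain ⟨a, b, v, hab, hb, -, hle⟩ :=
        exists_closed_subwalk N one_pos (by omega : n * 1 ≤ r) i j
      have hmv : mpow N (b - a) v v ≤ m :=
        (Finset.le_sup (f := fun i => mpow N (b - a) i i) (Finset.mem_univ v)).trans
          (Finset.le_sup (f := fun k => Finset.univ.sup fun i => mpow N k i i)
            (Finset.mem_Icc.2 ⟨by omega, by omega⟩))
      calc mpow N r i j ≤ _ := hle
        _ ≤ mpow N a i v * m * mpow N (r - b) v j := by gcongr
        _ = m * (mpow N a i v * mpow N (r - b) v j) := by ring
        _ ≤ m * mpow N (a + (r - b)) i j := by gcongr; exact mpow_mul_le _ _ _ _ _ _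
        _ ≤ m * (m ^ t * K) := by gcongr; exact ih _ (by omega) i j
        _ = m ^ (t + 1) * K := by ring
  have hlim : Filter.Tendsto (fun t => m ^ t * K) Filter.atTop (nhds 0) := by
    have := (NNReal.tendsto_pow_atTop_nhds_zero_of_lt_one hm1).mul_const K
    rwa [zero_mul] at this
  obtain ⟨t, ht⟩ := (hlim.eventually_lt_const hε).exists
  filter_upwards [Filter.eventually_ge_atTop (n * t)] with r hr i j
  exact (key t r hr i j).trans_lt ht

/-- For irreducible matrices, an optimal walk of large length may be taken through a critical node.
There are walks through a critical node whose weight is bounded below, in all lengths for which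
there are walks at all. -/
theorem eventually_exists_critical (hB : ClosedLeOne B) (hirr : Irred B) {c : Fin n}
    (hc : UnitNode B c) :
    ∀ᶠ r in Filter.atTop, ∀ i j, ∃ d, UnitNode B d ∧ ∃ l m, l + m = r ∧
      mpow B r i j ≤ mpow B l i d * mpow B m d j := by
  have hreach : ∀ i j, ∃ p, 0 < mpow B p i j := by
    intro i j
    induction hirr i j with
    | refl => exact ⟨0, by simp⟩
    | tail _ h ih =>
      obtain ⟨p, hp⟩ := ih
      exact ⟨p + 1, (mul_pos hp (pos_iff_ne_zero.2 h)).trans_le (le_mmul _ _ _ _ _)⟩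
  obtain ⟨d, hd⟩ := hc
  obtain ⟨k, hk⟩ := hd
  set l := k + 1 with hl
  have hcl : 1 ≤ mpow B l c c := hk.trans (mul_mpow_le B k c d c)
  rw [Filter.eventually_all]; intro i
  rw [Filter.eventually_all]; intro j
  have main : ∀ r' ∈ Finset.range (n * l), ∀ᶠ r in Filter.atTop, r' ≤ r → l ∣ r - r' →
      mpow B r i j ≤ mpow B r' i j → ∃ d, UnitNode B d ∧ ∃ l m, l + m = r ∧
      mpow B r i j ≤ mpow B l i d * mpow B m d j := by
    intro r' _
    by_cases h0 : mpow B r' i j = 0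
    · refine Filter.Eventually.of_forall fun r _ _ h => ⟨c, ⟨d, k, hk⟩, r, 0, rfl, ?_⟩
      rw [h0] at h
      exact h.trans zero_le
    obtain ⟨p, hp⟩ := hreach i c
    obtain ⟨q, hq⟩ := hreach c i
    -- The walk through `c` goes from `i` to `c` in `p` steps, turns round the critical cycle,
    -- returns to `i` in `q` steps and continues to `j` in `r'` steps. With `k * (p + q)` extra
    -- steps the length of the detour is a multiple of `l = k + 1`; turns of the cycle complete it.
    set ε := mpow B p i c * (mpow B q c i * mpow B (k * (p + q)) i i * mpow B r' i j) with hε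
    have hpq : 0 < mpow B (k * (p + q)) i i := by
      have h1 : 0 < mpow B (p + q) i i := (mul_pos hp hq).trans_le (mpow_mul_le _ _ _ _ _ _)
      exact mpow_mul_pos h1 k
    have hε0 : 0 < ε := mul_pos hp (mul_pos (mul_pos hq hpq) (pos_iff_ne_zero.2 h0))
    filter_upwards [noncritPart_eventually_lt hB hε0,
      Filter.eventually_ge_atTop (r' + l * (p + q))] with r hN hr hle hdvd _
    obtain ⟨t, ht⟩ := hdvd
    obtain ⟨s, rfl⟩ : ∃ s, t = (p + q) + s := by
      refine ⟨t - (p + q), (Nat.add_sub_cancel' ?_).symm⟩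
      have : l * (p + q) ≤ l * t := by omega
      exact Nat.le_of_mul_le_mul_left this (Nat.succ_pos k)
    rcases mpow_le_noncritPart_or (B := B) r i j with h | h
    · refine ⟨c, ⟨d, k, hk⟩, p, s * l + (q + k * (p + q) + r'), ?_, ?_⟩
      · have e : l * (p + q + s) = s * l + k * (p + q) + (p + q) := by rw [hl]; ring
        omega
      · refine (h.trans (hN i j).le).trans ?_
        rw [hε]
        gcongr
        calc _ = 1 * (mpow B q c i * mpow B (k * (p + q)) i i * mpow B r' i j) := (one_mul _).symm
          _ ≤ mpow B (s * l) c c * mpow B (q + k * (p + q) + r') c j := by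
            gcongr
            · exact one_le_mpow_mul hcl s
            · refine (mul_le_mul_left (mpow_mul_le _ _ _ _ _ _) _).trans (mpow_mul_le _ _ _ _ _ _)
          _ ≤ _ := mpow_mul_le _ _ _ _ _ _
    · exact h
  filter_upwards [(Filter.eventually_all_finset _).2 main] with r hr
  obtain ⟨r', h1, h2, h3, h4⟩ := hB.reduce (Nat.succ_pos k) r i j
  exact hr r' (Finset.mem_range.2 h1) h2 h3 h4

/-- Large powers factor through the critical nodes, with any two large exponents. -/
theorem eventually_factor (hB : ClosedLeOne B) (hirr : Irred B) {c : Fin n}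
    (hc : UnitNode B c) :
    ∀ᶠ r in Filter.atTop, ∀ a b, n * n ≤ a → n * n ≤ b → a + b = r → ∀ i j,
      ∃ d, UnitNode B d ∧ mpow B r i j ≤ mpow B a i d * mpow B b d j := by
  filter_upwards [eventually_exists_critical hB hirr hc] with r hr a b ha hb hab i j
  obtain ⟨d, hd, l, m, hlm, h⟩ := hr i j
  obtain ⟨d', h1, h2⟩ := hd.shift hB ha hb (hlm.trans hab.symm) i j
  exact ⟨d', h1, h.trans h2⟩

end Critical

/-! ### Eventual periods of sequences -/

section Periods

variable {β : Type*} {f : ℕ → β}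

/-- `d` is a period of the sequence `f` from some index on (`d = 0` is allowed). -/
def EvPeriod (f : ℕ → β) (d : ℕ) : Prop := ∀ᶠ r in Filter.atTop, f (r + d) = f r

theorem EvPeriod.zero : EvPeriod f 0 := Filter.Eventually.of_forall fun _ => rfl

theorem EvPeriod.of_forall {R d : ℕ} (h : ∀ r, R ≤ r → f (r + d) = f r) : EvPeriod f d :=
  Filter.eventually_atTop.2 ⟨R, h⟩

theorem EvPeriod.add {a b : ℕ} (ha : EvPeriod f a) (hb : EvPeriod f b) : EvPeriod f (a + b) := by
  filter_upwards [hb, (Filter.tendsto_add_atTop_nat b).eventually ha] with r h1 h2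
  rw [← h1, ← h2]
  congr 1; omega

theorem EvPeriod.of_add {a b : ℕ} (ha : EvPeriod f a) (hab : EvPeriod f (a + b)) :
    EvPeriod f b := by
  obtain ⟨R, hR⟩ := Filter.eventually_atTop.1 (ha.and hab)
  refine EvPeriod.of_forall (R := R + a) fun r hr => ?_
  obtain ⟨s, rfl⟩ : ∃ s, r = s + a := ⟨r - a, by omega⟩
  obtain ⟨h1, h2⟩ := hR s (by omega)
  rw [h1, ← h2]
  congr 1; omega

theorem EvPeriod.mul {a : ℕ} (ha : EvPeriod f a) (t : ℕ) : EvPeriod f (a * t) := by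
  induction t with
  | zero => exact EvPeriod.zero
  | succ t ih => exact ih.add ha

theorem EvPeriod.of_dvd {a b : ℕ} (ha : EvPeriod f a) (h : a ∣ b) : EvPeriod f b := by
  obtain ⟨t, rfl⟩ := h
  exact ha.mul t

/-- The eventual periods of an eventually periodic sequence are the multiples of the least
positive one. -/
theorem EvPeriod.dvd_of_least {p d : ℕ} (hp : EvPeriod f p) (hp0 : 0 < p)
    (hmin : ∀ q, 0 < q → EvPeriod f q → p ≤ q) (hd : EvPeriod f d) : p ∣ d := by
  by_contra h
  have hmod : 0 < d % p := Nat.pos_of_ne_zero fun h0 => h (Nat.dvd_of_mod_eq_zero h0)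
  have h1 : EvPeriod f (d % p) := by
    refine (hp.mul (d / p)).of_add ?_
    rwa [Nat.div_add_mod]
  exact absurd (hmin _ hmod h1) (not_le.2 (Nat.mod_lt _ hp0))

theorem EvPeriod.exists_least {d : ℕ} (hd : EvPeriod f d) (hd0 : 0 < d) :
    ∃ p, 0 < p ∧ ∀ e, EvPeriod f e ↔ p ∣ e := by
  classical
  have hex : ∃ p, 0 < p ∧ EvPeriod f p := ⟨d, hd0, hd⟩
  refine ⟨Nat.find hex, (Nat.find_spec hex).1, fun e => ⟨fun he => ?_, fun he => ?_⟩⟩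
  · exact (Nat.find_spec hex).2.dvd_of_least (Nat.find_spec hex).1
      (fun q h0 hq => Nat.find_min' hex ⟨h0, hq⟩) he
  · exact (Nat.find_spec hex).2.of_dvd he

/-- If a sequence is periodic from the index `R` on, then all its eventual periods are periods
from `R` on. -/
theorem EvPeriod.from_index {R l d : ℕ} (hl : 0 < l) (h : ∀ r, R ≤ r → f (r + l) = f r)
    (hd : EvPeriod f d) {r : ℕ} (hr : R ≤ r) : f (r + d) = f r := by
  have hmul : ∀ t r, R ≤ r → f (r + l * t) = f r := by
    intro t
    induction t with
    | zero => intro r _; rfl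
    | succ t ih =>
      intro r hr
      rw [Nat.mul_succ, ← add_assoc, h _ (by omega), ih r hr]
  obtain ⟨S, hS⟩ := Filter.eventually_atTop.1 hd
  have hle : S ≤ l * S := Nat.le_mul_of_pos_left S hl
  rw [← hmul S r hr, ← hS (r + l * S) (by omega), ← hmul S (r + d) (by omega)]
  congr 1; omega

theorem EvPeriod.eq_of_modEq {R l d : ℕ} (hl : 0 < l) (h : ∀ r, R ≤ r → f (r + l) = f r)
    (hd : EvPeriod f d) {r s : ℕ} (hr : R ≤ r) (hs : R ≤ s) (hrs : r ≡ s [MOD d]) :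
    f r = f s := by
  wlog hle : r ≤ s generalizing r s
  · exact (this hs hr hrs.symm (by omega)).symm
  obtain ⟨t, ht⟩ := (Nat.modEq_iff_dvd' hle).1 hrs
  have := EvPeriod.from_index hl h (hd.mul t) hr
  rw [← this]
  congr 1; omega

end Periods

/-! ### Periodicity of rows, orbits and powers -/

section Orbits

variable {n : ℕ} {B : Matrix (Fin n) (Fin n) ℝ≥0}

/-- From the index `n ^ 2` on the row of a critical node is periodic, with the length of a critical
cycle through it as a period. -/
theorem UnitNode.row_period (hB : ClosedLeOne B) {c : Fin n} (hc : UnitNode B c) :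
    ∃ l, 0 < l ∧ l ≤ n ∧ ∀ r, n * n ≤ r → mpow B (r + l) c = mpow B r c := by
  obtain ⟨d, hd⟩ := hc
  obtain ⟨l, hl, h1⟩ := hd.exists_short hB
  refine ⟨l + 1, by omega, hl, fun r hr => ?_⟩
  have hcc : 1 ≤ mpow B (l + 1) c c := h1.trans (mul_mpow_le B l c d c)
  have hfac : ∀ v, mpow B (r + (l + 1)) c v ≤ mpow B r c v := by
    intro v
    obtain ⟨r', hr', hle, ⟨t, ht⟩, hw⟩ :=
      hB.reduce (l := l + 1) (Nat.succ_pos l) (r + (l + 1)) c v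
    have hr2 : n * (l + 1) ≤ n * n := Nat.mul_le_mul_left n hl
    obtain ⟨t, rfl⟩ : ∃ t', t = t' + 1 := Nat.exists_eq_succ_of_ne_zero (by rintro rfl; omega)
    have e : r = t * (l + 1) + r' := by
      rw [Nat.mul_succ, mul_comm] at ht; omega
    calc _ ≤ 1 * mpow B r' c v := by rwa [one_mul]
      _ ≤ mpow B (t * (l + 1)) c c * mpow B r' c v := by
          gcongr; exact one_le_mpow_mul hcc t
      _ ≤ mpow B r c v := by
          rw [e]; exact mpow_mul_le _ _ _ _ _ _
  funext v
  apply le_antisymm (hfac v)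
  calc _ = 1 * mpow B r c v := (one_mul _).symm
    _ ≤ mpow B (l + 1) c c * mpow B r c v := by gcongr
    _ ≤ _ := by rw [add_comm r]; exact mpow_mul_le _ _ _ _ _ _

/-- The orbit of `x` under the powers of `B`. -/
noncomputable def orbit (B : Matrix (Fin n) (Fin n) ℝ≥0) (x : Fin n → ℝ≥0) (r : ℕ) :
    Fin n → ℝ≥0 := mvec (mpow B r) x

theorem orbit_congr {x : Fin n → ℝ≥0} {r s : ℕ} {i : Fin n} (h : mpow B r i = mpow B s i) :
    orbit B x r i = orbit B x s i := by
  simp only [orbit, mvec, h]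

theorem orbit_succ (B : Matrix (Fin n) (Fin n) ℝ≥0) (x : Fin n → ℝ≥0) (r : ℕ) :
    orbit B x (r + 1) = mvec B (orbit B x r) := by
  rw [orbit, add_comm, mvec_mpow_add, mpow_one]; rfl

theorem mvec_single (M : Matrix (Fin n) (Fin n) ℝ≥0) (j : Fin n) :
    mvec M (Pi.single j 1) = fun i => M i j := by
  funext i
  apply le_antisymm
  · obtain ⟨k, hk⟩ := exists_mvec_eq M (Pi.single j 1) i
    rw [hk]
    by_cases h : k = j
    · subst h; simp
    · simp [Pi.single_eq_of_ne h]
  · simpa using le_mvec M (Pi.single j 1) i j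

/-- Eventual periods of an orbit can be read off its critical coordinates. -/
theorem evPeriod_orbit_iff (hB : ClosedLeOne B) (hirr : Irred B) (hcrit : ∃ c, UnitNode B c)
    (x : Fin n → ℝ≥0) (d : ℕ) :
    EvPeriod (orbit B x) d ↔ ∀ c, UnitNode B c → EvPeriod (fun r => orbit B x r c) d := by
  constructor
  · intro h c _
    filter_upwards [h] with r hr
    rw [hr]
  intro h
  obtain ⟨c, hc⟩ := hcrit
  obtain ⟨R, hR⟩ := Filter.eventually_atTop.1 (eventually_factor hB hirr hc)
  refine EvPeriod.of_forall (R := n * n + (n * n + R)) fun r hr => ?_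
  set b := r - n * n with hb
  have hb1 : n * n ≤ b := by omega
  have hper : ∀ c, UnitNode B c → orbit B x (b + d) c = orbit B x b c := by
    intro c hc
    obtain ⟨l, h0, -, hl⟩ := hc.row_period hB
    exact EvPeriod.from_index (f := fun r => orbit B x r c) h0
      (fun r hr => orbit_congr (hl r hr)) (h c hc) hb1
  have key : ∀ u v, n * n ≤ u → R ≤ n * n + u →
      (∀ c, UnitNode B c → orbit B x u c = orbit B x v c) →
      ∀ i, orbit B x (n * n + u) i ≤ orbit B x (n * n + v) i := by
    intro u v hu hRu huv i
    obtain ⟨j, hj⟩ := exists_mvec_eq (mpow B (n * n + u)) x i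
    obtain ⟨c, hc, hle⟩ := hR (n * n + u) hRu (n * n) u le_rfl hu rfl i j
    calc orbit B x (n * n + u) i = mpow B (n * n + u) i j * x j := hj
      _ ≤ mpow B (n * n) i c * (mpow B u c j * x j) := by rw [← mul_assoc]; gcongr
      _ ≤ mpow B (n * n) i c * orbit B x u c := by gcongr; exact le_mvec _ x c j
      _ = mpow B (n * n) i c * orbit B x v c := by rw [huv c hc]
      _ ≤ orbit B x (n * n + v) i := by
          have := le_mvec (mpow B (n * n)) (orbit B x v) i c
          rwa [orbit, ← mvec_mpow_add] at this
  have e1 : r = n * n + b := by omega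
  have e2 : r + d = n * n + (b + d) := by omega
  rw [e2, e1]
  funext i
  exact le_antisymm (key _ _ (by omega) (by omega) hper i)
    (key _ _ (by omega) (by omega) (fun c hc => (hper c hc).symm) i)

/-- Eventual periods of the powers can be read off the critical rows. -/
theorem evPeriod_mpow (hB : ClosedLeOne B) (hirr : Irred B) (hcrit : ∃ c, UnitNode B c) {d : ℕ}
    (h : ∀ c, UnitNode B c → EvPeriod (fun r => mpow B r c) d) : EvPeriod (mpow B) d := by
  have h1 : ∀ j, EvPeriod (orbit B (Pi.single j 1)) d := by
    intro j
    refine (evPeriod_orbit_iff hB hirr hcrit _ d).2 fun c hc => ?_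
    filter_upwards [h c hc] with r hr
    exact orbit_congr hr
  filter_upwards [Filter.eventually_all.2 h1] with r hr
  funext i j
  have := congrFun (hr j) i
  simpa only [orbit, mvec_single] using this

theorem UnitEdge.evPeriod (hB : ClosedLeOne B) {i j : Fin n} (h : UnitEdge B i j) {d : ℕ}
    (hj : EvPeriod (fun r => mpow B r j) d) : EvPeriod (fun r => mpow B r i) d := by
  obtain ⟨R, hR⟩ := Filter.eventually_atTop.1 hj
  refine EvPeriod.of_forall (R := n * n + R + 1) fun r hr => ?_
  obtain ⟨s, rfl⟩ : ∃ s, r = s + 1 := ⟨r - 1, by omega⟩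
  funext v
  have : mpow B (s + d) j v = mpow B s j v := congrFun (hR s (by omega)) v
  rw [show s + 1 + d = s + d + 1 by omega, h.row hB (by omega), h.row hB (by omega), this]

/-- The length of a critical closed walk is a period of the rows of its nodes. -/
theorem evPeriod_closed_walk (hB : ClosedLeOne B) (c : ℕ → Fin n) (k : ℕ)
    (hc : ∀ l < k, UnitEdge B (c l) (c (l + 1))) (hk : c k = c 0) :
    EvPeriod (fun r => mpow B r (c 0)) k := by
  refine EvPeriod.of_forall (R := n * n) fun r hr => ?_
  funext v
  rw [mpow_row_walk hB c k hc hr, prod_closed_unit_walk hB c k hc hk, one_mul, hk]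

/-! ### The cyclicity of the critical graph is a period -/

theorem cycle_set_bddAbove {V : Type*} {E : V → V → Prop} {i : V} {k : ℕ} {c : ℕ → V}
    (hc : IsCycleOf E k c) (h0 : c 0 = i) :
    BddAbove {d : ℕ | ∀ (k : ℕ) (c : ℕ → V), IsCycleOf E k c →
      Relation.ReflTransGen E i (c 0) → Relation.ReflTransGen E (c 0) i → d ∣ k} := by
  refine ⟨k, fun d hd => Nat.le_of_dvd hc.1 (hd k c hc ?_ ?_)⟩ <;> rw [h0]

/-- A common divisor of the cycle lengths of a component divides its cyclicity. As `i` lies on a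
cycle, the supremum in the definition of `compCyclicity` is taken over a bounded set. -/
theorem dvd_compCyclicity {V : Type*} {E : V → V → Prop} {i : V} {k : ℕ} {c : ℕ → V}
    (hc : IsCycleOf E k c) (h0 : c 0 = i) {p : ℕ} (hp : ∀ (k : ℕ) (c : ℕ → V), IsCycleOf E k c →
      Relation.ReflTransGen E i (c 0) → Relation.ReflTransGen E (c 0) i → p ∣ k) :
    p ∣ compCyclicity E i := by
  have hb := cycle_set_bddAbove hc h0
  have hmem : compCyclicity E i ∈ _ := Nat.sSup_mem ⟨p, hp⟩ hb
  have hl : Nat.lcm p (compCyclicity E i) ≤ compCyclicity E i :=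
    le_csSup hb fun k c h1 h2 h3 => Nat.lcm_dvd (hp k c h1 h2 h3) (hmem k c h1 h2 h3)
  have hpos : 0 < compCyclicity E i :=
    Nat.succ_le_of_lt (Nat.lt_of_succ_le (le_csSup hb fun k c _ _ _ => one_dvd k))
  have : Nat.lcm p (compCyclicity E i) = compCyclicity E i :=
    le_antisymm hl (Nat.le_of_dvd (Nat.pos_of_ne_zero fun h => by
      rcases Nat.lcm_eq_zero_iff.1 h with rfl | h
      · exact absurd (Nat.eq_zero_of_zero_dvd (hp k c hc (by rw [h0]) (by rw [h0]))) hc.1.ne'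
      · omega) (Nat.dvd_lcm_right _ _))
  rw [← this]
  exact Nat.dvd_lcm_left _ _

theorem compCyclicity_pos {V : Type*} {E : V → V → Prop} {i : V} {k : ℕ} {c : ℕ → V}
    (hc : IsCycleOf E k c) (h0 : c 0 = i) : 0 < compCyclicity E i :=
  Nat.succ_le_of_lt (Nat.lt_of_succ_le
    (le_csSup (cycle_set_bddAbove hc h0) fun k _ _ _ _ => one_dvd k))

/-- For matrices with `λ(B) = 1` critical edges are recognized by powers of `B`. -/
theorem critEdge_iff (hB : ClosedLeOne B) (h1 : mcgm B = 1) (i j : Fin n) :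
    CritEdge B i j ↔ UnitEdge B i j := by
  constructor
  · rintro ⟨k, c, ⟨hk, hck, -⟩, hg, l, hl, rfl, rfl⟩
    have hprod : ∏ l ∈ Finset.range k, B (c l) (c (l + 1)) = 1 := by
      have hk0 : (1 / (k : ℝ)) ≠ 0 := by positivity
      have h := hg.trans h1
      rw [geomMean] at h
      exact NNReal.rpow_left_injective hk0 (h.trans (NNReal.one_rpow _).symm)
    refine ⟨(k - (l + 1)) + l, ?_⟩
    have e : k = l + 1 + (k - (l + 1)) := by omega
    rw [e, Finset.prod_range_add, Finset.prod_range_succ] at hprod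
    rw [← hprod]
    have h2 := prod_le_mpow B c 0 l
    have h3 := prod_le_mpow B c (l + 1) (k - (l + 1))
    simp only [zero_add] at h2
    rw [show l + 1 + (k - (l + 1)) = k by omega, hck] at h3
    calc _ = B (c l) (c (l + 1)) * ((∏ x ∈ Finset.range (k - (l + 1)),
            B (c (l + 1 + x)) (c (l + 1 + x + 1))) *
          ∏ x ∈ Finset.range l, B (c x) (c (x + 1))) := by ring
      _ ≤ B (c l) (c (l + 1)) * (mpow B (k - (l + 1)) (c (l + 1)) (c 0) *
            mpow B l (c 0) (c l)) := by gcongr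
      _ ≤ _ := by gcongr; exact mpow_mul_le _ _ _ _ _ _
  · rintro ⟨r, hr⟩
    have hr1 : B i j * mpow B r j i = 1 :=
      le_antisymm ((mul_mpow_le B r i j i).trans (hB _ (Nat.succ_pos r) i)) hr
    have h0 : mpow B r j i ≠ 0 := by
      intro h0; rw [h0, mul_zero] at hr1; exact zero_ne_one hr1
    obtain ⟨w, w0, wr, hw⟩ := exists_walk B r j i h0
    set c : ℕ → Fin n := fun l => if l = 0 then i else w (l - 1) with hc
    have hprod : ∏ l ∈ Finset.range (r + 1), B (c l) (c (l + 1)) = 1 := by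
      rw [Finset.prod_range_succ', ← hr1, hw, mul_comm]
      simp [hc, w0]
    refine ⟨r + 1, c, ⟨Nat.succ_pos r, by simp [hc, wr], fun l hl h => ?_⟩, ?_, 0, Nat.succ_pos r,
      by simp [hc], by simp [hc, w0]⟩
    · rw [Finset.prod_eq_zero (Finset.mem_range.2 hl) h] at hprod
      exact zero_ne_one hprod
    · rw [geomMean, hprod, NNReal.one_rpow, h1]

theorem critNode_iff (hB : ClosedLeOne B) (h1 : mcgm B = 1) (i : Fin n) :
    CritNode B i ↔ UnitNode B i :=
  exists_congr fun j => critEdge_iff hB h1 i j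

theorem UnitNode.exists_cycle (hB : ClosedLeOne B) (h1 : mcgm B = 1) {i : Fin n}
    (hi : UnitNode B i) : ∃ k c, IsCycleOf (CritEdge B) k c ∧ c 0 = i := by
  obtain ⟨j, hj⟩ := hi
  obtain ⟨k, c, ⟨hk, hck, hE⟩, hg, l, hl, hli, -⟩ := (critEdge_iff hB h1 i j).2 hj
  have hcrit : ∀ l < k, CritEdge B (c l) (c (l + 1)) := fun l hl =>
    ⟨k, c, ⟨hk, hck, hE⟩, hg, l, hl, rfl, rfl⟩
  -- the cycle is rotated, so that it starts at its node of index `l`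
  refine ⟨k, fun t => c ((l + t) % k), ⟨hk, by simp, fun t _ => ?_⟩, by
    simp [Nat.mod_eq_of_lt hl, hli]⟩
  have hm := Nat.mod_lt (l + t) hk
  have := hcrit _ hm
  rcases Nat.lt_or_ge ((l + t) % k + 1) k with h | h
  · have e : (l + (t + 1)) % k = (l + t) % k + 1 := by
      rw [← add_assoc, Nat.add_mod, Nat.mod_eq_of_lt (a := 1) (by omega), Nat.mod_eq_of_lt h]
    simpa [e] using this
  · have e : (l + t) % k + 1 = k := by omega
    have e' : (l + (t + 1)) % k = 0 := by
      rw [← add_assoc, ← Nat.mod_add_mod, e, Nat.mod_self]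
    rw [e, hck] at this
    simpa [e'] using this

theorem cyclicity_pos (hB : ClosedLeOne B) (h1 : mcgm B = 1) : 0 < cyclicity B := by
  classical
  apply Nat.pos_of_ne_zero
  rw [cyclicity, Ne, Finset.lcm_eq_zero_iff]
  rintro ⟨i, hi, h0⟩
  replace hi := (Finset.mem_filter.1 hi).2
  obtain ⟨k, c, hc, hc0⟩ := ((critNode_iff hB h1 i).1 hi).exists_cycle hB h1
  exact (compCyclicity_pos hc hc0).ne' h0

theorem UnitNode.evPeriod_cyclicity (hB : ClosedLeOne B) (h1 : mcgm B = 1) {i : Fin n}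
    (hi : UnitNode B i) : EvPeriod (fun r => mpow B r i) (cyclicity B) := by
  classical
  obtain ⟨l, hl0, -, hl⟩ := hi.row_period hB
  obtain ⟨p, hp0, hp⟩ := (EvPeriod.of_forall (f := fun r => mpow B r i) hl).exists_least hl0
  refine (hp _).2 (dvd_trans ?_ (Finset.dvd_lcm (f := fun i => compCyclicity (CritEdge B) i)
    (Finset.mem_filter.2 ⟨Finset.mem_univ i, (critNode_iff hB h1 i).2 hi⟩)))
  obtain ⟨_, _, hc', hc0'⟩ := hi.exists_cycle hB h1
  refine dvd_compCyclicity hc' hc0' fun k c hc hic hci => (hp k).1 ?_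
  have h2 : EvPeriod (fun r => mpow B r (c 0)) k :=
    evPeriod_closed_walk hB c k (fun l hl => (critEdge_iff hB h1 _ _).1 (hc.2.2 l hl)) hc.2.1
  clear hp hl hc0' hi hci
  induction hic using Relation.ReflTransGen.head_induction_on with
  | refl => exact h2
  | head h _ ih => exact ((critEdge_iff hB h1 _ _).1 h).evPeriod hB ih

/-- The cyclicity theorem: the powers are eventually periodic with period `γ`. -/
theorem mpow_add_cyclicity (hB : ClosedLeOne B) (h1 : mcgm B = 1) (hirr : Irred B)
    (hcrit : ∃ c, UnitNode B c) {r : ℕ} (hr : transient B ≤ r) :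
    mpow B (r + cyclicity B) = mpow B r := by
  have hper : EvPeriod (mpow B) (cyclicity B) :=
    evPeriod_mpow hB hirr hcrit fun c hc => hc.evPeriod_cyclicity hB h1
  obtain ⟨R, hR⟩ := Filter.eventually_atTop.1 hper
  have hmem : transient B ∈ {T : ℕ | ∀ r, T ≤ r → mpow B (r + cyclicity B) = mpow B r} :=
    Nat.sInf_mem ⟨R, hR⟩
  exact hmem r hr

/-- Eventual periods of an orbit hold from the transient of the matrix on. -/
theorem mvec_eq_iff_evPeriod (hB : ClosedLeOne B) (h1 : mcgm B = 1) (hirr : Irred B)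
    (hcrit : ∃ c, UnitNode B c) (x : Fin n → ℝ≥0) (d : ℕ) :
    (∀ r, transient B ≤ r → mvec (mpow B (r + d)) x = mvec (mpow B r) x) ↔
      EvPeriod (orbit B x) d := by
  refine ⟨fun h => EvPeriod.of_forall h, fun h r hr => ?_⟩
  exact EvPeriod.from_index (f := orbit B x) (cyclicity_pos hB h1)
    (fun r hr => by rw [orbit, mpow_add_cyclicity hB h1 hirr hcrit hr]; rfl) h hr

theorem mem_attr_iff (x : Fin n → ℝ≥0) (t : ℕ) : x ∈ Attr B t ↔ EvPeriod (orbit B x) t := by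
  constructor
  · rintro ⟨r, hr⟩
    refine EvPeriod.of_forall (R := r) fun s hs => ?_
    obtain ⟨u, rfl⟩ : ∃ u, s = u + r := ⟨s - r, by omega⟩
    simp only [orbit]
    rw [add_assoc, mvec_mpow_add, ← hr, ← mvec_mpow_add]
  · intro h
    obtain ⟨r, hr⟩ := h.exists
    exact ⟨r, hr.symm⟩

end Orbits

/-! ### Normalization -/

section Normalization

variable {n : ℕ} {A : Matrix (Fin n) (Fin n) ℝ≥0}

theorem mpow_normalized (A : Matrix (Fin n) (Fin n) ℝ≥0) (r : ℕ) (i j : Fin n) :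
    mpow (normalized A) r i j = mpow A r i j / mcgm A ^ r := mpow_div A (mcgm A) r i j

theorem closedLeOne_normalized (A : Matrix (Fin n) (Fin n) ℝ≥0) : ClosedLeOne (normalized A) := by
  refine closedLeOne_of_le fun k hk hkn i => ?_
  rw [mpow_normalized]
  refine div_le_one_of_le₀ ?_ zero_le
  have h1 : (Finset.univ.sup fun i => mpow A k i i) ^ (1 / (k : ℝ)) ≤ mcgm A :=
    Finset.le_sup (f := fun k : ℕ => (Finset.univ.sup fun i => mpow A k i i) ^ (1 / (k : ℝ)))
      (Finset.mem_Icc.2 ⟨hk, hkn⟩)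
  rw [one_div, NNReal.rpow_inv_le_iff (by positivity), NNReal.rpow_natCast] at h1
  exact (Finset.le_sup (f := fun i => mpow A k i i) (Finset.mem_univ i)).trans h1

theorem exists_closed_eq_one (hA : mcgm A ≠ 0) :
    ∃ k, 0 < k ∧ k ≤ n ∧ ∃ i, mpow (normalized A) k i i = 1 := by
  have hn : (Finset.Icc 1 n).Nonempty := by
    by_contra h
    rw [Finset.not_nonempty_iff_eq_empty] at h
    exact hA (by rw [mcgm, h]; rfl)
  obtain ⟨k, hk, h⟩ := Finset.exists_mem_eq_sup _ hn
    fun k : ℕ => (Finset.univ.sup fun i => mpow A k i i) ^ (1 / (k : ℝ))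
  rw [Finset.mem_Icc] at hk
  obtain ⟨i, -, hi⟩ := Finset.exists_mem_eq_sup (Finset.univ : Finset (Fin n))
    ⟨⟨0, by omega⟩, Finset.mem_univ _⟩ fun i => mpow A k i i
  refine ⟨k, hk.1, hk.2, i, ?_⟩
  have hm : mcgm A = mpow A k i i ^ (1 / (k : ℝ)) := by rw [← hi]; exact h
  have hk0 : (k : ℝ) ≠ 0 := by have := hk.1; positivity
  have hp : mcgm A ^ k = mpow A k i i := by
    rw [hm, ← NNReal.rpow_natCast, ← NNReal.rpow_mul, one_div_mul_cancel hk0, NNReal.rpow_one]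
  rw [mpow_normalized, ← hp, div_self (pow_ne_zero k hA)]

theorem exists_unitNode_normalized (hA : mcgm A ≠ 0) : ∃ c, UnitNode (normalized A) c := by
  obtain ⟨k, hk, -, i, hi⟩ := exists_closed_eq_one hA
  exact ⟨i, unitNode_of_one_le hk hi.ge⟩

theorem mcgm_normalized (hA : mcgm A ≠ 0) : mcgm (normalized A) = 1 := by
  apply le_antisymm
  · refine Finset.sup_le fun k hk => ?_
    rw [Finset.mem_Icc] at hk
    have hk0 : (0 : ℝ) < k := by have := hk.1; positivity
    rw [one_div, NNReal.rpow_inv_le_iff hk0, NNReal.one_rpow]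
    exact Finset.sup_le fun i _ => closedLeOne_normalized A k hk.1 i
  · obtain ⟨k, hk, hkn, i, hi⟩ := exists_closed_eq_one hA
    refine le_trans ?_ (Finset.le_sup (f := fun k : ℕ =>
      (Finset.univ.sup fun i => mpow (normalized A) k i i) ^ (1 / (k : ℝ)))
      (Finset.mem_Icc.2 ⟨hk, hkn⟩))
    rw [one_div, NNReal.le_rpow_inv_iff (by positivity), NNReal.one_rpow, ← hi]
    exact Finset.le_sup (f := fun i => mpow (normalized A) k i i) (Finset.mem_univ i)

theorem irred_normalized (hirr : Irred A) (hA : mcgm A ≠ 0) : Irred (normalized A) :=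
  fun i j => Relation.ReflTransGen.mono (fun _ _ h => div_ne_zero h hA) _ _ (hirr i j)

theorem pos_of_mcgm_ne_zero (hA : mcgm A ≠ 0) : 0 < n := by
  obtain ⟨k, h0, hk, -⟩ := exists_closed_eq_one hA
  omega

end Normalization

/-! ### Karp's formula for the maximum cycle geometric mean -/

section Karp

variable {n : ℕ} {A B : Matrix (Fin n) (Fin n) ℝ≥0}

theorem orbit_normalized (A : Matrix (Fin n) (Fin n) ℝ≥0) (x : Fin n → ℝ≥0) (r : ℕ) (i : Fin n) :
    orbit (normalized A) x r i = orbit A x r i / mcgm A ^ r := by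
  apply le_antisymm
  · obtain ⟨k, hk⟩ := exists_mvec_eq (mpow (normalized A) r) x i
    rw [orbit, hk, mpow_normalized, div_mul_eq_mul_div]
    exact div_le_div_of_nonneg_right (le_mvec _ _ i k) zero_le
  · obtain ⟨k, hk⟩ := exists_mvec_eq (mpow A r) x i
    rw [orbit, hk, ← div_mul_eq_mul_div, ← mpow_normalized]
    exact le_mvec _ _ i k

theorem mpow_mul_orbit_le (B : Matrix (Fin n) (Fin n) ℝ≥0) (x : Fin n → ℝ≥0) (a b : ℕ)
    (i j : Fin n) : mpow B a i j * orbit B x b j ≤ orbit B x (a + b) i := by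
  rw [orbit, orbit, mvec_mpow_add]
  exact le_mvec _ _ i j

theorem ClosedLeOne.orbit_reduce (hB : ClosedLeOne B) (x : Fin n → ℝ≥0) (r : ℕ) (i : Fin n) :
    ∃ k < n, orbit B x r i ≤ orbit B x k i := by
  obtain ⟨j, hj⟩ := exists_mvec_eq (mpow B r) x i
  obtain ⟨r', h1, -, -, h4⟩ := hB.reduce one_pos r i j
  refine ⟨r', by omega, ?_⟩
  rw [orbit, hj]
  exact (mul_le_mul_left h4 _).trans (le_mvec _ _ i j)

/-- At some node the `n`-th term of the orbit is maximal: walk backwards from a critical node `c`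
along a critical cycle, starting with a maximal term at `c`. -/
theorem exists_orbit_max (hB : ClosedLeOne B) {c : Fin n} (hc : UnitNode B c) (x : Fin n → ℝ≥0) :
    ∃ v, ∀ k, orbit B x k v ≤ orbit B x n v := by
  obtain ⟨K, hK, hmax⟩ := Finset.exists_max_image (Finset.range n) (fun k => orbit B x k c)
    ⟨0, Finset.mem_range.2 c.pos⟩
  have hmax' : ∀ k, orbit B x k c ≤ orbit B x K c := by
    intro k
    obtain ⟨k', h1, h2⟩ := hB.orbit_reduce x k c
    exact h2.trans (hmax k' (Finset.mem_range.2 h1))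
  rw [Finset.mem_range] at hK
  obtain ⟨d, l, hl⟩ := hc
  have hcl : 1 ≤ mpow B (l + 1) c c := hl.trans (mul_mpow_le B l c d c)
  have h1 := one_le_mpow_mul hcl n
  have e : n * (l + 1) = (n * (l + 1) - (n - K)) + (n - K) := by
    have : n ≤ n * (l + 1) := Nat.le_mul_of_pos_right n (Nat.succ_pos l)
    omega
  rw [e] at h1
  obtain ⟨v, hv⟩ := exists_mpow_add_eq B (n * (l + 1) - (n - K)) (n - K) c c
  rw [hv] at h1
  set t := n * (l + 1) - (n - K)
  refine ⟨v, fun k => ?_⟩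
  calc orbit B x k v = 1 * orbit B x k v := (one_mul _).symm
    _ ≤ (mpow B t c v * mpow B (n - K) v c) * orbit B x k v := by gcongr
    _ = mpow B (n - K) v c * (mpow B t c v * orbit B x k v) := by ring
    _ ≤ mpow B (n - K) v c * orbit B x K c := by
        gcongr; exact (mpow_mul_orbit_le _ _ _ _ _ _).trans (hmax' _)
    _ ≤ orbit B x (n - K + K) v := mpow_mul_orbit_le _ _ _ _ _ _
    _ = _ := by congr 1; omega

theorem exists_succ_ne_zero (hirr : Irred B) {c : Fin n} (hc : UnitNode B c) (i : Fin n) :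
    ∃ j, B i j ≠ 0 := by
  rcases Relation.ReflTransGen.cases_head (hirr i c) with rfl | ⟨j, h, -⟩
  · obtain ⟨j, hj⟩ := hc
    exact ⟨j, hj.ne_zero⟩
  · exact ⟨j, h⟩

theorem orbit_pos (hirr : Irred B) {c : Fin n} (hc : UnitNode B c) {x : Fin n → ℝ≥0}
    (hx : ∀ i, 0 < x i) (r : ℕ) (i : Fin n) : 0 < orbit B x r i := by
  induction r generalizing i with
  | zero => exact lt_of_lt_of_le (by simpa using hx i) (le_mvec (mpow B 0) x i i)
  | succ r ih =>
    obtain ⟨j, hj⟩ := exists_succ_ne_zero hirr hc i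
    rw [orbit_succ]
    exact (mul_pos (pos_iff_ne_zero.2 hj) (ih j)).trans_le (le_mvec _ _ i j)

/-- Karp's formula for the orbit of the all-ones vector, whose terms are positive. The minimum over
`k` of `(y n / y k) ^ (1 / (n - k))` is written as the reciprocal of a maximum, since the machine
has no minimum. -/
theorem karp (hirr : Irred A) (hA : mcgm A ≠ 0) :
    mcgm A = Finset.univ.sup fun v : Fin n => 1 / Finset.univ.sup fun k : Fin n =>
      (orbit A 1 k v / orbit A 1 n v) ^ (1 / ((n - k : ℕ) : ℝ)) := by
  obtain ⟨c, hc⟩ := exists_unitNode_normalized hA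
  have hB := closedLeOne_normalized A
  have hI := irred_normalized hirr hA
  have hpos : ∀ r i, 0 < orbit (normalized A) 1 r i := orbit_pos hI hc (fun _ => one_pos)
  have horb : ∀ r i, orbit A 1 r i = mcgm A ^ r * orbit (normalized A) 1 r i := by
    intro r i
    rw [orbit_normalized, mul_div_cancel₀ _ (pow_ne_zero r hA)]
  have hrat : ∀ (k : Fin n) v, orbit A 1 k v / orbit A 1 n v =
      (1 / mcgm A) ^ (n - k : ℕ) *
        (orbit (normalized A) 1 k v / orbit (normalized A) 1 n v) := by
    intro k v
    have h1 := (hpos n v).ne'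
    have h2 : mcgm A ^ n = mcgm A ^ (n - k : ℕ) * mcgm A ^ (k : ℕ) := by
      rw [← pow_add]; congr 1; omega
    rw [horb, horb, h2, one_div, inv_pow]
    field_simp
  have hsub : ∀ k : Fin n, (0 : ℝ) < ((n - k : ℕ) : ℝ) := fun k => by
    have : 0 < n - (k : ℕ) := by omega
    exact_mod_cast this
  have hl : 0 < 1 / mcgm A := by have := pos_iff_ne_zero.2 hA; positivity
  apply le_antisymm
  · obtain ⟨v, hv⟩ := exists_orbit_max hB hc 1
    refine le_trans ?_ (Finset.le_sup (f := fun v : Fin n => 1 / Finset.univ.sup fun k : Fin n =>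
      (orbit A 1 k v / orbit A 1 n v) ^ (1 / ((n - k : ℕ) : ℝ))) (Finset.mem_univ v))
    set g := Finset.univ.sup fun k : Fin n =>
      (orbit A 1 k v / orbit A 1 n v) ^ (1 / ((n - k : ℕ) : ℝ)) with hg
    have hg1 : g ≤ 1 / mcgm A := by
      refine Finset.sup_le fun k _ => ?_
      rw [one_div, NNReal.rpow_inv_le_iff (hsub k), NNReal.rpow_natCast, hrat]
      exact mul_le_of_le_one_right zero_le (div_le_one_of_le₀ (hv k) zero_le)
    have hg0 : 0 < g := by
      refine lt_of_lt_of_le ?_ (Finset.le_sup (f := fun k : Fin n =>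
        (orbit A 1 k v / orbit A 1 n v) ^ (1 / ((n - k : ℕ) : ℝ))) (Finset.mem_univ v))
      refine NNReal.rpow_pos ?_
      rw [hrat]
      exact mul_pos (pow_pos hl _) (div_pos (hpos _ _) (hpos _ _))
    rw [le_div_iff₀ hg0]
    rw [le_div_iff₀ (pos_iff_ne_zero.2 hA)] at hg1
    rwa [mul_comm]
  · refine Finset.sup_le fun v _ => ?_
    obtain ⟨k, hk, hle⟩ := hB.orbit_reduce 1 n v
    have h1 : 1 / mcgm A ≤ Finset.univ.sup fun k : Fin n =>
        (orbit A 1 k v / orbit A 1 n v) ^ (1 / ((n - k : ℕ) : ℝ)) := by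
      refine le_trans ?_ (Finset.le_sup (f := fun k : Fin n =>
        (orbit A 1 k v / orbit A 1 n v) ^ (1 / ((n - k : ℕ) : ℝ))) (Finset.mem_univ ⟨k, hk⟩))
      rw [one_div ((n - ((⟨k, hk⟩ : Fin n) : ℕ) : ℕ) : ℝ), NNReal.le_rpow_inv_iff (hsub ⟨k, hk⟩),
        NNReal.rpow_natCast, hrat]
      exact le_mul_of_one_le_right zero_le ((one_le_div (hpos n v)).2 hle)
    rw [div_le_iff₀ (hl.trans_le h1)]
    rw [div_le_iff₀ (pos_iff_ne_zero.2 hA)] at h1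
    rwa [mul_comm]

end Karp

/-! ### The periodic powers -/

section PeriodicPower

variable {n : ℕ} {B : Matrix (Fin n) (Fin n) ℝ≥0}

/-- A periodic power is the product of the critical columns of `B ^ s` and critical rows of suitable
powers, where the exponents matter only modulo periods of these rows. -/
theorem mmul_eq_periodic_power (hB : ClosedLeOne B) (h1 : mcgm B = 1) (hirr : Irred B)
    (hcrit : ∃ c, UnitNode B c) {s k : ℕ} (hs : n * n ≤ s) {R : Matrix (Fin n) (Fin n) ℝ≥0}
    (hR0 : ∀ c, ¬ UnitNode B c → R c = 0)
    (hR : ∀ c, UnitNode B c → ∃ e d, EvPeriod (fun r => mpow B r c) d ∧ s + s + e ≡ k [MOD d] ∧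
      R c = mpow B (s + e) c) {r : ℕ} (hr : transient B ≤ r) (hrk : r ≡ k [MOD cyclicity B]) :
    mmul (mpow B s) R = mpow B r := by
  obtain ⟨c, hc⟩ := hcrit
  obtain ⟨S, hS⟩ := Filter.eventually_atTop.1 (eventually_factor hB hirr hc)
  have hγ := cyclicity_pos hB h1
  -- a multiple of the cyclicity is added to `r`, to get beyond the index `S`
  set r' := r + cyclicity B * (S + s + s) with hr'
  have hle : S + s + s ≤ cyclicity B * (S + s + s) := Nat.le_mul_of_pos_left _ hγ
  have hrr : mpow B r = mpow B r' := by
    refine (EvPeriod.from_index (f := mpow B) hγ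
      (fun r hr => mpow_add_cyclicity hB h1 hirr ⟨c, hc⟩ hr) (EvPeriod.mul ?_ _) hr).symm
    exact EvPeriod.of_forall fun r hr => mpow_add_cyclicity hB h1 hirr ⟨c, hc⟩ hr
  set b := r' - s with hb
  have hb1 : n * n ≤ b := by omega
  have hb2 : s + b = r' := by omega
  have hrow : ∀ c, UnitNode B c → R c = mpow B b c := by
    intro c hc
    obtain ⟨e, d, hd, hmod, hRc⟩ := hR c hc
    obtain ⟨l, hl0, -, hl⟩ := hc.row_period hB
    obtain ⟨p, -, hp⟩ := (EvPeriod.of_forall (f := fun r => mpow B r c) hl).exists_least hl0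
    rw [hRc]
    refine EvPeriod.eq_of_modEq (f := fun r => mpow B r c) hl0 hl ((hp p).2 dvd_rfl) (by omega)
      hb1 ?_
    have e1 : s + s + e ≡ k [MOD p] := hmod.of_dvd ((hp d).1 hd)
    have hpγ : p ∣ cyclicity B := (hp _).1 (hc.evPeriod_cyclicity hB h1)
    have e2 : r ≡ k [MOD p] := hrk.of_dvd hpγ
    have e3 : r' ≡ r [MOD p] := by
      have h0 : cyclicity B * (S + s + s) ≡ 0 [MOD p] :=
        (Nat.modEq_zero_iff_dvd).2 (dvd_mul_of_dvd_left hpγ _)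
      exact h0.add_left r
    have e4 : s + (s + e) ≡ s + b [MOD p] := by
      rw [← add_assoc, hb2]; exact e1.trans (e3.trans e2).symm
    exact Nat.ModEq.add_left_cancel' s e4
  rw [hrr]
  funext i j
  apply le_antisymm
  · refine mmul_le_iff.2 fun c => ?_
    by_cases hc : UnitNode B c
    · rw [hrow c hc, ← hb2]
      exact mpow_mul_le _ _ _ _ _ _
    · simp [hR0 c hc]
  · obtain ⟨d, hd, hdle⟩ := hS r' (by omega) s b hs hb1 hb2 i j
    rw [← hrow d hd] at hdle
    exact hdle.trans (le_mmul _ _ i d j)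

/-- If a walk along critical edges enters a cycle, the length of that cycle is a period of the row
of its first node. -/
theorem evPeriod_of_walk (hB : ClosedLeOne B) (c : ℕ → Fin n)
    (hc : ∀ l, UnitEdge B (c l) (c (l + 1))) {m d : ℕ} (hd : c (m + d) = c m) :
    EvPeriod (fun r => mpow B r (c 0)) d := by
  have h := evPeriod_closed_walk hB (fun l => c (m + l)) d (fun l _ => hc (m + l)) hd
  clear hd
  induction m with
  | zero => exact h
  | succ m ih => exact ih ((hc m).evPeriod hB h)

/-- If a sequence has some period `l ≤ n` from the index `R` on, then `n` consecutive terms beyond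
`R` decide which numbers are eventual periods of it. -/
theorem evPeriod_iff_window {β : Type*} {f : ℕ → β} {R l : ℕ} (hl0 : 0 < l) (hln : l ≤ n)
    (hl : ∀ r, R ≤ r → f (r + l) = f r) {s : ℕ} (hs : R ≤ s) (p : ℕ) :
    EvPeriod f p ↔ ∀ e < n, f (s + (e + p)) = f (s + e) := by
  constructor
  · intro h e _
    rw [← add_assoc]
    exact EvPeriod.from_index hl0 hl h (by omega)
  · intro h
    refine EvPeriod.of_forall (R := s) fun r hr => ?_
    have hlp : EvPeriod f l := EvPeriod.of_forall hl
    have hmod : (r - s) % l ≡ r - s [MOD l] := Nat.mod_modEq _ _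
    have hmod' : s + (r - s) % l ≡ r [MOD l] := by
      have := hmod.add_left s
      rwa [Nat.add_sub_cancel' hr] at this
    have hlt := Nat.mod_lt (r - s) hl0
    rw [← EvPeriod.eq_of_modEq hl0 hl hlp (by omega) (by omega) (hmod'.add_right p),
      ← EvPeriod.eq_of_modEq hl0 hl hlp (by omega) (by omega) hmod', add_assoc]
    exact h _ (by omega)

end PeriodicPower

/-! ### Program logic -/

section Logic

/-- The integer arrays into which a program writes. -/
def Prog.intWrites : Prog → List ℕ
  | .skip => []
  | .setI a _ _ _ => [a]
  | .setR _ _ _ _ => []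
  | .seq p q => p.intWrites ++ q.intWrites
  | .ite _ p q => p.intWrites ++ q.intWrites
  | .while _ p => p.intWrites

/-- The real arrays into which a program writes. -/
def Prog.realWrites : Prog → List ℕ
  | .skip => []
  | .setI _ _ _ _ => []
  | .setR a _ _ _ => [a]
  | .seq p q => p.realWrites ++ q.realWrites
  | .ite _ p q => p.realWrites ++ q.realWrites
  | .while _ p => p.realWrites

/-- The memories `s` and `t` agree outside the integer arrays in `W` and the real arrays in `R`. -/
structure Frame (W R : List ℕ) (s t : Store) : Prop where
  int : ∀ a, a ∉ W → t.int a = s.int a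
  real : ∀ a, a ∉ R → t.real a = s.real a

theorem Frame.refl {W R : List ℕ} (s : Store) : Frame W R s s := ⟨fun _ _ => rfl, fun _ _ => rfl⟩

theorem Frame.trans {W R : List ℕ} {s t u : Store} (h1 : Frame W R s t) (h2 : Frame W R t u) :
    Frame W R s u :=
  ⟨fun a ha => (h2.int a ha).trans (h1.int a ha), fun a ha => (h2.real a ha).trans (h1.real a ha)⟩

theorem Frame.mono {W R W' R' : List ℕ} {s t : Store} (h : Frame W R s t) (hW : W ⊆ W')
    (hR : R ⊆ R') : Frame W' R' s t :=
  ⟨fun a ha => h.int a fun h' => ha (hW h'), fun a ha => h.real a fun h' => ha (hR h')⟩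

theorem Frame.setInt {W R : List ℕ} (s : Store) {a : ℕ} (ha : a ∈ W) (i j x : ℕ) :
    Frame W R s (s.setInt a i j x) := by
  refine ⟨fun b hb => ?_, fun b _ => rfl⟩
  have : b ≠ a := fun h => hb (h ▸ ha)
  funext i' j'
  simp [Store.setInt, this]

theorem Frame.setReal {W R : List ℕ} (s : Store) {a : ℕ} (ha : a ∈ R) (i j : ℕ) (x : ℝ≥0) :
    Frame W R s (s.setReal a i j x) := by
  refine ⟨fun b _ => rfl, fun b hb => ?_⟩
  have : b ≠ a := fun h => hb (h ▸ ha)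
  funext i' j'
  simp [Store.setReal, this]

theorem Exec.frame {p : Prog} {s t : Store} {k : ℕ} (h : Exec p s k t) :
    Frame p.intWrites p.realWrites s t := by
  induction h with
  | skip s => exact Frame.refl s
  | setI a i j e s => exact Frame.setInt s (by simp [Prog.intWrites]) _ _ _
  | setR a i j e s => exact Frame.setReal s (by simp [Prog.realWrites]) _ _ _
  | seq _ _ h1 h2 =>
    exact (h1.mono (List.subset_append_left _ _) (List.subset_append_left _ _)).trans
      (h2.mono (List.subset_append_right _ _) (List.subset_append_right _ _))
  | iteTrue _ _ h => exact h.mono (List.subset_append_left _ _) (List.subset_append_left _ _)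
  | iteFalse _ _ h => exact h.mono (List.subset_append_right _ _) (List.subset_append_right _ _)
  | whileFalse _ => exact Frame.refl _
  | whileTrue _ _ _ h1 h2 => exact Frame.trans h1 h2

variable {p q : Prog} {s : Store} {N M : ℕ} {P Q : Store → Prop}

theorem HaltsWithin.mono (h : HaltsWithin p s N P) (hNM : N ≤ M) (hPQ : ∀ t, P t → Q t) :
    HaltsWithin p s M Q := by
  obtain ⟨k, t, h1, h2, h3⟩ := h
  exact ⟨k, t, h1, h2.trans hNM, hPQ t h3⟩

theorem HaltsWithin.frame (h : HaltsWithin p s N P) :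
    HaltsWithin p s N fun t => P t ∧ Frame p.intWrites p.realWrites s t := by
  obtain ⟨k, t, h1, h2, h3⟩ := h
  exact ⟨k, t, h1, h2, h3, h1.frame⟩

theorem HaltsWithin.skip (h : P s) : HaltsWithin .skip s 1 P := ⟨1, s, .skip s, le_rfl, h⟩

theorem HaltsWithin.setI {a : ℕ} {i j e : IExp}
    (h : P (s.setInt a (i.eval s) (j.eval s) (e.eval s))) :
    HaltsWithin (.setI a i j e) s (i.cost + j.cost + e.cost + 1) P :=
  ⟨_, _, .setI a i j e s, le_rfl, h⟩

theorem HaltsWithin.setR {a : ℕ} {i j : IExp} {e : RExp}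
    (h : P (s.setReal a (i.eval s) (j.eval s) (e.eval s))) :
    HaltsWithin (.setR a i j e) s (i.cost + j.cost + e.cost + 1) P :=
  ⟨_, _, .setR a i j e s, le_rfl, h⟩

theorem HaltsWithin.seq (h : HaltsWithin p s N fun t => HaltsWithin q t M P) :
    HaltsWithin (.seq p q) s (N + M) P := by
  obtain ⟨k, t, h1, h2, l, u, h3, h4, h5⟩ := h
  exact ⟨k + l, u, .seq h1 h3, by omega, h5⟩

/-- Sequencing, with the arrays left alone by the first program. -/
theorem HaltsWithin.andThen (h : HaltsWithin p s N Q)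
    (h' : ∀ t, Frame p.intWrites p.realWrites s t → Q t → HaltsWithin q t M P) :
    HaltsWithin (.seq p q) s (N + M) P :=
  .seq (h.frame.mono le_rfl fun t ht => h' t ht.2 ht.1)

theorem HaltsWithin.ite {b : Test} (h1 : b.Holds s → HaltsWithin p s N P)
    (h2 : ¬ b.Holds s → HaltsWithin q s N P) : HaltsWithin (.ite b p q) s (b.cost + 1 + N) P := by
  by_cases hb : b.Holds s
  · obtain ⟨k, t, h3, h4, h5⟩ := h1 hb
    exact ⟨_, t, .iteTrue hb h3, by omega, h5⟩
  · obtain ⟨k, t, h3, h4, h5⟩ := h2 hb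
    exact ⟨_, t, .iteFalse hb h3, by omega, h5⟩

/-- A loop with exactly `m` rounds. -/
theorem HaltsWithin.while {b : Test} {c m : ℕ} {I : ℕ → Store → Prop} (h0 : I 0 s)
    (step : ∀ j < m, ∀ t, Frame p.intWrites p.realWrites s t → I j t →
      b.Holds t ∧ HaltsWithin p t c (I (j + 1)))
    (halt : ∀ t, Frame p.intWrites p.realWrites s t → I m t → ¬ b.Holds t) :
    HaltsWithin (.while b p) s (m * (b.cost + 1 + c) + (b.cost + 1)) (I m) := by
  have key : ∀ d j, j + d = m → ∀ t, Frame p.intWrites p.realWrites s t → I j t →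
      HaltsWithin (.while b p) t (d * (b.cost + 1 + c) + (b.cost + 1)) (I m) := by
    intro d
    induction d with
    | zero =>
      rintro j rfl t hf hI
      exact ⟨_, t, .whileFalse (halt t hf hI), by omega, hI⟩
    | succ d ih =>
      intro j hj t hf hI
      obtain ⟨hb, k, u, h1, h2, h3⟩ := step j (by omega) t hf hI
      obtain ⟨l, w, h4, h5, h6⟩ := ih (j + 1) (by omega) u (hf.trans h1.frame) h3
      refine ⟨_, w, .whileTrue hb h1 h4, ?_, h6⟩
      rw [Nat.succ_mul]
      omega
  exact key m 0 (by omega) s (Frame.refl s) h0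

/-! ### Registers and loops -/

/-- The integer register `a`: the cell `(0, 0)` of array `a`. -/
abbrev reg (a : ℕ) : IExp := .get a (.const 0) (.const 0)

/-- The real register `a`: the cell `(0, 0)` of array `a`. -/
abbrev rreg (a : ℕ) : RExp := .get a (.const 0) (.const 0)

/-- Assignment to an integer register. -/
abbrev setReg (a : ℕ) (e : IExp) : Prog := .setI a (.const 0) (.const 0) e

/-- Assignment to a real register. -/
abbrev setRReg (a : ℕ) (e : RExp) : Prog := .setR a (.const 0) (.const 0) e

/-- Let the register `v` run from `0` to the content of the register `b`, exclusively. -/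
def forLoop (b v : ℕ) (p : Prog) : Prog :=
  .seq (setReg v (.const 0)) (.while (.not (.ile (reg b) (reg v)))
    (.seq p (setReg v (.add (reg v) (.const 1)))))

theorem intWrites_forLoop (b v : ℕ) (p : Prog) :
    (forLoop b v p).intWrites = v :: (p.intWrites ++ [v]) := rfl

theorem realWrites_forLoop (b v : ℕ) (p : Prog) :
    (forLoop b v p).realWrites = p.realWrites ++ [] := rfl

@[simp] theorem setInt_self (s : Store) (a i j x : ℕ) : (s.setInt a i j x).int a i j = x := by
  simp [Store.setInt]

theorem setInt_of_ne (s : Store) {a b : ℕ} (h : b ≠ a) (i j x : ℕ) :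
    (s.setInt a i j x).int b = s.int b := by
  funext i' j'; simp [Store.setInt, h]

@[simp] theorem setReal_self (s : Store) (a i j : ℕ) (x : ℝ≥0) :
    (s.setReal a i j x).real a i j = x := by
  simp [Store.setReal]

/-- The rule for counting loops. The invariant `I j` holds before the round number `j`; it must not
depend on the counter. -/
theorem HaltsWithin.forLoop {b v c : ℕ} {I : ℕ → Store → Prop} (hN : s.int b 0 0 = N)
    (hbv : b ≠ v) (hb : b ∉ p.intWrites) (hv : v ∉ p.intWrites)
    (hI : ∀ j t x, I j t → I j (t.setInt v 0 0 x)) (h0 : I 0 s)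
    (step : ∀ j < N, ∀ t, Frame (forLoop b v p).intWrites (forLoop b v p).realWrites s t →
      t.int v 0 0 = j → I j t → HaltsWithin p t c (I (j + 1))) :
    HaltsWithin (forLoop b v p) s (N * (c + 17) + 13) (I N) := by
  set W := (MaxTimes.forLoop b v p).intWrites with hW
  set R := (MaxTimes.forLoop b v p).realWrites with hR
  rw [intWrites_forLoop] at hW
  rw [realWrites_forLoop] at hR
  have hbW : b ∉ W := by simp [hW, hbv, hb]
  refine HaltsWithin.mono (M := N * (c + 17) + 13) (P := fun t => I N t ∧ t.int v 0 0 = N)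
    (.seq (N := 4) (M := N * (8 + 1 + (c + 8)) + (8 + 1)) (.setI ?_)) ?_ fun t ht => ht.1
  · set s' := s.setInt v 0 0 0
    change HaltsWithin _ s' _ _
    have hs' : Frame W R s s' := Frame.setInt s (by simp [hW]) 0 0 0
    refine HaltsWithin.while (c := c + 8) (m := N) (I := fun j t => I j t ∧ t.int v 0 0 = j)
      ⟨hI _ _ _ h0, setInt_self s v 0 0 0⟩ ?_ ?_
    · rintro j hj t hf ⟨hIj, hvj⟩
      have hf' : Frame W R s t := hs'.trans (hf.mono
        (by simp [hW, Prog.intWrites]) (by simp [hR, Prog.realWrites]))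
      have hbt : t.int b 0 0 = N := by rw [hf'.int b hbW, hN]
      constructor
      · simp only [Test.Holds, IExp.eval, hvj, hbt]; omega
      · refine HaltsWithin.andThen (step j hj t hf' hvj hIj)
          fun u hu hIu => .setI ⟨hI _ _ _ hIu, ?_⟩
        have : u.int v 0 0 = j := by rw [hu.int v hv, hvj]
        simp [IExp.eval, this]
    · rintro t hf ⟨-, hvN⟩
      have hf' : Frame W R s t := hs'.trans (hf.mono
        (by simp [hW, Prog.intWrites]) (by simp [hR, Prog.realWrites]))
      have hbt : t.int b 0 0 = N := by rw [hf'.int b hbW, hN]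
      simp [Test.Holds, IExp.eval, hvN, hbt]
  · have : N * (8 + 1 + (c + 8)) = N * (c + 17) := by ring
    omega

/-- Compute a maximum: `acc = max_v e`, where `pre` prepares the evaluation of `e`. -/
def maxLoop (b v acc : ℕ) (pre : Prog) (e : RExp) : Prog :=
  .seq (setRReg acc .zero) (forLoop b v (.seq pre (setRReg acc (.max (rreg acc) e))))

theorem HaltsWithin.maxLoop {n b v acc c : ℕ} {pre : Prog} {e : RExp} {f : Fin n → ℝ≥0}
    (hn : s.int b 0 0 = n) (hbv : b ≠ v) (hb : b ∉ pre.intWrites) (hv : v ∉ pre.intWrites)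
    (hacc : acc ∉ pre.realWrites)
    (step : ∀ (j : Fin n) (t : Store),
      Frame (maxLoop b v acc pre e).intWrites (maxLoop b v acc pre e).realWrites s t →
      t.int v 0 0 = j → HaltsWithin pre t c fun u => e.eval u = f j) :
    HaltsWithin (maxLoop b v acc pre e) s (n * (c + e.cost + 24) + 17)
      fun t => t.real acc 0 0 = Finset.univ.sup f := by
  refine HaltsWithin.mono (M := n * (c + e.cost + 24) + 17)
    (P := fun t => t.real acc 0 0 = (Finset.univ.filter fun j : Fin n => (j : ℕ) < n).sup f)
    (.seq (N := 4) (M := n * ((c + (e.cost + 7)) + 17) + 13) (.setR ?_)) (by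
      have : n * ((c + (e.cost + 7)) + 17) = n * (c + e.cost + 24) := by ring
      omega) (fun t ht => by
        rw [ht]; congr 1
        ext j; simp)
  refine HaltsWithin.forLoop (I := fun m t => t.real acc 0 0 =
    (Finset.univ.filter fun j : Fin n => (j : ℕ) < m).sup f) hn hbv
    (by simpa [Prog.intWrites] using hb) (by simpa [Prog.intWrites] using hv)
    (fun _ _ _ h => h) (by simp [RExp.eval, IExp.eval]) ?_
  intro j hj t hf hvj hI
  have hf' := (Frame.setReal (W := (MaxTimes.maxLoop b v acc pre e).intWrites)
    (R := (MaxTimes.maxLoop b v acc pre e).realWrites) s (a := acc)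
    (by simp [MaxTimes.maxLoop, Prog.realWrites]) 0 0 0).trans
    (hf.mono (List.subset_append_right _ _) (List.subset_append_right _ _))
  refine (HaltsWithin.andThen (M := e.cost + 7) (step ⟨j, hj⟩ t hf' hvj)
    fun u hu he => (HaltsWithin.setR ?_).mono (by simp [IExp.cost, RExp.cost]; omega)
    fun _ h => h)
  have h1 : u.real acc 0 0 = t.real acc 0 0 := by rw [hu.real acc hacc]
  have h2 : (Finset.univ.filter fun i : Fin n => (i : ℕ) < j + 1)
      = insert ⟨j, hj⟩ (Finset.univ.filter fun i : Fin n => (i : ℕ) < j) := by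
    ext i
    simp only [Finset.mem_filter, Finset.mem_univ, true_and, Finset.mem_insert, Fin.ext_iff]
    omega
  simp only [RExp.eval, IExp.eval, setReal_self]
  rw [h2, Finset.sup_insert, he, h1, hI, sup_comm]

/-- Fill the row with number `i` of the array `dst`: entry `w` becomes the value of `e`, whose
evaluation is prepared by `pre`. -/
def rowLoop (b w dst : ℕ) (i : IExp) (pre : Prog) (e : RExp) : Prog :=
  forLoop b w (.seq pre (.setR dst i (reg w) e))

theorem HaltsWithin.rowLoop {n b w dst c r : ℕ} {i : IExp} {pre : Prog} {e : RExp}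
    {f : Fin n → ℝ≥0} (hn : s.int b 0 0 = n) (hbw : b ≠ w) (hb : b ∉ pre.intWrites)
    (hw : w ∉ pre.intWrites) (hdst : dst ∉ pre.realWrites)
    (step : ∀ (j : Fin n) (t : Store),
      Frame (rowLoop b w dst i pre e).intWrites (rowLoop b w dst i pre e).realWrites s t →
      (∀ r' ≠ r, t.real dst r' = s.real dst r') →
      t.int w 0 0 = j → HaltsWithin pre t c fun u => i.eval u = r ∧ e.eval u = f j) :
    HaltsWithin (rowLoop b w dst i pre e) s (n * (c + i.cost + e.cost + 21) + 13)
      fun t => (∀ j : Fin n, t.real dst r j = f j) ∧ ∀ r' ≠ r, t.real dst r' = s.real dst r' := by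
  refine HaltsWithin.mono (M := n * (c + i.cost + e.cost + 21) + 13)
    (P := fun t => (∀ j : Fin n, (j : ℕ) < n → t.real dst r j = f j) ∧
      ∀ r' ≠ r, t.real dst r' = s.real dst r')
    (HaltsWithin.forLoop (c := c + (i.cost + e.cost + 4)) (I := fun m t =>
      (∀ j : Fin n, (j : ℕ) < m → t.real dst r j = f j) ∧
      ∀ r' ≠ r, t.real dst r' = s.real dst r') hn hbw
    (by simpa [Prog.intWrites] using hb) (by simpa [Prog.intWrites] using hw)
    (fun _ _ _ h => h) (by simp) ?_) (by
      have : n * ((c + (i.cost + e.cost + 4)) + 17) = n * (c + i.cost + e.cost + 21) := by ring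
      omega) (fun t ht => ⟨fun j => ht.1 j j.2, ht.2⟩)
  rintro j hj t hf hwj ⟨hI, hI'⟩
  refine (HaltsWithin.andThen (M := i.cost + e.cost + 4) (step ⟨j, hj⟩ t hf hI' hwj)
    fun u hu he => (HaltsWithin.setR ?_).mono (by simp [IExp.cost]; omega)
    fun _ h => h)
  have h1 : u.int w 0 0 = j := by rw [hu.int w hw, hwj]
  have h2 : u.real dst = t.real dst := hu.real dst hdst
  simp only [IExp.eval, h1, he.1, he.2]
  constructor
  · intro k hk
    rcases Nat.lt_succ_iff_lt_or_eq.1 hk with hk | hk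
    · rw [← hI k hk, ← h2]
      simp [Store.setReal, hk.ne]
    · have : k = ⟨j, hj⟩ := Fin.ext hk
      subst this
      simp
  · intro r' hr'
    rw [← hI' r' hr', ← h2]
    funext k
    simp [Store.setReal, hr']

/-- Fill the array `dst`: entry `(v, w)` becomes the value of `e`, whose evaluation is prepared by
`pre`. -/
def tabulate (b v w dst : ℕ) (pre : Prog) (e : RExp) : Prog :=
  forLoop b v (rowLoop b w dst (reg v) pre e)

theorem HaltsWithin.tabulate {n b v w dst c : ℕ} {pre : Prog} {e : RExp}
    {f : Matrix (Fin n) (Fin n) ℝ≥0} (hn : s.int b 0 0 = n) (hbv : b ≠ v) (hbw : b ≠ w)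
    (hvw : v ≠ w) (hb : b ∉ pre.intWrites) (hv : v ∉ pre.intWrites)
    (hw : w ∉ pre.intWrites) (hdst : dst ∉ pre.realWrites)
    (step : ∀ (i j : Fin n) (t : Store),
      Frame (tabulate b v w dst pre e).intWrites (tabulate b v w dst pre e).realWrites s t →
      t.int v 0 0 = i → t.int w 0 0 = j → HaltsWithin pre t c fun u => e.eval u = f i j) :
    HaltsWithin (tabulate b v w dst pre e) s (n * (n * (c + e.cost + 24) + 30) + 13)
      fun t => ∀ i j : Fin n, t.real dst i j = f i j := by
  refine HaltsWithin.mono (M := n * (n * (c + e.cost + 24) + 30) + 13)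
    (P := fun t => ∀ i : Fin n, (i : ℕ) < n → ∀ j : Fin n, t.real dst i j = f i j)
    (HaltsWithin.forLoop (c := n * (c + 3 + e.cost + 21) + 13) (I := fun m t =>
      ∀ i : Fin n, (i : ℕ) < m → ∀ j : Fin n, t.real dst i j = f i j) hn hbv
    (by simp [MaxTimes.rowLoop, intWrites_forLoop, Prog.intWrites, hb, hbw])
    (by simp [MaxTimes.rowLoop, intWrites_forLoop, Prog.intWrites, hv, hvw])
    (fun _ _ _ h => h) (by simp) ?_) (by
      have : n * (c + 3 + e.cost + 21) = n * (c + e.cost + 24) := by ring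
      rw [this]) (fun t ht i => ht i i.2)
  intro i hi t hf hvi hI
  refine (HaltsWithin.rowLoop (r := i) (f := f ⟨i, hi⟩) (c := c) ?_ hbw hb hw hdst
    ?_).mono le_rfl ?_
  · rw [hf.int b, hn]
    simp [MaxTimes.rowLoop, intWrites_forLoop, Prog.intWrites, hb, hbw, hbv]
  · intro j u hu _ hwj
    have hvu : u.int v 0 0 = i := by
      rw [hu.int v, hvi]
      simp [MaxTimes.rowLoop, intWrites_forLoop, Prog.intWrites, hv, hvw]
    refine (HaltsWithin.frame (step ⟨i, hi⟩ j u ?_ hvu hwj)).mono le_rfl fun x hx => ⟨?_, hx.1⟩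
    · refine hf.trans (hu.mono ?_ ?_)
      · rw [intWrites_forLoop]
        exact List.subset_cons_of_subset _ (List.subset_append_left _ _)
      · rw [realWrites_forLoop]
        exact List.subset_append_left _ _
    · simp only [IExp.eval]
      rw [hx.2.int v hv, hvu]
  · rintro u ⟨h1, h2⟩ k hk j
    rcases Nat.lt_succ_iff_lt_or_eq.1 hk with hk | hk
    · rw [h2 k hk.ne, hI k hk]
    · have : k = ⟨i, hi⟩ := Fin.ext hk
      subst this
      exact h1 j

end Logic

/-! ### Arrays written by loops, and the cost of loops -/

section MatrixRoutines

attribute [simp] Prog.intWrites Prog.realWrites intWrites_forLoop realWrites_forLoop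

@[simp] theorem intWrites_maxLoop (b v acc : ℕ) (pre : Prog) (e : RExp) :
    (maxLoop b v acc pre e).intWrites = v :: (pre.intWrites ++ [v]) := by
  simp [maxLoop]

@[simp] theorem realWrites_maxLoop (b v acc : ℕ) (pre : Prog) (e : RExp) :
    (maxLoop b v acc pre e).realWrites = acc :: (pre.realWrites ++ [acc]) := by
  simp [maxLoop]

@[simp] theorem intWrites_rowLoop (b w dst : ℕ) (i : IExp) (pre : Prog) (e : RExp) :
    (rowLoop b w dst i pre e).intWrites = w :: (pre.intWrites ++ [w]) := by
  simp [rowLoop]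

@[simp] theorem realWrites_rowLoop (b w dst : ℕ) (i : IExp) (pre : Prog) (e : RExp) :
    (rowLoop b w dst i pre e).realWrites = pre.realWrites ++ [dst] := by
  simp [rowLoop]

@[simp] theorem intWrites_tabulate (b v w dst : ℕ) (pre : Prog) (e : RExp) :
    (tabulate b v w dst pre e).intWrites = v :: w :: (pre.intWrites ++ [w, v]) := by
  simp [tabulate]

@[simp] theorem realWrites_tabulate (b v w dst : ℕ) (pre : Prog) (e : RExp) :
    (tabulate b v w dst pre e).realWrites = pre.realWrites ++ [dst] := by
  simp [tabulate]

/-- The cost of a loop whose rounds cost at most `c * n ^ k + a`. -/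
theorem loop_cost_le {n : ℕ} (hn : 0 < n) (c a b k : ℕ) :
    n * (c * n ^ k + a) + b ≤ (c + a + b) * n ^ (k + 1) := by
  have h1 : 1 ≤ n ^ k := Nat.one_le_pow _ _ hn
  have h2 : 1 ≤ n ^ (k + 1) := Nat.one_le_pow _ _ hn
  calc n * (c * n ^ k + a) + b ≤ n * (c * n ^ k + a * n ^ k) + b * n ^ (k + 1) := by
        gcongr
        · exact Nat.le_mul_of_pos_right a h1
        · exact Nat.le_mul_of_pos_right b h2
    _ = _ := by ring

/-! ### Matrix routines

The arrays in use. Integer arrays: `0` the dimension, `1` the integer input, `2` the integer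
output, `3`, `4`, `5` counters, `6` the number to be halved, `7` the exponent, `8` the critical
successors, `9` the number of terms of an orbit or a node moving along critical edges, `10` a period
or another such node, `11` a flag or the length of a critical cycle, `12` an exponent, `13` the
period of an orbit, `14` a multiple of it. Real arrays: `0` the input matrix, `1` the input vector,
`2` the output matrix, `3` an accumulator, `4` the terms of Karp's formula, `5` the cycle mean, `6`
the normalized matrix, `7` the sum of its powers, `8` its power, `9` a scratch matrix, `10` the
terms of an orbit, `11` rows of periodic powers, `12` the weight of a walk.

The constants in the running times are rough upper bounds. -/

/-- The real array `a` holds the matrix `M`. -/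
def Store.HasMat {n : ℕ} (s : Store) (a : ℕ) (M : Matrix (Fin n) (Fin n) ℝ≥0) : Prop :=
  ∀ i j : Fin n, s.real a i j = M i j

theorem Store.HasMat.congr {n : ℕ} {s t : Store} {a : ℕ} {M : Matrix (Fin n) (Fin n) ℝ≥0}
    (h : s.HasMat a M) (hst : t.real a = s.real a) : t.HasMat a M := by
  intro i j; rw [hst]; exact h i j

variable {n : ℕ} {s : Store}

/-- Copy the matrix in the array `src` to the array `dst`. -/
def copyMat (src dst : ℕ) : Prog := tabulate 0 3 4 dst .skip (.get src (reg 3) (reg 4))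

@[simp] theorem intWrites_copyMat (src dst : ℕ) : (copyMat src dst).intWrites = [3, 4, 4, 3] := rfl

@[simp] theorem realWrites_copyMat (src dst : ℕ) : (copyMat src dst).realWrites = [dst] := rfl

theorem copyMat_spec {src dst : ℕ} (hne : src ≠ dst) (hn : 0 < n) (h0 : s.int 0 0 0 = n)
    {M : Matrix (Fin n) (Fin n) ℝ≥0} (hM : s.HasMat src M) :
    HaltsWithin (copyMat src dst) s (75 * n ^ 2) fun t => t.HasMat dst M := by
  refine (HaltsWithin.tabulate (c := 1) (f := M) h0 (by decide) (by decide) (by decide) (by simp)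
    (by simp) (by simp) (by simp) ?_).mono ?_ fun t ht => ht
  · intro i j t hf hi hj
    refine .skip ?_
    simp only [RExp.eval, IExp.eval, hi, hj]
    rw [hf.real src (by simpa using hne)]
    exact hM i j
  · calc _ ≤ n * ((32 * n ^ 1) + 30) + 13 := by
          simp only [RExp.cost, IExp.cost]; rw [pow_one, mul_comm n (1 + _ + 24)]
      _ ≤ _ := loop_cost_le hn 32 30 13 1

/-- Store the maximum `max_k X[i][k] * Y[k][j]` in the accumulator. -/
def dotLoop (X Y : ℕ) : Prog :=
  maxLoop 0 5 3 .skip (.mul (.get X (reg 3) (reg 5)) (.get Y (reg 5) (reg 4)))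

@[simp] theorem intWrites_dotLoop (X Y : ℕ) : (dotLoop X Y).intWrites = [5, 5] := rfl

@[simp] theorem realWrites_dotLoop (X Y : ℕ) : (dotLoop X Y).realWrites = [3, 3] := rfl

theorem dotLoop_spec {X Y : ℕ} (hX : X ≠ 3) (hY : Y ≠ 3) (hn : 0 < n)
    (h0 : s.int 0 0 0 = n) {M N : Matrix (Fin n) (Fin n) ℝ≥0} (hM : s.HasMat X M)
    (hN : s.HasMat Y N) {i j : Fin n} (hi : s.int 3 0 0 = i) (hj : s.int 4 0 0 = j) :
    HaltsWithin (dotLoop X Y) s (57 * n) fun t => t.real 3 0 0 = mmul M N i j := by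
  refine (HaltsWithin.maxLoop (c := 1) (f := fun k => M i k * N k j) h0 (by decide) (by simp)
    (by simp) (by simp) ?_).mono ?_ fun t ht => ht
  · intro k t hf hk
    refine .skip ?_
    simp only [RExp.eval, IExp.eval, hk]
    rw [hf.real X (by simpa using hX), hf.real Y (by simpa using hY), hf.int 3 (by simp),
      hf.int 4 (by simp), hi, hj, hM i k, hN k j]
  · simp only [RExp.cost, IExp.cost]; omega

/-- Store the matrix with entries `e` in `dst`, where `e` may use the entries of the product of the
matrices in `X` and `Y`, found in the accumulator. -/
def mulMat (X Y dst : ℕ) (e : RExp) : Prog := tabulate 0 3 4 dst (dotLoop X Y) e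

@[simp] theorem intWrites_mulMat (X Y dst : ℕ) (e : RExp) :
    (mulMat X Y dst e).intWrites = [3, 4, 5, 5, 4, 3] := rfl

@[simp] theorem realWrites_mulMat (X Y dst : ℕ) (e : RExp) :
    (mulMat X Y dst e).realWrites = [3, 3, dst] := rfl

theorem mulMat_spec {X Y dst : ℕ} {e : RExp} (hX : X ≠ 3) (hY : Y ≠ 3) (hXd : X ≠ dst)
    (hYd : Y ≠ dst) (hd : dst ≠ 3) (hn : 0 < n) (h0 : s.int 0 0 0 = n)
    {M N P : Matrix (Fin n) (Fin n) ℝ≥0} (hM : s.HasMat X M) (hN : s.HasMat Y N)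
    (he : ∀ (t : Store) (i j : Fin n), t.HasMat X M → t.int 3 0 0 = i → t.int 4 0 0 = j →
      t.real 3 0 0 = mmul M N i j → e.eval t = P i j) :
    HaltsWithin (mulMat X Y dst e) s ((124 + e.cost) * n ^ 3) fun t => t.HasMat dst P := by
  refine (HaltsWithin.tabulate (c := 57 * n) (f := P) h0 (by decide) (by decide) (by decide)
    (by simp) (by simp) (by simp)
    (by simpa using hd) ?_).mono ?_ fun t ht => ht
  · intro i j t hf hi hj
    have hXt : t.HasMat X M := hM.congr (hf.real X (by simp [hX, hXd]))
    have hYt : t.HasMat Y N := hN.congr (hf.real Y (by simp [hY, hYd]))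
    have h0t : t.int 0 0 0 = n := by rw [hf.int 0 (by simp), h0]
    refine (HaltsWithin.frame (dotLoop_spec hX hY hn h0t hXt hYt hi hj)).mono le_rfl ?_
    rintro u ⟨hu, hfu⟩
    refine he u i j (hXt.congr (hfu.real X (by simp [hX]))) ?_ ?_ hu
    · rw [hfu.int 3 (by simp), hi]
    · rw [hfu.int 4 (by simp), hj]
  · have h1 := loop_cost_le hn 57 (e.cost + 24) 0 1
    have h2 := loop_cost_le hn (57 + (e.cost + 24)) 30 13 2
    calc _ = n * (n * (57 * n ^ 1 + (e.cost + 24)) + 0 + 30) + 13 := by ring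
      _ ≤ n * ((57 + (e.cost + 24)) * n ^ 2 + 30) + 13 := by gcongr; exact h1
      _ ≤ _ := h2
      _ = _ := by ring

/-- Fill the rows `1, 2, …` of the array `Y` with the successive images of row `0` under the matrix
in the array `M`; the register `b` holds their number. -/
def orbitLoop (b M Y : ℕ) : Prog :=
  forLoop b 3 (rowLoop 0 4 Y (.add (reg 3) (.const 1))
    (maxLoop 0 5 3 .skip (.mul (.get M (reg 4) (reg 5)) (.get Y (reg 3) (reg 5)))) (rreg 3))

@[simp] theorem intWrites_orbitLoop (b M Y : ℕ) :
    (orbitLoop b M Y).intWrites = [3, 4, 5, 5, 4, 3] := rfl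

theorem orbitLoop_spec {b M Y N : ℕ} (hb3 : b ≠ 3) (hb4 : b ≠ 4) (hb5 : b ≠ 5)
    (hM3 : M ≠ 3) (hY3 : Y ≠ 3) (hMY : M ≠ Y) (hn : 0 < n) (h0 : s.int 0 0 0 = n)
    (hN : s.int b 0 0 = N) {B : Matrix (Fin n) (Fin n) ℝ≥0} (hM : s.HasMat M B)
    {y : ℕ → Fin n → ℝ≥0} (hy : ∀ r, y (r + 1) = mvec B (y r))
    (hY : ∀ i : Fin n, s.real Y 0 i = y 0 i) :
    HaltsWithin (orbitLoop b M Y) s (N * (116 * n ^ 2) + 13)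
      fun t => ∀ r ≤ N, ∀ i : Fin n, t.real Y r i = y r i := by
  have hpos : 1 ≤ n ^ 2 := Nat.one_le_pow _ _ hn
  refine HaltsWithin.mono (HaltsWithin.forLoop (c := 99 * n ^ 2)
    (I := fun m t => ∀ r ≤ m, ∀ i : Fin n, t.real Y r i = y r i) hN hb3 (by simp [hb4, hb5])
    (by simp) (fun _ _ _ h => h) (fun r hr i => ?_) ?_)
    (by gcongr; omega) fun t ht => ht
  · obtain rfl := Nat.le_zero.1 hr
    exact hY i
  intro r hr t hf hrt hI
  have h0t : t.int 0 0 0 = n := by rw [hf.int 0 (by simp), h0]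
  have hMt : t.HasMat M B := hM.congr (hf.real M (by simp [hM3, hMY]))
  refine (HaltsWithin.rowLoop (c := n * 40 + 17) (r := r + 1) (f := y (r + 1)) h0t (by decide)
    (by simp) (by simp) (by simp [hY3]) ?_).mono ?_ ?_
  · intro i u hu hrow hi
    have h0u : u.int 0 0 0 = n := by rw [hu.int 0 (by simp), h0t]
    refine (HaltsWithin.frame (HaltsWithin.maxLoop (n := n) (c := 1) (f := fun k => B i k * y r k)
      h0u (by decide) (by simp) (by simp) (by simp) ?_)).mono le_rfl ?_
    · intro k w hw hk
      refine .skip ?_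
      simp only [RExp.eval, IExp.eval, hk]
      rw [hw.real M (by simp [hM3]), hw.real Y (by simp [hY3]), hw.int 3 (by simp),
        hw.int 4 (by simp), hi, hu.int 3 (by simp), hrt, hrow r (by omega), hI r le_rfl k,
        hu.real M (by simp [hM3, hMY]), hMt i k]
    · rintro w ⟨hw, hfw⟩
      refine ⟨?_, ?_⟩
      · simp only [IExp.eval]
        rw [hfw.int 3 (by simp), hu.int 3 (by simp), hrt]
      · simp only [RExp.eval, IExp.eval]
        rw [hw, hy]
        rfl
  · simp only [RExp.cost, IExp.cost]
    have h1 := loop_cost_le hn 40 46 13 1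
    calc _ = n * (40 * n ^ 1 + 46) + 13 := by ring
      _ ≤ _ := h1
  · rintro u ⟨h1, h2⟩ k hk i
    rcases Nat.lt_or_eq_of_le hk with hk | rfl
    · rw [h2 k hk.ne, hI k (by omega)]
    · exact h1 i

end MatrixRoutines

/-! ### Karp's algorithm and the normalized matrix -/

section CommonPart

variable {n : ℕ} {s : Store}

@[simp] theorem orbit_zero (B : Matrix (Fin n) (Fin n) ℝ≥0) (x : Fin n → ℝ≥0) :
    orbit B x 0 = x := by
  funext i
  apply le_antisymm
  · obtain ⟨k, hk⟩ := exists_mvec_eq (mpow B 0) x i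
    rw [orbit, hk]
    by_cases h : i = k
    · subst h; simp
    · simp [Matrix.one_apply_ne h]
  · have := le_mvec (mpow B 0) x i i
    rwa [mpow_zero, Matrix.one_apply_eq, one_mul] at this

/-- Compute the maximum cycle geometric mean by Karp's formula. -/
def karpProg : Prog :=
  .seq (rowLoop 0 3 4 (.const 0) .skip .one) <| .seq (orbitLoop 0 0 4) <|
    maxLoop 0 3 5
      (maxLoop 0 4 3 .skip (.root (.sub (reg 0) (reg 4))
        (.div (.get 4 (reg 4) (reg 3)) (.get 4 (reg 0) (reg 3)))))
      (.div .one (rreg 3))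

@[simp] theorem intWrites_karpProg : karpProg.intWrites =
    [3, 3, 3, 4, 5, 5, 4, 3, 3, 4, 4, 3] := rfl

@[simp] theorem realWrites_karpProg : karpProg.realWrites = [4, 3, 3, 4, 5, 3, 3, 5] := rfl

theorem karpProg_spec (hn : 0 < n) (h0 : s.int 0 0 0 = n)
    {A : Matrix (Fin n) (Fin n) ℝ≥0} (hA : s.HasMat 0 A) (hirr : Irred A) (hA0 : mcgm A ≠ 0) :
    HaltsWithin karpProg s (300 * n ^ 3) fun t => t.real 5 0 0 = mcgm A := by
  refine HaltsWithin.mono (.andThen (HaltsWithin.rowLoop (c := 1) (r := 0)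
    (f := fun _ : Fin n => 1) h0 (by decide) (by simp) (by simp) (by simp) ?_)
    fun t hf ht => .andThen (orbitLoop_spec (N := n) (y := orbit A 1) (by decide) (by decide)
      (by decide) (by decide) (by decide) (by decide) hn (by rw [hf.int 0 (by simp), h0])
      (by rw [hf.int 0 (by simp), h0]) (hA.congr (hf.real 0 (by simp)))
      (orbit_succ A 1) (fun i => by rw [ht.1 i]; simp)) fun u hu hY =>
    (HaltsWithin.maxLoop (c := n * 48 + 17)
      (f := fun v : Fin n => 1 / Finset.univ.sup fun k : Fin n =>
        (orbit A 1 k v / orbit A 1 n v) ^ (1 / ((n - k : ℕ) : ℝ)))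
      (by rw [hu.int 0 (by simp), hf.int 0 (by simp), h0])
      (by decide) (by simp) (by simp) (by simp) ?_)) ?_
    fun t ht => ht.trans (karp hirr hA0).symm
  · intro j t _ _ _
    exact .skip ⟨rfl, rfl⟩
  · intro v w hw hv
    have hw0 : w.int 0 0 0 = n := by
      rw [hw.int 0 (by simp), hu.int 0 (by simp), hf.int 0 (by simp), h0]
    refine (HaltsWithin.maxLoop (n := n) (c := 1) (f := fun k : Fin n =>
        (orbit A 1 k v / orbit A 1 n v) ^ (1 / ((n - k : ℕ) : ℝ))) hw0 (by decide) (by simp)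
        (by simp) (by simp) ?_).mono (by simp [RExp.cost, IExp.cost]) ?_
    · intro k x hx hk
      refine .skip ?_
      simp only [RExp.eval, IExp.eval, hk]
      rw [hx.int 0 (by simp), hx.int 3 (by simp), hw0, hv, hx.real 4 (by simp),
        hw.real 4 (by simp), hY _ k.2.le, hY n le_rfl]
    · intro x hx
      simp only [RExp.eval, IExp.eval]
      rw [hx]
  · simp only [RExp.cost, IExp.cost]
    have h1 : n ≤ n ^ 3 := Nat.le_self_pow (by decide) n
    have h2 : n ^ 2 ≤ n ^ 3 := Nat.pow_le_pow_right hn (by decide)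
    have h3 : 0 < n ^ 3 := by positivity
    calc _ = 116 * n ^ 3 + 48 * n ^ 2 + 70 * n + 43 := by ring
      _ ≤ _ := by omega

/-- Store the normalized matrix in array `6`. -/
def normProg : Prog :=
  .seq karpProg (tabulate 0 3 4 6 .skip (.div (.get 0 (reg 3) (reg 4)) (rreg 5)))

@[simp] theorem intWrites_normProg : normProg.intWrites =
    [3, 3, 3, 4, 5, 5, 4, 3, 3, 4, 4, 3, 3, 4, 4, 3] := rfl

@[simp] theorem realWrites_normProg : normProg.realWrites = [4, 3, 3, 4, 5, 3, 3, 5, 6] := rfl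

theorem normProg_spec (hn : 0 < n) (h0 : s.int 0 0 0 = n)
    {A : Matrix (Fin n) (Fin n) ℝ≥0} (hA : s.HasMat 0 A) (hirr : Irred A) (hA0 : mcgm A ≠ 0) :
    HaltsWithin normProg s (400 * n ^ 3) fun t => t.HasMat 6 (normalized A) := by
  refine HaltsWithin.mono (.andThen (karpProg_spec hn h0 hA hirr hA0) fun t hf ht =>
    HaltsWithin.tabulate (c := 1) (f := normalized A)
      (by rw [hf.int 0 (by simp), h0]) (by decide) (by decide)
      (by decide) (by simp) (by simp) (by simp) (by simp) ?_) ?_ fun t ht => ht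
  · intro i j u hu hi hj
    refine .skip ?_
    simp only [RExp.eval, IExp.eval]
    rw [hi, hj, hu.real 0 (by simp), hu.real 5 (by simp), ht,
      hf.real 0 (by simp), hA i j]
    rfl
  · simp only [RExp.cost, IExp.cost]
    have h1 : n ≤ n ^ 3 := Nat.le_self_pow (by decide) n
    have h2 : n ^ 2 ≤ n ^ 3 := Nat.pow_le_pow_right hn (by decide)
    have h3 : 0 < n ^ 3 := by positivity
    calc _ = 300 * n ^ 3 + 36 * n ^ 2 + 30 * n + 13 := by ring
      _ ≤ _ := by omega

/-! ### Repeated squaring -/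

/-- `S` collects the powers `B, B ^ 2, …, B ^ q`: its entries are at least those of the first `q`
powers, and at most those of some positive powers. -/
def IsPowerSum (B : Matrix (Fin n) (Fin n) ℝ≥0) (q : ℕ) (S : Matrix (Fin n) (Fin n) ℝ≥0) : Prop :=
  ∀ i j, (∃ k, 0 < k ∧ S i j ≤ mpow B k i j) ∧ ∀ k, 0 < k → k ≤ q → mpow B k i j ≤ S i j

theorem isPowerSum_one (B : Matrix (Fin n) (Fin n) ℝ≥0) : IsPowerSum B 1 B := by
  refine fun i j => ⟨⟨1, one_pos, by simp⟩, fun k h1 h2 => ?_⟩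
  obtain rfl : k = 1 := by omega
  simp

theorem IsPowerSum.double {B S : Matrix (Fin n) (Fin n) ℝ≥0} {q : ℕ} (hq : 0 < q)
    (h : IsPowerSum B q S) : IsPowerSum B (q + q) fun i j => S i j ⊔ mmul S S i j := by
  intro i j
  constructor
  · rcases le_total (S i j) (mmul S S i j) with hle | hle
    · obtain ⟨u, hu⟩ := exists_mmul_eq S S i j
      obtain ⟨⟨a, ha, hSa⟩, -⟩ := h i u
      obtain ⟨⟨b, hb, hSb⟩, -⟩ := h u j
      refine ⟨a + b, by omega, sup_le (hle.trans ?_) ?_⟩ <;>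
        exact hu.le.trans ((mul_le_mul' hSa hSb).trans (mpow_mul_le _ _ _ _ _ _))
    · obtain ⟨k, hk, hS⟩ := (h i j).1
      exact ⟨k, hk, sup_le hS (hle.trans hS)⟩
  · intro k h0 hk
    rcases le_or_gt k q with hkq | hkq
    · exact ((h i j).2 k h0 hkq).trans le_sup_left
    · obtain ⟨u, hu⟩ := exists_mpow_add_eq B q (k - q) i j
      rw [Nat.add_sub_cancel' hkq.le] at hu
      rw [hu]
      exact (mul_le_mul' ((h i u).2 q hq le_rfl) ((h u j).2 (k - q) (by omega) (by omega))).trans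
        ((le_mmul S S i u j).trans le_sup_right)

/-- Critical edges are found with the help of the sum of the first `n` powers. -/
theorem IsPowerSum.unitEdge_iff {B S : Matrix (Fin n) (Fin n) ℝ≥0} {q : ℕ} (hB : ClosedLeOne B)
    (hq : n ≤ q) (h : IsPowerSum B q S) (i j : Fin n) : UnitEdge B i j ↔ 1 ≤ B i j * S j i := by
  constructor
  · intro he
    obtain ⟨r, hr, h1⟩ := he.exists_short hB
    refine h1.trans ?_
    gcongr
    rcases Nat.eq_zero_or_pos r with rfl | hr0
    · -- the closed walk is a loop, and the entry `1` of the identity is dominated by the loop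
      have hij : j = i := by
        by_contra hij
        rw [mpow_zero, Matrix.one_apply_ne hij, mul_zero] at h1
        exact absurd h1 (by simp)
      subst hij
      rw [mpow_zero, Matrix.one_apply_eq] at h1 ⊢
      rw [mul_one] at h1
      refine h1.trans ?_
      have := (h j j).2 1 one_pos (by omega)
      rwa [mpow_one] at this
    · exact (h j i).2 r hr0 (by omega)
  · intro h1
    obtain ⟨k, -, hk⟩ := (h j i).1
    exact ⟨k, h1.trans (by gcongr)⟩

/-- Double the exponent `q` in register `7`: the arrays `7` and `8`, which hold a sum of the powers
of a matrix `B` up to `B ^ q` and the power `B ^ q`, are brought up to date. -/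
def doubleProg : Prog :=
  .seq (mulMat 7 7 9 (.max (.get 7 (reg 3) (reg 4)) (rreg 3))) <| .seq (copyMat 9 7) <|
    .seq (mulMat 8 8 9 (rreg 3)) <| .seq (copyMat 9 8) <| setReg 7 (.add (reg 7) (reg 7))

@[simp] theorem intWrites_doubleProg : doubleProg.intWrites =
    [3, 4, 5, 5, 4, 3, 3, 4, 4, 3, 3, 4, 5, 5, 4, 3, 3, 4, 4, 3, 7] := rfl

/-- The memory holds the power `B ^ q` and the sum of the first `q` powers, for the `q > 0` in
register `7`. -/
structure HasPowers (B : Matrix (Fin n) (Fin n) ℝ≥0) (q : ℕ) (s : Store) : Prop where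
  pos : 0 < q
  exponent : s.int 7 0 0 = q
  power : s.HasMat 8 (mpow B q)
  powerSum : ∃ S, IsPowerSum B q S ∧ s.HasMat 7 S

theorem doubleProg_spec (hn : 0 < n) (h0 : s.int 0 0 0 = n) {B : Matrix (Fin n) (Fin n) ℝ≥0}
    {q : ℕ} (h : HasPowers B q s) :
    HaltsWithin doubleProg s (430 * n ^ 3) (HasPowers B (q + q)) := by
  obtain ⟨hq, hexp, hpow, S, hS, hsum⟩ := h
  refine HaltsWithin.mono (.andThen (mulMat_spec (P := fun i j => S i j ⊔ mmul S S i j) (by decide)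
    (by decide) (by decide) (by decide) (by decide) hn h0 hsum hsum ?e1) fun t hf ht =>
    .andThen (copyMat_spec (by decide) hn (by rw [hf.int 0 (by simp), h0]) ht) fun u hu hu7 =>
    .andThen (mulMat_spec (P := mpow B (q + q)) (by decide) (by decide) (by decide) (by decide)
      (by decide) hn (by rw [hu.int 0 (by simp), hf.int 0 (by simp), h0])
      (hpow.congr (by rw [hu.real 8 (by simp), hf.real 8 (by simp)]))
      (hpow.congr (by rw [hu.real 8 (by simp), hf.real 8 (by simp)])) ?e2) fun v hv hv9 =>
    .andThen (copyMat_spec (by decide) hn (by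
      rw [hv.int 0 (by simp), hu.int 0 (by simp), hf.int 0 (by simp), h0]) hv9) fun w hw hw8 =>
    .setI ⟨by omega, ?x, hw8, _, hS.double hq, ?s⟩) ?c fun t ht => ht
  case e1 =>
    intro t i j h7 hi hj hacc
    simp only [RExp.eval, IExp.eval, hi, hj, hacc, h7 i j]
  case e2 =>
    intro t i j h8 hi hj hacc
    simp only [RExp.eval, IExp.eval, hacc, mpow_add]
  case x =>
    simp only [IExp.eval, setInt_self]
    rw [hw.int 7 (by simp), hv.int 7 (by simp), hu.int 7 (by simp), hf.int 7 (by simp), hexp]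
  case s =>
    refine hu7.congr ?_
    change w.real 7 = _
    rw [hw.real 7 (by simp), hv.real 7 (by simp)]
  case c =>
    simp only [RExp.cost, IExp.cost]
    have h2 : n ^ 2 ≤ n ^ 3 := Nat.pow_le_pow_right hn (by decide)
    have h3 : 0 < n ^ 3 := by positivity
    omega

/-- Raise the matrix in array `6` to a power with exponent at least `n ^ 2`. The register `6` runs
through `n, n / 2, n / 4, …`, and each round multiplies the exponent by `4`. -/
def powerProg : Prog :=
  .seq (copyMat 6 7) <| .seq (copyMat 6 8) <| .seq (setReg 7 (.const 1)) <|
    .seq (setReg 6 (reg 0)) <| .while (.not (.ile (reg 6) (.const 0)))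
      (.seq (setReg 6 (.div (reg 6) (.const 2))) (.seq doubleProg doubleProg))

@[simp] theorem intWrites_powerProg : powerProg.intWrites =
    [3, 4, 4, 3, 3, 4, 4, 3, 7, 6, 6, 3, 4, 5, 5, 4, 3, 3, 4, 4, 3, 3, 4, 5, 5, 4, 3, 3, 4, 4, 3, 7,
      3, 4, 5, 5, 4, 3, 3, 4, 4, 3, 3, 4, 5, 5, 4, 3, 3, 4, 4, 3, 7] := rfl

@[simp] theorem realWrites_powerProg : powerProg.realWrites =
    [7, 8, 3, 3, 9, 7, 3, 3, 9, 8, 3, 3, 9, 7, 3, 3, 9, 8] := rfl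

theorem le_four_pow (n : ℕ) : n * n ≤ 4 ^ (Nat.log 2 n + 1) := by
  have h : n ≤ 2 ^ (Nat.log 2 n + 1) := (Nat.lt_pow_succ_log_self (by decide) n).le
  calc n * n ≤ 2 ^ (Nat.log 2 n + 1) * 2 ^ (Nat.log 2 n + 1) := Nat.mul_le_mul h h
    _ = 4 ^ (Nat.log 2 n + 1) := by rw [← mul_pow]; rfl

theorem powerProg_spec (hn : 0 < n) (h0 : s.int 0 0 0 = n) {B : Matrix (Fin n) (Fin n) ℝ≥0}
    (hB : s.HasMat 6 B) :
    HaltsWithin powerProg s (1100 * (n ^ 3 * (Nat.log 2 n + 1)))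
      fun t => ∃ q, n * n ≤ q ∧ HasPowers B q t := by
  have h3 : 0 < n ^ 3 := by positivity
  have h2 : n ^ 2 ≤ n ^ 3 := Nat.pow_le_pow_right hn (by decide)
  refine HaltsWithin.mono (.andThen (copyMat_spec (by decide) hn h0 hB) fun t hf ht =>
    .andThen (copyMat_spec (by decide) hn (by rw [hf.int 0 (by simp), h0])
      (hB.congr (hf.real 6 (by simp)))) fun u hu hu8 =>
    .seq (.setI (.seq (.setI (HaltsWithin.while (m := Nat.log 2 n + 1) (c := 900 * n ^ 3)
      (I := fun j t => t.int 6 0 0 = n / 2 ^ j ∧ HasPowers B (4 ^ j) t) ?init ?step ?halt))))) ?c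
      fun t ht => ⟨_, le_four_pow n, ht.2⟩
  case init =>
    refine ⟨?_, by simp, ?_, ?_, B, ?_, ?_⟩
    · simp only [IExp.eval, setInt_self, pow_zero, Nat.div_one]
      rw [setInt_of_ne _ (by decide), hu.int 0 (by simp), hf.int 0 (by simp), h0]
    · simp only [IExp.eval]
      rw [setInt_of_ne _ (by decide), setInt_self, pow_zero]
    · rw [pow_zero, mpow_one]
      exact hu8
    · exact isPowerSum_one B
    · refine ht.congr ?_
      change u.real 7 = _
      rw [hu.real 7 (by simp)]
  case step =>
    rintro j hj v hv ⟨h6, hP⟩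
    constructor
    · simp only [Test.Holds, IExp.eval, h6]
      have : 2 ^ j ≤ n := Nat.pow_le_of_le_log (by omega) (by omega)
      have := Nat.div_pos this (by positivity)
      omega
    · have hv0 : v.int 0 0 0 = n := by
        rw [hv.int 0 (by simp), setInt_of_ne _ (by decide), setInt_of_ne _ (by decide),
          hu.int 0 (by simp), hf.int 0 (by simp), h0]
      refine HaltsWithin.mono (.seq (.setI (.andThen (doubleProg_spec (B := B) (q := 4 ^ j) hn ?_
        ?_) fun w hw hPw => .mono (.frame (doubleProg_spec hn ?_ hPw)) le_rfl fun x hx => ?_))) ?_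
        fun t ht => ht
      · rw [setInt_of_ne _ (by decide), hv0]
      · refine ⟨hP.pos, ?_, hP.power, hP.powerSum⟩
        rw [setInt_of_ne _ (by decide), hP.exponent]
      · rw [hw.int 0 (by simp), setInt_of_ne _ (by decide), hv0]
      · constructor
        · rw [hx.2.int 6 (by simp), hw.int 6 (by simp)]
          simp only [IExp.eval, setInt_self, h6]
          rw [Nat.div_div_eq_div_mul, pow_succ]
        · have e : 4 ^ (j + 1) = 4 ^ j + 4 ^ j + (4 ^ j + 4 ^ j) := by ring
          rw [e]
          exact hx.1
      · simp only [IExp.cost]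
        omega
  case halt =>
    rintro v - ⟨h6, -⟩
    simp only [Test.Holds, IExp.eval, h6, not_not]
    rw [Nat.div_eq_of_lt (Nat.lt_pow_succ_log_self (by decide) n)]
  case c =>
    simp only [IExp.cost, Test.cost]
    set l := Nat.log 2 n + 1 with hl
    have h4 : n ^ 3 ≤ n ^ 3 * l := Nat.le_mul_of_pos_right _ (Nat.succ_pos _)
    have h5 : l ≤ n ^ 3 * l := Nat.le_mul_of_pos_left _ h3
    have h6 : l * (1 + 1 + 1 + 1 + 1 + 1 + 1 + 900 * n ^ 3) = 7 * l + 900 * (n ^ 3 * l) := by ring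
    omega

/-! ### Critical successors -/

/-- Find a critical successor of each critical node: cell `(i, 0)` of the integer array `8` becomes
`j + 1` for some critical edge `(i, j)`, or `0` if there is none. -/
def succProg : Prog :=
  forLoop 0 3 (.seq (.setI 8 (reg 3) (.const 0) (.const 0))
    (forLoop 0 4 (.ite (.rle .one (.mul (.get 6 (reg 3) (reg 4)) (.get 7 (reg 4) (reg 3))))
      (.setI 8 (reg 3) (.const 0) (.add (reg 4) (.const 1))) .skip)))

@[simp] theorem intWrites_succProg : succProg.intWrites = [3, 8, 4, 8, 4, 3] := rfl

@[simp] theorem realWrites_succProg : succProg.realWrites = [] := rfl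

/-- The entry for the node `i` in the list of critical successors, encoded as in `succProg`. -/
def SuccEntry (B : Matrix (Fin n) (Fin n) ℝ≥0) (i : Fin n) (e : ℕ) : Prop :=
  (e = 0 ∧ ¬ UnitNode B i) ∨ ∃ j : Fin n, e = j + 1 ∧ UnitEdge B i j

/-- One pass over the matrix: an edge `(i, j)` is critical iff `1 ≤ B i j * S j i`. -/
theorem succProg_spec (hn : 0 < n) (h0 : s.int 0 0 0 = n) {B S : Matrix (Fin n) (Fin n) ℝ≥0}
    (hB : s.HasMat 6 B) (hS : s.HasMat 7 S) (hBS : ∀ i j, UnitEdge B i j ↔ 1 ≤ B i j * S j i) :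
    HaltsWithin succProg s (120 * n ^ 2) fun t => ∀ i : Fin n, SuccEntry B i (t.int 8 i 0) := by
  refine HaltsWithin.mono (P := fun t => ∀ i : Fin n, (i : ℕ) < n → SuccEntry B i (t.int 8 i 0))
    (HaltsWithin.forLoop (c := 60 * n + 20) (I := fun m t => ∀ i : Fin n, (i : ℕ) < m →
      SuccEntry B i (t.int 8 i 0)) h0 (by decide) (by simp) (by simp)
      (fun j t x h i hi => by rw [setInt_of_ne _ (by decide)]; exact h i hi) (by simp) ?step) ?c
    fun t ht i => ht i i.2
  case step =>
    intro i hi t hf h3 hI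
    have ht0 : t.int 0 0 0 = n := by rw [hf.int 0 (by simp), h0]
    refine HaltsWithin.mono (.seq (.setI (HaltsWithin.forLoop (c := 31) (N := n)
      (I := fun m u => ((u.int 8 i 0 = 0 ∧ ∀ j : Fin n, (j : ℕ) < m → ¬ UnitEdge B ⟨i, hi⟩ j) ∨
        ∃ j : Fin n, u.int 8 i 0 = j + 1 ∧ UnitEdge B ⟨i, hi⟩ j) ∧
        ∀ i' ≠ i, u.int 8 i' = t.int 8 i') ?h0 (by decide) (by simp) (by simp) ?hI ?init
        ?step))) ?ci ?post
    case h0 => rw [setInt_of_ne _ (by decide), ht0]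
    case hI =>
      intro j u x h
      rwa [setInt_of_ne _ (by decide)]
    case init =>
      simp only [IExp.eval, h3]
      refine ⟨Or.inl ⟨by simp, by simp⟩, fun i' hi' => ?_⟩
      funext k
      simp [Store.setInt, hi']
    case step =>
      rintro j hj u hu h4 ⟨hI1, hI2⟩
      have hu3 : u.int 3 0 0 = i := by
        rw [hu.int 3 (by simp), setInt_of_ne _ (by decide), h3]
      have hu6 : u.real 6 i j = B ⟨i, hi⟩ ⟨j, hj⟩ := by
        rw [hu.real 6 (by simp)]
        change t.real 6 i j = _
        rw [hf.real 6 (by simp)]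
        exact hB ⟨i, hi⟩ ⟨j, hj⟩
      have hu7 : u.real 7 j i = S ⟨j, hj⟩ ⟨i, hi⟩ := by
        rw [hu.real 7 (by simp)]
        change t.real 7 j i = _
        rw [hf.real 7 (by simp)]
        exact hS ⟨j, hj⟩ ⟨i, hi⟩
      have hiff : (Test.rle .one (.mul (.get 6 (reg 3) (reg 4)) (.get 7 (reg 4) (reg 3)))).Holds u ↔
          UnitEdge B ⟨i, hi⟩ ⟨j, hj⟩ := by
        rw [hBS, ← hu6, ← hu7]
        simp only [Test.Holds, RExp.eval, IExp.eval, hu3, h4]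
      refine HaltsWithin.mono (HaltsWithin.ite (N := 10) (fun hb => HaltsWithin.setI ?_)
        (fun hb => HaltsWithin.mono (HaltsWithin.skip (P := fun v => v = u) rfl) (by decide) ?_))
        (by simp [Test.cost, RExp.cost, IExp.cost]) fun t ht => ht
      · simp only [IExp.eval, hu3, h4]
        refine ⟨Or.inr ⟨⟨j, hj⟩, by simp, hiff.1 hb⟩, fun i' hi' => ?_⟩
        rw [← hI2 i' hi']
        funext k
        simp [Store.setInt, hi']
      · rintro v rfl
        refine ⟨?_, hI2⟩
        rcases hI1 with ⟨h1, h2⟩ | h1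
        · refine Or.inl ⟨h1, fun k hk => ?_⟩
          rcases Nat.lt_succ_iff_lt_or_eq.1 hk with hk | hk
          · exact h2 k hk
          · have : k = ⟨j, hj⟩ := Fin.ext hk
            rw [this]
            exact fun h => hb (hiff.2 h)
        · exact Or.inr h1
    case ci => simp only [IExp.cost]; omega
    case post =>
      rintro u ⟨h1, h2⟩ k hk
      rcases Nat.lt_succ_iff_lt_or_eq.1 hk with hk | hk
      · rw [h2 k hk.ne]
        exact hI k hk
      · have : k = ⟨i, hi⟩ := Fin.ext hk
        subst this
        rcases h1 with ⟨h1, h2⟩ | h1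
        · exact Or.inl ⟨h1, fun ⟨j, hj⟩ => h2 j j.2 hj⟩
        · exact Or.inr h1
  case c =>
    have h1 : n ≤ n ^ 2 := Nat.le_self_pow (by decide) n
    have h2 : 0 < n ^ 2 := by positivity
    calc _ = 60 * n ^ 2 + 37 * n + 13 := by ring
      _ ≤ _ := by omega

/-- The common first part of the algorithms. -/
def prepProg : Prog := .seq normProg (.seq powerProg succProg)

/-- The result of `prepProg`: the normalized matrix `B` in array `6`, a power of it with a large
exponent, and critical successors; the integer input and the vector are kept. -/
structure Prepared (B : Matrix (Fin n) (Fin n) ℝ≥0) (s t : Store) : Prop where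
  dim : t.int 0 0 0 = n
  input : t.int 1 = s.int 1
  vector : t.real 1 = s.real 1
  matrix : t.HasMat 6 B
  power : ∃ q, n * n ≤ q ∧ t.int 7 0 0 = q ∧ t.HasMat 8 (mpow B q)
  succ : ∀ i : Fin n, SuccEntry B i (t.int 8 i 0)

theorem prepProg_spec (hn : 0 < n) (h0 : s.int 0 0 0 = n)
    {A : Matrix (Fin n) (Fin n) ℝ≥0} (hA : s.HasMat 0 A) (hirr : Irred A) (hA0 : mcgm A ≠ 0) :
    HaltsWithin prepProg s (1700 * (n ^ 3 * (Nat.log 2 n + 1))) (Prepared (normalized A) s) := by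
  refine HaltsWithin.mono (.andThen (normProg_spec hn h0 hA hirr hA0) fun t hf ht =>
    .andThen (powerProg_spec hn (by rw [hf.int 0 (by simp), h0]) ht) fun u hu hP =>
    (HaltsWithin.frame (P := fun t => ∀ i : Fin n, SuccEntry (normalized A) i (t.int 8 i 0))
      (N := 120 * n ^ 2) ?succ).mono le_rfl ?post) ?c fun t ht => ht
  case succ =>
    obtain ⟨q, hq, hP⟩ := hP
    obtain ⟨S, hS, hS7⟩ := hP.powerSum
    exact succProg_spec hn (by rw [hu.int 0 (by simp), hf.int 0 (by simp), h0])
      (ht.congr (hu.real 6 (by simp))) hS7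
      (hS.unitEdge_iff (closedLeOne_normalized A) ((Nat.le_mul_self n).trans hq))
  case post =>
    rintro v ⟨hsucc, hv⟩
    obtain ⟨q, hq, hP⟩ := hP
    refine ⟨?_, ?_, ?_, ?_, ⟨q, hq, ?_, ?_⟩, hsucc⟩
    · rw [hv.int 0 (by simp), hu.int 0 (by simp), hf.int 0 (by simp), h0]
    · rw [hv.int 1 (by simp), hu.int 1 (by simp), hf.int 1 (by simp)]
    · rw [hv.real 1 (by simp), hu.real 1 (by simp), hf.real 1 (by simp)]
    · exact ht.congr (by rw [hv.real 6 (by simp), hu.real 6 (by simp)])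
    · rw [hv.int 7 (by simp), hP.exponent]
    · exact hP.power.congr (hv.real 8 (by simp))
  case c =>
    have h2 : n ^ 2 ≤ n ^ 3 := Nat.pow_le_pow_right hn (by decide)
    have h4 : n ^ 3 ≤ n ^ 3 * (Nat.log 2 n + 1) := Nat.le_mul_of_pos_right _ (Nat.succ_pos _)
    omega

end CommonPart

/-! ### The ultimate period of an orbit -/

section PeriodAlgorithm

variable {n : ℕ} {s : Store}

theorem orbit_shift (B : Matrix (Fin n) (Fin n) ℝ≥0) (x : Fin n → ℝ≥0) (q r : ℕ) :
    orbit B x (q + (r + 1)) = mvec B (orbit B x (q + r)) := by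
  rw [← add_assoc, orbit_succ]

/-- Tabulate `2 * n + 1` consecutive terms of the orbit of the vector in array `1`, starting with
the exponent of the power in array `8`, in the rows of array `10`. -/
def orbitProg : Prog :=
  .seq (rowLoop 0 4 10 (.const 0)
    (maxLoop 0 5 3 .skip (.mul (.get 8 (reg 4) (reg 5)) (.get 1 (reg 5) (.const 0)))) (rreg 3)) <|
    .seq (setReg 9 (.add (reg 0) (reg 0))) (orbitLoop 9 6 10)

@[simp] theorem intWrites_orbitProg : orbitProg.intWrites =
    [4, 5, 5, 4, 9, 3, 4, 5, 5, 4, 3] := rfl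

theorem orbitProg_spec (hn : 0 < n) (h0 : s.int 0 0 0 = n) {B : Matrix (Fin n) (Fin n) ℝ≥0}
    {x : Fin n → ℝ≥0} {q : ℕ} (hB : s.HasMat 6 B) (hq : s.HasMat 8 (mpow B q))
    (hx : ∀ i : Fin n, s.real 1 i 0 = x i) :
    HaltsWithin orbitProg s (400 * n ^ 3)
      fun t => ∀ r ≤ n + n, ∀ i : Fin n, t.real 10 r i = orbit B x (q + r) i := by
  refine HaltsWithin.mono (.andThen (HaltsWithin.rowLoop (c := n * 38 + 17) (r := 0)
    (f := orbit B x q) h0 (by decide) (by simp) (by simp) (by simp) ?row) fun t hf ht =>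
    .seq (.setI (orbitLoop_spec (N := n + n) (y := fun r => orbit B x (q + r)) (by decide)
      (by decide) (by decide) (by decide) (by decide) (by decide) hn ?h0 ?hN ?hM
      (orbit_shift B x q) ?hY))) ?c fun t ht => ht
  case row =>
    intro i t hf _ hi
    have ht0 : t.int 0 0 0 = n := by rw [hf.int 0 (by simp), h0]
    refine (HaltsWithin.frame (HaltsWithin.maxLoop (n := n) (c := 1)
      (f := fun k => mpow B q i k * x k) ht0 (by decide) (by simp) (by simp) (by simp) ?_)).mono
      (by simp [RExp.cost, IExp.cost]) ?_
    · intro k u hu hk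
      refine .skip ?_
      simp only [RExp.eval, IExp.eval, hk]
      rw [hu.real 8 (by simp), hu.real 1 (by simp), hu.int 4 (by simp), hi, hf.real 8 (by simp),
        hf.real 1 (by simp), hq i k, hx k]
    · rintro u ⟨hu, -⟩
      refine ⟨rfl, ?_⟩
      simp only [RExp.eval, IExp.eval]
      rw [hu]
      rfl
  case h0 => rw [setInt_of_ne _ (by decide), hf.int 0 (by simp), h0]
  case hN =>
    simp only [IExp.eval, setInt_self]
    rw [hf.int 0 (by simp), h0]
  case hM => exact hB.congr (by change t.real 6 = _; rw [hf.real 6 (by simp)])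
  case hY => exact fun i => ht.1 i
  case c =>
    simp only [RExp.cost, IExp.cost]
    have h1 : n ≤ n ^ 3 := Nat.le_self_pow (by decide) n
    have h2 : n ^ 2 ≤ n ^ 3 := Nat.pow_le_pow_right hn (by decide)
    have h3 : 0 < n ^ 3 := by positivity
    calc _ = 232 * n ^ 3 + 38 * n ^ 2 + 42 * n + 36 := by ring
      _ ≤ _ := by omega

/-- Equality of reals as a test. -/
abbrev Test.req (e f : RExp) : Test := .and (.rle e f) (.rle f e)

/-- For the node in register `3`, store in register `10` the least `p > 0` for which the first `n`
terms of the orbit in array `10` are repeated after `p` steps. -/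
def periodProg : Prog :=
  .seq (setReg 10 (.const 0)) <| forLoop 0 4 <| .seq (setReg 11 (.const 1)) <|
    .seq (forLoop 0 5 (.ite (.req (.get 10 (.add (reg 5) (.add (reg 4) (.const 1))) (reg 3))
        (.get 10 (reg 5) (reg 3))) .skip (setReg 11 (.const 0)))) <|
      .ite (.and (.ile (.const 1) (reg 11)) (.ile (reg 10) (.const 0)))
        (setReg 10 (.add (reg 4) (.const 1))) .skip

@[simp] theorem intWrites_periodProg : periodProg.intWrites = [10, 4, 11, 5, 11, 5, 10, 4] := rfl

@[simp] theorem realWrites_periodProg : periodProg.realWrites = [] := rfl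

/-- The terms with the indices `0, …, n - 1` of the sequence `f` are repeated after `p` steps. -/
def Window (n : ℕ) (f : ℕ → ℝ≥0) (p : ℕ) : Prop := ∀ e < n, f (e + p) = f e

theorem periodProg_spec (hn : 0 < n) (h0 : s.int 0 0 0 = n) {i : ℕ} (h3 : s.int 3 0 0 = i)
    {l : ℕ} (hl0 : 0 < l) (hl : l ≤ n) (hlw : Window n (fun r => s.real 10 r i) l) :
    HaltsWithin periodProg s (170 * n ^ 2) fun t => ∃ p, t.int 10 0 0 = p ∧ 0 < p ∧ p ≤ n ∧
      Window n (fun r => s.real 10 r i) p ∧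
      ∀ p', 0 < p' → Window n (fun r => s.real 10 r i) p' → p ≤ p' := by
  set W := Window n (fun r => s.real 10 r i) with hW
  refine HaltsWithin.mono (.seq (.setI (HaltsWithin.forLoop (N := n) (c := 77 * n + 50)
    (I := fun m t => (t.int 10 0 0 = 0 ∧ ∀ p, 0 < p → p ≤ m → ¬ W p) ∨
      ∃ p, t.int 10 0 0 = p ∧ 0 < p ∧ p ≤ m ∧ W p ∧ ∀ p', 0 < p' → W p' → p ≤ p')
    (by rw [setInt_of_ne _ (by decide), h0]) (by decide) (by simp) (by simp) ?hI ?init ?step)))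
    ?c ?post
  case hI =>
    intro j t x h
    rwa [setInt_of_ne _ (by decide)]
  case init => exact Or.inl ⟨setInt_self _ _ _ _ _, fun p h1 h2 => by omega⟩
  case step =>
    intro m hm t hf h4 hI
    have ht0 : t.int 0 0 0 = n := by rw [hf.int 0 (by simp), setInt_of_ne _ (by decide), h0]
    have ht3 : t.int 3 0 0 = i := by rw [hf.int 3 (by simp), setInt_of_ne _ (by decide), h3]
    have ht10 : t.real 10 = s.real 10 := hf.real 10 (by simp)
    refine HaltsWithin.mono (.seq (.setI (.andThen (HaltsWithin.forLoop (N := n) (c := 60)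
      (I := fun m' u => (u.int 11 0 0 = 1 ∧
          ∀ e < m', s.real 10 (e + (m + 1)) i = s.real 10 e i) ∨
        (u.int 11 0 0 = 0 ∧ ¬ W (m + 1)))
      (by rw [setInt_of_ne _ (by decide), ht0]) (by decide) (by simp) (by simp) ?hI2 ?init2 ?step2)
      fun u hu hIu => .mono (.ite (N := 20) (fun hb => .mono (.setI ?yes) (by decide) fun _ h => h)
        (fun hb => .mono (.skip (P := fun v => v = u) rfl) (by decide) ?no)) le_rfl
        fun _ h => h))) ?c2 fun _ h => h
    case hI2 =>
      intro j u x h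
      rwa [setInt_of_ne _ (by decide)]
    case init2 => exact Or.inl ⟨setInt_self _ _ _ _ _, by simp⟩
    case step2 =>
      intro e he u hu h5 hI2
      have hu3 : u.int 3 0 0 = i := by rw [hu.int 3 (by simp), setInt_of_ne _ (by decide), ht3]
      have hu4 : u.int 4 0 0 = m := by rw [hu.int 4 (by simp), setInt_of_ne _ (by decide), h4]
      have hu10 : u.real 10 = s.real 10 := by
        rw [hu.real 10 (by simp)]
        exact ht10
      have hiff : (Test.req (.get 10 (.add (reg 5) (.add (reg 4) (.const 1))) (reg 3))
          (.get 10 (reg 5) (reg 3))).Holds u ↔ s.real 10 (e + (m + 1)) i = s.real 10 e i := by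
        simp only [Test.Holds, RExp.eval, IExp.eval, h5, hu4, hu3, hu10]
        exact le_antisymm_iff.symm
      refine HaltsWithin.mono (HaltsWithin.ite (N := 4)
        (fun hb => HaltsWithin.mono (HaltsWithin.skip (P := fun v => v = u) rfl) (by decide) ?_)
        (fun hb => HaltsWithin.setI ?_))
        (by simp [Test.cost, RExp.cost, IExp.cost]) fun t ht => ht
      · rintro v rfl
        rcases hI2 with ⟨h1, h2⟩ | h1
        · refine Or.inl ⟨h1, fun e' he' => ?_⟩
          rcases Nat.lt_succ_iff_lt_or_eq.1 he' with he' | rfl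
          · exact h2 e' he'
          · exact hiff.1 hb
        · exact Or.inr h1
      · exact Or.inr ⟨setInt_self _ _ _ _ _, fun hw => hb (hiff.2 (hw e he))⟩
    case yes =>
      obtain ⟨hb1, hb2⟩ := hb
      simp only [Test.Holds, IExp.eval] at hb1 hb2
      rw [hu.int 10 (by simp), setInt_of_ne _ (by decide)] at hb2
      have hu4 : u.int 4 0 0 = m := by rw [hu.int 4 (by simp), setInt_of_ne _ (by decide), h4]
      have hWm : W (m + 1) := by
        rcases hIu with ⟨-, h⟩ | ⟨h, -⟩
        · exact h
        · omega
      have hno : ∀ p, 0 < p → p ≤ m → ¬ W p := by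
        rcases hI with ⟨-, h⟩ | ⟨p, h, hp, -⟩
        · exact h
        · omega
      refine Or.inr ⟨m + 1, ?_, Nat.succ_pos m, le_rfl, hWm, fun p' hp' hw => ?_⟩
      · simp only [IExp.eval, setInt_self, hu4]
      · by_contra! hlt
        exact hno p' hp' (by omega) hw
    case no =>
      rintro v rfl
      have hv10 : v.int 10 0 0 = t.int 10 0 0 := by
        rw [hu.int 10 (by simp), setInt_of_ne _ (by decide)]
      rcases hI with ⟨h, hno⟩ | ⟨p, h, hp, hpm, hrest⟩
      · refine Or.inl ⟨by rw [hv10, h], fun p hp hpm => ?_⟩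
        rcases Nat.lt_or_ge m p with hmp | hmp
        · obtain rfl : p = m + 1 := by omega
          rcases hIu with ⟨h1, -⟩ | ⟨-, h1⟩
          · refine absurd ⟨?_, ?_⟩ hb
            · simp only [Test.Holds, IExp.eval, h1, le_refl]
            · simp only [Test.Holds, IExp.eval, hv10, h, le_refl]
          · exact h1
        · exact hno p hp hmp
      · exact Or.inr ⟨p, by rw [hv10, h], hp, by omega, hrest⟩
    case c2 =>
      simp only [Test.cost, IExp.cost]
      omega
  case c =>
    simp only [IExp.cost]
    have h1 : n ≤ n ^ 2 := Nat.le_self_pow (by decide) n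
    have h2 : 0 < n ^ 2 := by positivity
    calc _ = 77 * n ^ 2 + 67 * n + 17 := by ring
      _ ≤ _ := by omega
  case post =>
    rintro t (⟨-, h⟩ | h)
    · exact absurd hlw (h l hl0 hl)
    · exact h

/-- Replace the number `a` in register `13` by its least common multiple with the number `p ≤ n` in
register `10`. There is no product of integers: `a` is added up to the first multiple of `p`, which
takes less than `p` additions. -/
def lcmProg : Prog :=
  .seq (setReg 14 (reg 13)) <| .seq (forLoop 0 5
    (.ite (.ile (.const 1) (.mod (reg 14) (reg 10))) (setReg 14 (.add (reg 14) (reg 13))) .skip)) <|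
    setReg 13 (reg 14)

@[simp] theorem intWrites_lcmProg : lcmProg.intWrites = [14, 5, 14, 5, 13] := rfl

@[simp] theorem realWrites_lcmProg : lcmProg.realWrites = [] := rfl

theorem eq_lcm_of_first {a p t : ℕ} (hp : 0 < p) (hdvd : p ∣ a * (t + 1))
    (hfirst : ∀ t', 0 < t' → t' ≤ t → ¬ p ∣ a * t') : a * (t + 1) = Nat.lcm a p := by
  rcases Nat.eq_zero_or_pos a with rfl | ha
  · simp
  refine Nat.dvd_antisymm ?_ (Nat.lcm_dvd (dvd_mul_right _ _) hdvd)
  obtain ⟨u, hu⟩ := Nat.dvd_lcm_left a p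
  have hlpos : 0 < Nat.lcm a p := Nat.lcm_pos ha hp
  have hu0 : 0 < u := Nat.pos_of_ne_zero fun h => by rw [hu, h] at hlpos; simp at hlpos
  have hul : t < u := by
    by_contra! h
    exact hfirst u hu0 h (hu ▸ Nat.dvd_lcm_right a p)
  have hle : Nat.lcm a p ≤ a * (t + 1) :=
    Nat.le_of_dvd (by positivity) (Nat.lcm_dvd (dvd_mul_right _ _) hdvd)
  rw [hu] at hle ⊢
  have : u ≤ t + 1 := Nat.le_of_mul_le_mul_left hle ha
  obtain rfl : u = t + 1 := by omega
  exact dvd_rfl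

theorem lcmProg_spec (hn : 0 < n) (h0 : s.int 0 0 0 = n) {a p : ℕ} (h13 : s.int 13 0 0 = a)
    (h10 : s.int 10 0 0 = p) (hp : 0 < p) (hpn : p ≤ n) :
    HaltsWithin lcmProg s (100 * n) fun t => t.int 13 0 0 = Nat.lcm a p := by
  refine HaltsWithin.mono (.seq (.setI (.andThen (HaltsWithin.forLoop (N := n) (c := 30)
    (I := fun m t => ∃ u, t.int 14 0 0 = a * (u + 1) ∧ (u < m → p ∣ a * (u + 1)) ∧ u ≤ m ∧
      ∀ t', 0 < t' → t' ≤ u → ¬ p ∣ a * t')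
    (by rw [setInt_of_ne _ (by decide), h0]) (by decide) (by simp) (by simp) ?hI ?init ?step)
    fun t ht hI => .setI ?post))) ?c fun _ h => h
  case hI =>
    intro j t x h
    rwa [setInt_of_ne _ (by decide)]
  case init =>
    refine ⟨0, ?_, by simp, le_rfl, fun t' h1 h2 => by omega⟩
    simp only [IExp.eval, setInt_self, h13, zero_add, mul_one]
  case step =>
    rintro m hm t hf - ⟨u, h14, h1, h2, h3⟩
    have ht10 : t.int 10 0 0 = p := by rw [hf.int 10 (by simp), setInt_of_ne _ (by decide), h10]
    have ht13 : t.int 13 0 0 = a := by rw [hf.int 13 (by simp), setInt_of_ne _ (by decide), h13]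
    refine HaltsWithin.mono (HaltsWithin.ite (N := 10) (fun hb => HaltsWithin.setI ?_)
        (fun hb => HaltsWithin.mono (HaltsWithin.skip (P := fun v => v = t) rfl) (by decide) ?_))
        (by simp [Test.cost, IExp.cost]) fun t ht => ht
    · simp only [Test.Holds, IExp.eval, h14, ht10] at hb
      have hnd : ¬ p ∣ a * (u + 1) := fun h => by
        rw [Nat.mod_eq_zero_of_dvd h] at hb
        omega
      have hum : u = m := by
        by_contra hne
        exact hnd (h1 (by omega))
      refine ⟨u + 1, ?_, fun h => by omega, by omega, fun t' ht0 ht' => ?_⟩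
      · simp only [IExp.eval, setInt_self, h14, ht13]
        ring
      · rcases Nat.lt_succ_iff_lt_or_eq.1 (Nat.lt_succ_of_le ht') with h | rfl
        · exact h3 t' ht0 (by omega)
        · exact hnd
    · rintro v rfl
      simp only [Test.Holds, IExp.eval, h14, ht10] at hb
      exact ⟨u, h14, fun _ => Nat.dvd_of_mod_eq_zero (by omega), by omega, h3⟩
  case post =>
    obtain ⟨u, h14, h1, h2, h3⟩ := hI
    have hd : p ∣ a * (u + 1) := by
      by_cases hun : u < n
      · exact h1 hun
      · exact absurd (dvd_mul_left p a) (h3 p hp (by omega))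
    simp only [IExp.eval, setInt_self]
    rw [h14, eq_lcm_of_first hp hd h3]
  case c =>
    simp only [IExp.cost]
    omega

/-- Store the ultimate period of the orbit tabulated in array `10` in register `13`. -/
def alphaProg : Prog :=
  .seq (setReg 13 (.const 1)) <| forLoop 0 3 <|
    .ite (.ile (.const 1) (.get 8 (reg 3) (.const 0))) (.seq periodProg lcmProg) .skip

@[simp] theorem intWrites_alphaProg : alphaProg.intWrites =
    [13, 3, 10, 4, 11, 5, 11, 5, 10, 4, 14, 5, 14, 5, 13, 3] := rfl

theorem SuccEntry.pos_iff {B : Matrix (Fin n) (Fin n) ℝ≥0} {i : Fin n} {e : ℕ}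
    (h : SuccEntry B i e) : 1 ≤ e ↔ UnitNode B i := by
  rcases h with ⟨rfl, h⟩ | ⟨j, rfl, h⟩
  · simp [h]
  · simp only [le_add_iff_nonneg_left, zero_le, true_iff]
    exact ⟨j, h⟩

/-- A number is an eventual period of all critical coordinates iff the least common multiple of
their least periods divides it. -/
theorem alphaProg_spec (hn : 0 < n) (h0 : s.int 0 0 0 = n) {B : Matrix (Fin n) (Fin n) ℝ≥0}
    (hB : ClosedLeOne B) (hsucc : ∀ i : Fin n, SuccEntry B i (s.int 8 i 0)) {x : Fin n → ℝ≥0}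
    {q : ℕ} (hq : n * n ≤ q)
    (hY : ∀ r ≤ n + n, ∀ i : Fin n, s.real 10 r i = orbit B x (q + r) i) :
    HaltsWithin alphaProg s (320 * n ^ 3) fun t => 0 < t.int 13 0 0 ∧
      ∀ d, t.int 13 0 0 ∣ d ↔ ∀ c, UnitNode B c → EvPeriod (fun r => orbit B x r c) d := by
  refine HaltsWithin.mono (P := fun t => 0 < t.int 13 0 0 ∧ ∀ d, t.int 13 0 0 ∣ d ↔
      ∀ c : Fin n, (c : ℕ) < n → UnitNode B c → EvPeriod (fun r => orbit B x r c) d)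
    (.seq (.setI (HaltsWithin.forLoop (N := n) (c := 270 * n ^ 2 + 10)
    (I := fun m t => 0 < t.int 13 0 0 ∧ ∀ d, t.int 13 0 0 ∣ d ↔
      ∀ c : Fin n, (c : ℕ) < m → UnitNode B c → EvPeriod (fun r => orbit B x r c) d)
    (by rw [setInt_of_ne _ (by decide), h0]) (by decide) (by simp) (by simp) ?hI ?init ?step)))
    ?c fun t ht => ⟨ht.1, fun d => (ht.2 d).trans ⟨fun h c => h c c.2, fun h c _ => h c⟩⟩
  case hI =>
    intro j t x h
    rwa [setInt_of_ne _ (by decide)]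
  case init =>
    simp [IExp.eval]
  case step =>
    intro i hi t hf h3 hI
    have ht0 : t.int 0 0 0 = n := by rw [hf.int 0 (by simp), setInt_of_ne _ (by decide), h0]
    have ht8 : t.int 8 i 0 = s.int 8 i 0 := by
      rw [hf.int 8 (by simp), setInt_of_ne _ (by decide)]
    have ht10 : t.real 10 = s.real 10 := hf.real 10 (by simp)
    have hiff : (Test.ile (.const 1) (.get 8 (reg 3) (.const 0))).Holds t ↔
        UnitNode B ⟨i, hi⟩ := by
      rw [← (hsucc ⟨i, hi⟩).pos_iff]
      simp only [Test.Holds, IExp.eval, h3, ht8]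
    have hsplit : ∀ d, (∀ c : Fin n, (c : ℕ) < i + 1 → UnitNode B c →
        EvPeriod (fun r => orbit B x r c) d) ↔
        (∀ c : Fin n, (c : ℕ) < i → UnitNode B c → EvPeriod (fun r => orbit B x r c) d) ∧
        (UnitNode B ⟨i, hi⟩ → EvPeriod (fun r => orbit B x r ⟨i, hi⟩) d) := by
      intro d
      refine ⟨fun h => ⟨fun c hc => h c (by omega), h ⟨i, hi⟩ (Nat.lt_succ_self i)⟩,
        fun h c hc => ?_⟩
      rcases Nat.lt_succ_iff_lt_or_eq.1 hc with hc | hc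
      · exact h.1 c hc
      · have : c = ⟨i, hi⟩ := Fin.ext hc
        subst this
        exact h.2
    refine HaltsWithin.mono (HaltsWithin.ite (N := 270 * n ^ 2) (fun hb => ?yes)
      (fun hb => HaltsWithin.mono (HaltsWithin.skip (P := fun v => v = t) rfl) ?_ ?no))
      (by simp [Test.cost, IExp.cost]; omega) fun t ht => ht
    case yes =>
      have hc := hiff.1 hb
      obtain ⟨l, hl0, hln, hl⟩ := hc.row_period hB
      have hper : ∀ r, n * n ≤ r → orbit B x (r + l) ⟨i, hi⟩ = orbit B x r ⟨i, hi⟩ :=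
        fun r hr => orbit_congr (hl r hr)
      have hwin : ∀ p ≤ n, Window n (fun r => t.real 10 r i) p ↔
          EvPeriod (fun r => orbit B x r ⟨i, hi⟩) p := by
        intro p hp
        rw [evPeriod_iff_window hl0 hln hper hq]
        refine forall₂_congr fun e he => ?_
        simp only [ht10]
        rw [hY (e + p) (by omega) ⟨i, hi⟩, hY e (by omega) ⟨i, hi⟩]
      refine HaltsWithin.mono (.andThen (periodProg_spec hn ht0 h3 hl0 hln
        ((hwin l hln).2 (EvPeriod.of_forall hper))) fun u hu ⟨p, h10, hp0, hpn, hpw, hmin⟩ =>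
        .mono (lcmProg_spec (a := t.int 13 0 0) hn (by rw [hu.int 0 (by simp), ht0])
          (by rw [hu.int 13 (by simp)]) h10 hp0 hpn) le_rfl fun v hv => ?_) ?_ fun _ h => h
      · rw [hv]
        refine ⟨Nat.lcm_pos hI.1 hp0, fun d => ?_⟩
        rw [hsplit, ← hI.2 d, Nat.lcm_dvd_iff]
        refine and_congr_right fun _ => ⟨fun h _ => ((hwin p hpn).1 hpw).of_dvd h, fun h => ?_⟩
        refine EvPeriod.dvd_of_least ((hwin p hpn).1 hpw) hp0 (fun p' hp' hev => ?_) (h hc)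
        by_contra! hlt
        exact absurd (hmin p' hp' ((hwin p' (by omega)).2 hev)) (by omega)
      · have h1 : n ≤ n ^ 2 := Nat.le_self_pow (by decide) n
        omega
    · have h2 : 0 < n ^ 2 := by positivity
      omega
    case no =>
      rintro v rfl
      refine ⟨hI.1, fun d => ?_⟩
      rw [hsplit, ← hI.2 d]
      exact ⟨fun h => ⟨h, fun h' => absurd (hiff.2 h') hb⟩, fun h => h.1⟩
  case c =>
    simp only [IExp.cost]
    have h1 : n ≤ n ^ 3 := Nat.le_self_pow (by decide) n
    have h3 : 0 < n ^ 3 := by positivity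
    calc _ = 270 * n ^ 3 + 27 * n + 17 := by ring
      _ ≤ _ := by omega

/-- Compute the ultimate period of the orbit of the input vector in register `13`. -/
def orbitPeriodProg : Prog := .seq prepProg (.seq orbitProg alphaProg)

theorem orbitPeriodProg_spec {A : Matrix (Fin n) (Fin n) ℝ≥0} (x : Fin n → ℝ≥0) (m : ℕ)
    (hirr : Irred A) (hA : mcgm A ≠ 0) :
    HaltsWithin orbitPeriodProg (input A x m) (2450 * (n ^ 3 * (Nat.log 2 n + 1))) fun t =>
      t.int 1 0 0 = m ∧ 0 < t.int 13 0 0 ∧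
        ∀ d, t.int 13 0 0 ∣ d ↔ EvPeriod (orbit (normalized A) x) d := by
  have hn := pos_of_mcgm_ne_zero hA
  have hB := closedLeOne_normalized A
  refine HaltsWithin.mono (.andThen (prepProg_spec (A := A) hn (by simp [input])
    (fun i j => by simp [input]) hirr hA) fun t _ ⟨h0, h1, hx, hM, ⟨q, hq, _, hpow⟩, hs⟩ =>
    .andThen (orbitProg_spec (x := x) hn h0 hM hpow (fun i => ?hx)) fun u hu hY =>
    .mono (.frame (alphaProg_spec hn (by rw [hu.int 0 (by simp), h0]) hB (fun i => ?hs) hq hY))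
      le_rfl ?post) ?c fun _ h => h
  case hx => rw [hx]; simp [input]
  case hs => rw [hu.int 8 (by simp)]; exact hs i
  case post =>
    rintro v ⟨⟨hpos, hd⟩, hv⟩
    refine ⟨?_, hpos, fun d => ?_⟩
    · rw [hv.int 1 (by simp), hu.int 1 (by simp), h1]
      simp [input]
    · rw [hd, evPeriod_orbit_iff hB (irred_normalized hirr hA) (exists_unitNode_normalized hA)]
  case c =>
    have h4 : n ^ 3 ≤ n ^ 3 * (Nat.log 2 n + 1) := Nat.le_mul_of_pos_right _ (Nat.succ_pos _)
    omega

/-- The vector `x` is attracted iff `t` is a multiple of the ultimate period of its orbit. -/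
theorem attr_decidable_cubic_log :
    ∃ (p : Prog) (C : ℕ), ∀ (n : ℕ) (A : Matrix (Fin n) (Fin n) ℝ≥0) (x : Fin n → ℝ≥0) (t : ℕ),
      Irred A → mcgm A ≠ 0 →
      HaltsWithin p (input A x t) (C * (n ^ 3 * (Nat.log 2 n + 1))) fun s =>
        (x ∈ Attr (normalized A) t ∧ s.outInt = 1) ∨
          (x ∉ Attr (normalized A) t ∧ s.outInt = 0) := by
  refine ⟨.seq orbitPeriodProg (setReg 2 (.sub (.const 1) (.mod (reg 1) (reg 13)))), 2462,
    fun n A x t hirr hA => ?_⟩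
  refine HaltsWithin.mono (.andThen (orbitPeriodProg_spec x t hirr hA)
    fun u _ ⟨h1, hpos, hd⟩ => .setI ?_) ?_ fun _ h => h
  · rw [mem_attr_iff, ← hd]
    simp only [Store.outInt, IExp.eval, setInt_self, h1]
    by_cases h : u.int 13 0 0 ∣ t
    · exact Or.inl ⟨h, by rw [Nat.mod_eq_zero_of_dvd h]⟩
    · refine Or.inr ⟨h, ?_⟩
      have := Nat.pos_of_ne_zero fun h0 => h (Nat.dvd_of_mod_eq_zero h0)
      omega
  · simp only [IExp.cost]
    have hn := pos_of_mcgm_ne_zero hA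
    have : 0 < n ^ 3 * (Nat.log 2 n + 1) := by positivity
    omega

theorem ultimatePeriod_computable_cubic_log :
    ∃ (p : Prog) (C : ℕ), ∀ (n : ℕ) (A : Matrix (Fin n) (Fin n) ℝ≥0) (x : Fin n → ℝ≥0),
      Irred A → mcgm A ≠ 0 →
      HaltsWithin p (input A x 0) (C * (n ^ 3 * (Nat.log 2 n + 1))) fun s =>
        IsUltimatePeriod (normalized A) x s.outInt := by
  refine ⟨.seq orbitPeriodProg (setReg 2 (reg 13)), 2456, fun n A x hirr hA => ?_⟩
  refine HaltsWithin.mono (.andThen (orbitPeriodProg_spec x 0 hirr hA)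
    fun u _ ⟨h1, hpos, hd⟩ => .setI ?_) ?_ fun _ h => h
  · simp only [Store.outInt, IExp.eval, setInt_self]
    have hiff := mvec_eq_iff_evPeriod (closedLeOne_normalized A) (mcgm_normalized hA)
      (irred_normalized hirr hA) (exists_unitNode_normalized hA) x
    refine ⟨⟨hpos, (hiff _).2 ((hd _).1 dvd_rfl)⟩, fun a ha => ?_⟩
    exact Nat.le_of_dvd ha.1 ((hd a).2 ((hiff a).1 ha.2))
  · simp only [IExp.cost]
    have hn := pos_of_mcgm_ne_zero hA
    have : 0 < n ^ 3 * (Nat.log 2 n + 1) := by positivity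
    omega

end PeriodAlgorithm

/-! ### The periodic powers by following critical edges -/

section PowerAlgorithm

variable {n : ℕ} {s : Store}

/-- The critical successor of the node in register `v`, read off array `8`. -/
abbrev succExp (v : ℕ) : IExp := .sub (.get 8 (reg v) (.const 0)) (.const 1)

/-- Move the node in register `9` along critical edges; register `b` holds the number of steps. The
real register `12` is multiplied by the weight of the walk. -/
def walkProg (b : ℕ) : Prog :=
  forLoop b 4 (.seq (setRReg 12 (.mul (rreg 12) (.get 6 (reg 9) (succExp 9))))
    (setReg 9 (succExp 9)))

theorem walkProg_spec {b N : ℕ} (hb4 : b ≠ 4) (hb9 : b ≠ 9) (hN : s.int b 0 0 = N)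
    {B : Matrix (Fin n) (Fin n) ℝ≥0} (hB : s.HasMat 6 B) {c : ℕ → Fin n}
    (hc : ∀ l, s.int 8 (c l) 0 = c (l + 1) + 1) (h9 : s.int 9 0 0 = c 0) (h12 : s.real 12 0 0 = 1) :
    HaltsWithin (walkProg b) s (N * 60 + 13) fun t => t.int 9 0 0 = c N ∧
      t.real 12 0 0 = ∏ l ∈ Finset.range N, B (c l) (c (l + 1)) := by
  refine HaltsWithin.mono (HaltsWithin.forLoop (N := N) (c := 40)
    (I := fun m t => t.int 9 0 0 = c m ∧
      t.real 12 0 0 = ∏ l ∈ Finset.range m, B (c l) (c (l + 1))) hN hb4 (by simp [hb9]) (by simp)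
    (fun j t x h => ⟨by rw [setInt_of_ne _ (by decide)]; exact h.1, h.2⟩) ⟨h9, by simpa using h12⟩
    ?_) (by omega) fun _ h => h
  rintro m hm t hf - ⟨h1, h2⟩
  have h8 : t.int 8 (c m) 0 = c (m + 1) + 1 := by rw [hf.int 8 (by simp), hc]
  have h6 : t.real 6 = s.real 6 := hf.real 6 (by simp)
  refine HaltsWithin.mono (.seq (.setR (.setI ⟨?_, ?_⟩))) (by simp [IExp.cost, RExp.cost])
    fun _ h => h
  · simp only [IExp.eval, setInt_self]
    change t.int 8 (t.int 9 0 0) 0 - 1 = _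
    rw [h1, h8, Nat.add_sub_cancel]
  · simp only [RExp.eval, IExp.eval]
    rw [h1, h8, Nat.add_sub_cancel, h2, h6, hB, Finset.prod_range_succ]
    exact setReal_self t 12 0 0 _

/-- Walk along critical edges from the node in register `3`; register `b` holds the number of steps.
The real register `12` becomes the weight of the walk. -/
def walkFromProg (b : ℕ) : Prog :=
  .seq (setReg 9 (reg 3)) <| .seq (setRReg 12 .one) (walkProg b)

@[simp] theorem intWrites_walkFromProg (b : ℕ) : (walkFromProg b).intWrites = [9, 4, 9, 4] := rfl

@[simp] theorem realWrites_walkFromProg (b : ℕ) : (walkFromProg b).realWrites = [12, 12] := rfl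

theorem walkFromProg_spec {b N : ℕ} (hb4 : b ≠ 4) (hb9 : b ≠ 9) (hN : s.int b 0 0 = N)
    {B : Matrix (Fin n) (Fin n) ℝ≥0} (hB : s.HasMat 6 B) {c : ℕ → Fin n}
    (hc : ∀ l, s.int 8 (c l) 0 = c (l + 1) + 1) (h3 : s.int 3 0 0 = c 0) :
    HaltsWithin (walkFromProg b) s (N * 60 + 30) fun t => t.int 9 0 0 = c N ∧
      t.real 12 0 0 = ∏ l ∈ Finset.range N, B (c l) (c (l + 1)) := by
  refine HaltsWithin.mono (.seq (.setI (.seq (.setR (walkProg_spec hb4 hb9 (N := N) ?_ (B := B)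
    ?_ (c := c) ?_ ?_ ?_))))) (by simp only [IExp.cost, RExp.cost]; omega) fun _ h => h
  · exact (congrFun (congrFun (setInt_of_ne s hb9 _ _ _) 0) 0).trans hN
  · exact hB
  · intro l
    rw [← hc l]
    exact congrFun (congrFun (setInt_of_ne s (show (8 : ℕ) ≠ 9 by decide) 0 0 (s.int 3 0 0)) _) 0
  · exact (setInt_self s 9 0 0 _).trans h3
  · exact setReal_self _ _ _ _ _

/-- Store in register `11` the length of the cycle of critical edges through the node in
register `9`. -/
def cycleProg : Prog :=
  .seq (setReg 11 (.const 0)) <| .seq (setReg 10 (reg 9)) <| forLoop 0 4 <|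
    .seq (setReg 10 (succExp 10)) <|
      .ite (.and (.ile (reg 10) (reg 9)) (.ile (reg 9) (reg 10)))
        (setReg 11 (.add (reg 4) (.const 1))) .skip

@[simp] theorem intWrites_cycleProg : cycleProg.intWrites = [11, 10, 4, 10, 11, 4] := rfl

@[simp] theorem realWrites_cycleProg : cycleProg.realWrites = [] := rfl

theorem cycleProg_spec (h0 : s.int 0 0 0 = n) {c : ℕ → Fin n}
    (hc : ∀ l, s.int 8 (c l) 0 = c (l + 1) + 1) (h9 : s.int 9 0 0 = c 0)
    (hcyc : ∃ L, 0 < L ∧ L ≤ n ∧ c L = c 0) :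
    HaltsWithin cycleProg s (n * 60 + 25) fun t => ∃ L, t.int 11 0 0 = L ∧ 0 < L ∧ L ≤ n ∧
      c L = c 0 := by
  refine HaltsWithin.mono (.seq (.setI (.seq (.setI (HaltsWithin.forLoop (N := n) (c := 43)
    (I := fun m t => t.int 10 0 0 = c m ∧
      ((∀ L, 0 < L → L ≤ m → c L ≠ c 0) ∨
        ∃ L, t.int 11 0 0 = L ∧ 0 < L ∧ L ≤ m ∧ c L = c 0)) ?h0 (by decide) (by simp)
    (by simp) ?hI ?init ?step))))) ?c ?post
  case h0 => rw [setInt_of_ne _ (by decide), setInt_of_ne _ (by decide), h0]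
  case hI =>
    intro j t x h
    rwa [setInt_of_ne _ (by decide), setInt_of_ne _ (by decide)]
  case init =>
    refine ⟨?_, Or.inl fun L h1 h2 => by omega⟩
    simp only [IExp.eval, setInt_self]
    rw [setInt_of_ne _ (by decide), h9]
  case step =>
    rintro m hm t hf h4 ⟨h10, hI⟩
    have ht9 : t.int 9 0 0 = c 0 := by
      rw [hf.int 9 (by simp), setInt_of_ne _ (by decide), setInt_of_ne _ (by decide), h9]
    have ht8 : t.int 8 (c m) 0 = c (m + 1) + 1 := by
      rw [hf.int 8 (by simp), setInt_of_ne _ (by decide), setInt_of_ne _ (by decide), hc]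
    refine HaltsWithin.mono (.seq (M := 32) (.setI ?_)) (by simp [IExp.cost]) fun _ h => h
    set u := t.setInt 10 ((IExp.const 0).eval t) ((IExp.const 0).eval t)
      ((succExp 10).eval t) with hu
    have hu10 : u.int 10 0 0 = c (m + 1) := by
      simp only [hu, IExp.eval, setInt_self]
      rw [h10, ht8, Nat.add_sub_cancel]
    have hu9 : u.int 9 0 0 = c 0 := by rw [hu, setInt_of_ne _ (by decide), ht9]
    have hu4 : u.int 4 0 0 = m := by rw [hu, setInt_of_ne _ (by decide), h4]
    have hu11 : u.int 11 0 0 = t.int 11 0 0 := by rw [hu, setInt_of_ne _ (by decide)]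
    have hiff : (Test.and (.ile (reg 10) (reg 9)) (.ile (reg 9) (reg 10))).Holds u ↔
        c (m + 1) = c 0 := by
      simp only [Test.Holds, IExp.eval, hu10, hu9]
      rw [Fin.ext_iff]
      exact le_antisymm_iff.symm
    refine HaltsWithin.mono (HaltsWithin.ite (N := 16) (fun hb => .mono (.setI ?_) (by decide)
        fun _ h => h)
      (fun hb => HaltsWithin.mono (HaltsWithin.skip (P := fun v => v = u) rfl) (by decide) ?_))
      (by simp [Test.cost, IExp.cost]) fun t ht => ht
    · refine ⟨by rw [setInt_of_ne _ (by decide), hu10], Or.inr ⟨m + 1, ?_, Nat.succ_pos m, le_rfl,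
        hiff.1 hb⟩⟩
      simp only [IExp.eval, setInt_self, hu4]
    · rintro v rfl
      refine ⟨hu10, ?_⟩
      rcases hI with h | ⟨L, h1, h2, h3, h4⟩
      · refine Or.inl fun L hL hLm => ?_
        rcases Nat.lt_or_ge m L with hlt | hge
        · obtain rfl : L = m + 1 := by omega
          exact fun h => hb (hiff.2 h)
        · exact h L hL hge
      · exact Or.inr ⟨L, by rw [hu11, h1], h2, by omega, h4⟩
  case c =>
    simp only [IExp.cost]
    omega
  case post =>
    rintro t ⟨-, h | h⟩
    · obtain ⟨L, h1, h2, h3⟩ := hcyc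
      exact absurd h3 (h L h1 h2)
    · exact h

/-- An orbit of a self-map of an `n`-element set is periodic from index `n` on. -/
theorem exists_iterate_period (σ : Fin n → Fin n) (i : Fin n) :
    ∃ L, 0 < L ∧ L ≤ n ∧ σ^[n + L] i = σ^[n] i := by
  obtain ⟨a, ha, b, hb, hab, he⟩ := Finset.exists_ne_map_eq_of_card_lt_of_maps_to
    (s := Finset.range (n + 1)) (t := (Finset.univ : Finset (Fin n))) (by simp)
    (f := fun t => σ^[t] i) (fun _ _ => Finset.mem_coe.2 (Finset.mem_univ _))
  wlog hlt : a < b generalizing a b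
  · exact this b hb a ha hab.symm he.symm (by omega)
  simp only [Finset.mem_range] at ha hb he
  refine ⟨b - a, by omega, by omega, ?_⟩
  rw [show n + (b - a) = (n - a) + b by omega, Function.iterate_add_apply, ← he,
    ← Function.iterate_add_apply]
  congr 1; omega

/-- The exponent of the row of a critical node, reduced modulo the number `L` in register `11`: the
remainder of `k - 2 * q`, with `k` the integer input and `q` in register `7`. As subtraction
truncates, `L - 2 * q % L` takes the place of `-2 * q`. -/
abbrev residueExp : IExp :=
  .mod (.add (reg 1) (.sub (reg 11) (.mod (.add (reg 7) (reg 7)) (reg 11)))) (reg 11)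

theorem residue_modEq (k q L : ℕ) (hL : 0 < L) :
    q + q + (k + (L - (q + q) % L)) % L ≡ k [MOD L] := by
  have h1 : (k + (L - (q + q) % L)) % L ≡ k + (L - (q + q) % L) [MOD L] := Nat.mod_modEq _ _
  have h2 : q + q ≡ (q + q) % L [MOD L] := (Nat.mod_modEq _ _).symm
  refine (h2.add h1).trans ?_
  have h3 : (q + q) % L < L := Nat.mod_lt _ hL
  rw [show (q + q) % L + (k + (L - (q + q) % L)) = k + L by omega]
  exact Nat.add_modEq_right

/-- For the critical node `c` in register `3`, fill row `c` of array `11` with the row of a power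
`B ^ (q + e)`, with `e` given by `residueExp`. -/
def critRowProg : Prog :=
  .seq (walkFromProg 0) <| .seq cycleProg <| .seq (setReg 12 residueExp) <|
    .seq (walkFromProg 12) <|
      rowLoop 0 4 11 (reg 3) .skip (.mul (rreg 12) (.get 8 (reg 9) (reg 4)))

@[simp] theorem intWrites_critRowProg : critRowProg.intWrites =
    [9, 4, 9, 4, 11, 10, 4, 10, 11, 4, 12, 9, 4, 9, 4, 4, 4] := rfl

@[simp] theorem realWrites_critRowProg : critRowProg.realWrites = [12, 12, 12, 12, 11] := rfl

theorem critRowProg_spec (hn : 0 < n) (h0 : s.int 0 0 0 = n) {B : Matrix (Fin n) (Fin n) ℝ≥0}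
    (hB : ClosedLeOne B) (h6 : s.HasMat 6 B) {q k : ℕ} (hq : n * n ≤ q) (h7 : s.int 7 0 0 = q)
    (h1 : s.int 1 0 0 = k) (h8 : s.HasMat 8 (mpow B q)) {i : Fin n} (h3 : s.int 3 0 0 = i)
    {σ : Fin n → Fin n} (hσ : ∀ l, s.int 8 (σ^[l] i) 0 = σ^[l + 1] i + 1)
    (hE : ∀ l, UnitEdge B (σ^[l] i) (σ^[l + 1] i)) :
    HaltsWithin critRowProg s (500 * n) fun t =>
      (∃ e d, EvPeriod (fun r => mpow B r i) d ∧ q + q + e ≡ k [MOD d] ∧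
        ∀ j : Fin n, t.real 11 i j = mpow B (q + e) i j) ∧
      ∀ r ≠ (i : ℕ), t.real 11 r = s.real 11 r := by
  refine HaltsWithin.mono (.andThen (walkFromProg_spec (N := n) (c := fun l => σ^[l] i) (by decide)
    (by decide) h0 h6 hσ h3) fun t ht ⟨ht9, _⟩ =>
    .andThen (cycleProg_spec (n := n) (c := fun l => σ^[n + l] i) ?b1 ?b2 ht9
      (exists_iterate_period σ i)) fun u hu ⟨L, h11, hL0, hLn, hcyc⟩ =>
    .mono (.seq (.setI (.andThen (walkFromProg_spec (N := (k + (L - (q + q) % L)) % L)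
      (c := fun l => σ^[l] i) (by decide) (by decide) ?d1 (B := B) ?d2 ?d3 ?d4)
      fun v hv ⟨hv9, hv12⟩ => .mono (HaltsWithin.rowLoop (n := n) (r := i)
          (f := fun j => mpow B (q + (k + (L - (q + q) % L)) % L) i j) (c := 1) ?e1
          (by decide) (by simp) (by simp) (by simp) ?e2) le_rfl ?post))) (M := 200 * n + 100) ?c2
          fun _ h => h) ?c fun _ h => h
  case b1 => rw [ht.int 0 (by simp), h0]
  case b2 => exact fun l => by rw [ht.int 8 (by simp)]; exact hσ (n + l)
  case d1 =>
    simp only [IExp.eval, setInt_self]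
    rw [h11, hu.int 1 (by simp), hu.int 7 (by simp), ht.int 1 (by simp), ht.int 7 (by simp), h1, h7]
  case d2 => exact h6.congr (by change u.real 6 = _; rw [hu.real 6 (by simp), ht.real 6 (by simp)])
  case d3 =>
    intro l
    rw [setInt_of_ne _ (by decide), hu.int 8 (by simp), ht.int 8 (by simp), hσ]
  case d4 =>
    rw [setInt_of_ne _ (by decide), hu.int 3 (by simp), ht.int 3 (by simp), h3]
    rfl
  case e1 =>
    rw [hv.int 0 (by simp), setInt_of_ne _ (by decide), hu.int 0 (by simp), ht.int 0 (by simp), h0]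
  case e2 =>
    intro j w hw _ hj
    refine .skip ⟨?_, ?_⟩
    · simp only [IExp.eval]
      rw [hw.int 3 (by simp), hv.int 3 (by simp), setInt_of_ne _ (by decide), hu.int 3 (by simp),
        ht.int 3 (by simp), h3]
    · simp only [RExp.eval, IExp.eval]
      rw [hw.real 12 (by simp), hv12, hw.int 9 (by simp), hv9, hj, hw.real 8 (by simp),
        hv.real 8 (by simp)]
      change _ * u.real 8 _ _ = _
      rw [hu.real 8 (by simp), ht.real 8 (by simp), h8]
      exact (mpow_row_walk hB (fun l => σ^[l] i) _ (fun l _ => hE l) hq j).symm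
  case post =>
    rintro w ⟨hw1, hw2⟩
    refine ⟨⟨_, L, evPeriod_of_walk hB (fun l => σ^[l] i) hE hcyc, residue_modEq k q L hL0, hw1⟩,
      fun r hr => ?_⟩
    rw [hw2 r hr, hv.real 11 (by simp)]
    change u.real 11 r = _
    rw [hu.real 11 (by simp), ht.real 11 (by simp)]
  case c2 =>
    have := Nat.mod_lt (k + (L - (q + q) % L)) hL0
    simp only [IExp.cost, RExp.cost]
    omega
  case c =>
    omega

/-- Fill the rows of array `11`: those of critical nodes as in `critRowProg`, the others with
zeros. -/
def rowsProg : Prog :=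
  forLoop 0 3 <| .ite (.ile (.const 1) (.get 8 (reg 3) (.const 0))) critRowProg
    (rowLoop 0 4 11 (reg 3) .skip .zero)

@[simp] theorem intWrites_rowsProg : rowsProg.intWrites =
    [3, 9, 4, 9, 4, 11, 10, 4, 10, 11, 4, 12, 9, 4, 9, 4, 4, 4, 4, 4, 3] := rfl

@[simp] theorem realWrites_rowsProg : rowsProg.realWrites = [12, 12, 12, 12, 11, 11] := rfl

/-- `f` is the row of the node `c` in the second factor of the factorization of the periodic power
with residue `k` in `mmul_eq_periodic_power`. -/
def IsFactorRow (B : Matrix (Fin n) (Fin n) ℝ≥0) (q k : ℕ) (c : Fin n) (f : Fin n → ℝ≥0) : Prop :=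
  (¬ UnitNode B c → f = 0) ∧ (UnitNode B c → ∃ e d, EvPeriod (fun r => mpow B r c) d ∧
    q + q + e ≡ k [MOD d] ∧ f = mpow B (q + e) c)

theorem rowsProg_spec (hn : 0 < n) (h0 : s.int 0 0 0 = n) {B : Matrix (Fin n) (Fin n) ℝ≥0}
    (hB : ClosedLeOne B) (h6 : s.HasMat 6 B) {q k : ℕ} (hq : n * n ≤ q) (h7 : s.int 7 0 0 = q)
    (h1 : s.int 1 0 0 = k) (h8 : s.HasMat 8 (mpow B q))
    (hsucc : ∀ i : Fin n, SuccEntry B i (s.int 8 i 0)) :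
    HaltsWithin rowsProg s (600 * n ^ 2) fun t =>
      ∀ c : Fin n, IsFactorRow B q k c fun j => t.real 11 c j := by
  classical
  refine HaltsWithin.mono (P := fun t => ∀ c : Fin n, (c : ℕ) < n →
      IsFactorRow B q k c fun j => t.real 11 c j)
    (HaltsWithin.forLoop (N := n) (c := 500 * n + 9) (I := fun m t =>
      ∀ c : Fin n, (c : ℕ) < m → IsFactorRow B q k c fun j => t.real 11 c j) h0 (by decide)
      (by simp) (by simp) (fun _ _ _ h => h) (by simp) ?step) ?c fun t ht c => ht c c.2
  case step =>
    intro i hi t hf h3 hI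
    have hiff : (Test.ile (.const 1) (.get 8 (reg 3) (.const 0))).Holds t ↔
        UnitNode B ⟨i, hi⟩ := by
      rw [← (hsucc ⟨i, hi⟩).pos_iff]
      simp only [Test.Holds, IExp.eval, h3]
      rw [hf.int 8 (by simp)]
    have hstep : ∀ t' : Store, (IsFactorRow B q k ⟨i, hi⟩ fun j => t'.real 11 i j) →
        (∀ r ≠ i, t'.real 11 r = t.real 11 r) → ∀ c : Fin n, (c : ℕ) < i + 1 →
        IsFactorRow B q k c fun j => t'.real 11 c j := by
      intro t' h1 h2 c hc
      rcases Nat.lt_succ_iff_lt_or_eq.1 hc with hc | hc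
      · rw [h2 c hc.ne]
        exact hI c hc
      · have : c = ⟨i, hi⟩ := Fin.ext hc
        subst this
        exact h1
    have ht0 : t.int 0 0 0 = n := by rw [hf.int 0 (by simp), h0]
    refine HaltsWithin.mono (HaltsWithin.ite (N := 500 * n) (fun hb => ?yes) (fun hb => ?no))
      (by simp [Test.cost, IExp.cost]; omega) fun t ht => ht
    case yes =>
      choose! σ hσ using fun (i : Fin n) (h : UnitNode B i) =>
        (hsucc i).resolve_left fun h' => h'.2 h
      have hnode : ∀ l, UnitNode B (σ^[l] ⟨i, hi⟩) := by
        intro l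
        induction l with
        | zero => exact hiff.1 hb
        | succ l ih =>
          rw [Function.iterate_succ_apply']
          exact (hσ _ ih).2.right
      refine (critRowProg_spec hn ht0 hB (h6.congr (hf.real 6 (by simp))) hq (k := k)
        (by rw [hf.int 7 (by simp), h7]) (by rw [hf.int 1 (by simp), h1])
        (h8.congr (hf.real 8 (by simp))) (i := ⟨i, hi⟩) h3 (σ := σ) ?_ ?_).mono le_rfl ?_
      · intro l
        rw [hf.int 8 (by simp), Function.iterate_succ_apply']
        exact (hσ _ (hnode l)).1
      · intro l
        rw [Function.iterate_succ_apply']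
        exact (hσ _ (hnode l)).2
      · rintro u ⟨⟨e, d, h1, h2, h3⟩, h4⟩
        exact hstep u ⟨fun h => absurd (hiff.1 hb) h, fun _ => ⟨e, d, h1, h2, funext h3⟩⟩ h4
    case no =>
      refine (HaltsWithin.rowLoop (n := n) (r := i) (f := fun _ => 0) (c := 1) ht0 (by decide)
        (by simp) (by simp) (by simp) ?_).mono (by simp only [IExp.cost, RExp.cost]; omega) ?_
      · intro j w hw _ hj
        refine .skip ⟨?_, rfl⟩
        simp only [IExp.eval]
        rw [hw.int 3 (by simp), h3]
      · rintro u ⟨h1, h2⟩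
        exact hstep u ⟨fun _ => funext h1, fun h => absurd (hiff.2 h) hb⟩ h2
  case c =>
    have h1 : n ≤ n ^ 2 := Nat.le_self_pow (by decide) n
    have h2 : 0 < n ^ 2 := by positivity
    calc _ = 500 * n ^ 2 + 26 * n + 13 := by ring
      _ ≤ _ := by omega

/-- The critical columns of `B ^ q` are multiplied by the critical rows that `rowsProg` computes. -/
theorem periodicPower_computable_cubic_log :
    ∃ (p : Prog) (C : ℕ), ∀ (n : ℕ) (A : Matrix (Fin n) (Fin n) ℝ≥0) (k : ℕ),
      Irred A → mcgm A ≠ 0 → k < cyclicity (normalized A) →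
      HaltsWithin p (input A 0 k) (C * (n ^ 3 * (Nat.log 2 n + 1))) fun s =>
        ∀ r, transient (normalized A) ≤ r → r ≡ k [MOD cyclicity (normalized A)] →
          s.outMatrix n = mpow (normalized A) r := by
  refine ⟨.seq prepProg (.seq rowsProg (mulMat 8 11 2 (rreg 3))), 2500, fun n A k hirr hA _ => ?_⟩
  have hn := pos_of_mcgm_ne_zero hA
  have hB := closedLeOne_normalized A
  refine HaltsWithin.mono (.andThen (prepProg_spec (A := A) hn (by simp [input])
    (fun i j => by simp [input]) hirr hA) fun t _ ⟨h0, h1, _, hM, ⟨q, hq, h7, hpow⟩, hs⟩ =>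
    .andThen (rowsProg_spec (k := k) hn h0 hB hM hq h7 (by rw [h1]; simp [input]) hpow hs)
    fun u hu hR => .mono (mulMat_spec (P := mmul (mpow (normalized A) q) fun i j => u.real 11 i j)
      (by decide) (by decide) (by decide) (by decide) (by decide) hn
      (by rw [hu.int 0 (by simp), h0]) (hpow.congr (hu.real 8 (by simp))) (fun i j => rfl)
      fun t i j _ _ _ h => h) le_rfl fun v hv r hr hrk => ?_) ?_ fun _ h => h
  · have hout : v.outMatrix n = mmul (mpow (normalized A) q) fun i j => u.real 11 i j := by
      funext i j
      exact hv i j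
    rw [hout]
    exact mmul_eq_periodic_power hB (mcgm_normalized hA) (irred_normalized hirr hA)
      (exists_unitNode_normalized hA) hq (fun c hc => (hR c).1 hc) (fun c hc => (hR c).2 hc) hr hrk
  · simp only [RExp.cost, IExp.cost]
    have h2 : n ^ 2 ≤ n ^ 3 := Nat.pow_le_pow_right hn (by decide)
    have h4 : n ^ 3 ≤ n ^ 3 * (Nat.log 2 n + 1) := Nat.le_mul_of_pos_right _ (Nat.succ_pos _)
    omega

end PowerAlgorithm

end MaxTimes

open MaxTimes in
theorem theorem4p10 :
    -- deciding whether `x` belongs to the attraction cone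
    (∃ (p : Prog) (C : ℕ), ∀ (n : ℕ) (A : Matrix (Fin n) (Fin n) ℝ≥0) (x : Fin n → ℝ≥0) (t : ℕ),
      Irred A → mcgm A ≠ 0 →
      HaltsWithin p (input A x t) (C * (n ^ 3 * (Nat.log 2 n + 1))) fun s =>
        (x ∈ Attr (normalized A) t ∧ s.outInt = 1) ∨
          (x ∉ Attr (normalized A) t ∧ s.outInt = 0)) ∧
    -- computing the periodic power with a given residue of the exponent
    (∃ (p : Prog) (C : ℕ), ∀ (n : ℕ) (A : Matrix (Fin n) (Fin n) ℝ≥0) (k : ℕ),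
      Irred A → mcgm A ≠ 0 → k < cyclicity (normalized A) →
      HaltsWithin p (input A 0 k) (C * (n ^ 3 * (Nat.log 2 n + 1))) fun s =>
        ∀ r, transient (normalized A) ≤ r → r ≡ k [MOD cyclicity (normalized A)] →
          s.outMatrix n = mpow (normalized A) r) ∧
    -- computing the ultimate period of the orbit of `x`
    (∃ (p : Prog) (C : ℕ), ∀ (n : ℕ) (A : Matrix (Fin n) (Fin n) ℝ≥0) (x : Fin n → ℝ≥0),
      Irred A → mcgm A ≠ 0 →
      HaltsWithin p (input A x 0) (C * (n ^ 3 * (Nat.log 2 n + 1))) fun s =>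
        IsUltimatePeriod (normalized A) x s.outInt) :=
  ⟨attr_decidable_cubic_log, periodicPower_computable_cubic_log,
    ultimatePeriod_computable_cubic_log⟩
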